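/- **Setting.** Let $p\in\{0,\dots,7\}$ and let $k\ge 0$ be an integer ($k=p+1-d$ in the case of $d$ extended dimensions); put $n=k+9-p$. Let $$H(r)=(r/r_0)^{p-7}\ \ (p<7),\qquad H(r)=-\tfrac{2\pi}{g_s}\log(r/r_0)\ \ (p=7).$$ An *asymptotically D$p$-brane metric measure space* $(X,\mathsf d,\mathfrak m)$ with singular set $\mathcal S$ consists of a complete separable metric space $(X,\mathsf d)$, a closed set $\mathcal S\subset X$ with dense complement, a smooth Riemannian metric $g$ on the smooth $n$-manifold $X\setminus\mathcal S$ and a smooth function $f$ on $X\setminus\mathcal S$ such that: * on $X\setminus\mathcal S$, $\mathsf d(x,y)$ is the infimum of the $g$-lengths of curves in $X\setminus\mathcal S$ from $x$ to $y$; * $\mathfrak m=\mathrm e^{f}\,\mathrm{dvol}_g$ on $X\setminus\mathcal S$, and $\mathfrak m(\mathcal S)=0$; * there are finitely many pairwise disjoint open sets (ends) in $X\setminus\mathcal S$, each with constants $r_0,g_s,\varepsilon,c>0$, a complete connected $k$-dimensional smooth Riemannian manifold $(M,\mathrm dx^2)$ (the parallel factor) and a diffeomorphism onto the end from $M\times\mathbb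 S^{8-p}\times(0,\varepsilon)\ni(x,\Theta,r)$, equivalently from $M\times\{y\in\mathbb R^{9-p}:0<|y|<\varepsilon\}$ with $y=r\Theta$. As $r\to0$, uniformly on the end, $g$ is asymptotic to $g_0=\mathrm dx^2+H(r)\,(\mathrm dr^2+r^2\mathrm ds^2_{\mathbb S^{8-p}})$, i.e. for every $\eta>0$ one has $|g-g_0|\le\eta\, g_0$ as quadratic forms for all small $r$, and $\mathrm e^{f}/H^{(p-7)/2}\to c$; * $\mathcal S$ is the set $\{r=0\}$ of tips of the ends: for every $\delta>0$, the union of $\mathcal S$ with the sets $\{r<\delta\}$ of all ends is open in $X$, and for every $\delta>0$ smaller than the $\varepsilon$ of every end, the union of $\mathcal S$ with the sets $\{r\le\delta\}$ of all ends is closed in $X$. (For $p\le5$ this forces $\mathcal S=\emptyset$.) For $u\in L^2(X,\mathfrak m)$, a function $G\in L^2(X,\mathfrak m)$ is a relaxed gradient of $u$ if there are Lipschitz functions $u_j\in L^2(X,\mathfrak m)$ with $u_j\to u$ in $L^2$ whose slopes $|Du_j|(x)=\limsup_{y\to x}|u_j(y)-u_j(x)|/\mathsf d(y,x)$ lie in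 $L^2$ and converge weakly in $L^2$ to some $\tilde G\le G$. Let $\mathsf{Ch}(u)=\frac12\min\int_X G^2\,\mathrm d\mathfrak m$ over all relaxed gradients $G$ of $u$ ($+\infty$ if there is none), and let $W^{1,2}(X,\mathsf d,\mathfrak m)=\{u\in L^2:\mathsf{Ch}(u)<\infty\}$ with norm $\|u\|_{W^{1,2}}=(\|u\|_{L^2}^2+2\,\mathsf{Ch}(u))^{1/2}$. **Proposition.** Let $(X,\mathsf d,\mathfrak m)$ be an asymptotically D$p$-brane metric measure space with singular set $\mathcal S$. If $p=6$ or $p=7$, assume also that the parallel factor $M$ of each end has finite volume. Then $W^{1,2}(X,\mathsf d,\mathfrak m)$ is a Hilbert space, it contains all smooth functions compactly supported in $X\setminus\mathcal S$ (extended by zero), and the closure $W^{1,2}_{0,\mathcal S}(X,\mathsf d,\mathfrak m)$ of the set of these functions in the $W^{1,2}$-topology satisfies $$W^{1,2}_{0,\mathcal S}(X,\mathsf d,\mathfrak m)=W^{1,2}(X,\mathsf d,\mathfrak m).$$ More precisely, the identity map $u\mapsto u$ is an isomorphism of Hilbert spaces between $W^{1,2}_{0,\mathcal S}(X,\mathsf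 d,\mathfrak m)$ and $W^{1,2}(X,\mathsf d,\mathfrak m)$. -/

import Mathlib

open MeasureTheory Filter Topology Bundle Manifold Set
open scoped ENNReal NNReal ContDiff

universe u v

noncomputable section

/-! ### Cheeger energy of a metric measure space -/

section Cheeger

variable {X : Type*} [MetricSpace X]

/-- The slope `|Df|(x) = limsup_{y → x} |f y - f x| / d(y, x)`; it is `0` at isolated points, where
the punctured neighbourhood filter is trivial. It is finite when `f` is Lipschitz. -/
def lipSlope (f : X → ℝ) (x : X) : ℝ :=
  (limsup (fun y => ENNReal.ofReal (|f y - f x| / dist y x)) (𝓝[≠] x)).toReal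

variable [MeasurableSpace X]

/-- `G` is a relaxed gradient of `f`: there are Lipschitz functions `F j` in `L²`, with slopes in
`L²`, such that `F j → f` strongly in `L²`, the slopes converge weakly in `L²` to some `G'`, and
`G' ≤ G` almost everywhere. -/
def IsRelaxedGradient (m : Measure X) (f G : Lp ℝ 2 m) : Prop :=
  ∃ (F : ℕ → X → ℝ) (hF : ∀ j, MemLp (F j) 2 m) (hD : ∀ j, MemLp (lipSlope (F j)) 2 m)
    (G' : Lp ℝ 2 m),
    (∀ j, ∃ K : ℝ≥0, LipschitzWith K (F j)) ∧
    Tendsto (fun j => (hF j).toLp (F j)) atTop (𝓝 f) ∧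
    (∀ h : Lp ℝ 2 m, Tendsto (fun j => inner ℝ ((hD j).toLp (lipSlope (F j))) h) atTop
      (𝓝 (inner ℝ G' h))) ∧
    (∀ᵐ x ∂m, G' x ≤ G x)

/-- The Cheeger energy: half of the least value of `∫ G² dm` over all relaxed gradients `G` of `f`,
and `∞` if `f` has no relaxed gradient. -/
def cheegerEnergy (m : Measure X) (f : Lp ℝ 2 m) : ℝ≥0∞ :=
  ⨅ (G : Lp ℝ 2 m) (_ : IsRelaxedGradient m f G), ENNReal.ofReal (‖G‖ ^ 2 / 2)

/-- The Hilbert space `W`, viewed inside `L²(X, m)` through the injective linear map `j`, is the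
Sobolev space `W^{1,2}(X, d, m)`: its elements are the functions of finite Cheeger energy, and
`‖u‖² = ‖u‖²_{L²} + 2 Ch(u)`. (This determines `W` and `j` up to a unique isometric isomorphism.) -/
structure IsSobolevHilbertSpace (m : Measure X) (W : Type*) [NormedAddCommGroup W]
    [InnerProductSpace ℝ W] (j : W →ₗ[ℝ] Lp ℝ 2 m) : Prop where
  complete : CompleteSpace W
  injective : Function.Injective j
  range_eq : Set.range j = {f : Lp ℝ 2 m | cheegerEnergy m f < ⊤}
  norm_sq : ∀ u : W, ‖u‖ ^ 2 = ‖j u‖ ^ 2 + 2 * (cheegerEnergy m (j u)).toReal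

end Cheeger

/-! ### The volume measure of a Riemannian manifold -/

section Volume

variable {n : ℕ} {U : Type*} [TopologicalSpace U] [ChartedSpace (EuclideanSpace ℝ (Fin n)) U]
  [RiemannianBundle (fun x : U => TangentSpace (𝓡 n) x)]

/-- The Gram matrix `g(∂ᵢ, ∂ⱼ)` at the point of coordinates `y`, in the chart around `x`. -/
def chartGram (x : U) (y : EuclideanSpace ℝ (Fin n)) : Matrix (Fin n) (Fin n) ℝ :=
  let z : U := (chartAt (EuclideanSpace ℝ (Fin n)) x).symm y
  let b : Fin n → TangentSpace (𝓡 n) z := fun i =>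
    mfderiv 𝓘(ℝ, EuclideanSpace ℝ (Fin n)) (𝓡 n) (chartAt (EuclideanSpace ℝ (Fin n)) x).symm y
      (EuclideanSpace.single i (1 : ℝ) : EuclideanSpace ℝ (Fin n))
  Matrix.of fun i j => inner ℝ (b i) (b j)

variable [MeasurableSpace U]

/-- The measure `√(det g) dy` of the chart around `x`, as a measure on the manifold (it is carried
by the domain of the chart). -/
def chartVolume (x : U) : Measure U :=
  Measure.map (chartAt (EuclideanSpace ℝ (Fin n)) x).symm
    ((volume.restrict (chartAt (EuclideanSpace ℝ (Fin n)) x).target).withDensity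
      fun y => ENNReal.ofReal (Real.sqrt (chartGram x y).det))

variable (n U) in
/-- The Riemannian volume: the measure given by `√(det g) dy` in each chart. These local measures
agree on overlaps, so their supremum is the measure obtained by gluing them. -/
def riemannianVolume : Measure U := ⨆ x : U, chartVolume (n := n) x

end Volume

/-! ### Asymptotically Dp-brane spaces -/

/-- The harmonic function `H` of a Dp-brane. -/
def braneH (p : ℕ) (gs r₀ r : ℝ) : ℝ :=
  if p = 7 then -(2 * Real.pi / gs) * Real.log (r / r₀) else (r / r₀) ^ ((p : ℤ) - 7)

/-- The transverse space `ℝ^{9-p}`. Away from the origin it is `(0, ∞) × 𝕊^{8-p}` in polar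
coordinates, with `dr² + r² ds²` the Euclidean metric. -/
abbrev Transverse (p : ℕ) : Type := EuclideanSpace ℝ (Fin (9 - p))

/-- An end, asymptotic to a Dp-brane singularity, of a weighted Riemannian manifold
`(U, g, e^f dvol)` of dimension `k + (9 - p)`; `k` is the number of internal dimensions parallel
to the brane. The end is an open subset of `U` diffeomorphic to `M × {y : 0 < ‖y‖ < ε}`, where
`M` is a complete Riemannian manifold of dimension `k` and `r = ‖y‖`. -/
structure DpBraneEnd (p k : ℕ) {U : Type u} [MetricSpace U]
    [ChartedSpace (EuclideanSpace ℝ (Fin (k + (9 - p)))) U]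
    [RiemannianBundle (fun x : U => TangentSpace (𝓡 (k + (9 - p))) x)]
    (f : U → ℝ) where
  /-- the parallel factor, with metric `dx²` -/
  M : Type v
  [metricSpace : MetricSpace M]
  [completeSpace : CompleteSpace M]
  [secondCountable : SecondCountableTopology M]
  [measurableSpace : MeasurableSpace M]
  [borelSpace : BorelSpace M]
  [chartedSpace : ChartedSpace (EuclideanSpace ℝ (Fin k)) M]
  [isManifold : IsManifold (𝓡 k) ∞ M]
  [riemannianBundle : RiemannianBundle (fun x : M => TangentSpace (𝓡 k) x)]
  [smoothMetric : IsContMDiffRiemannianBundle (𝓡 k) ∞ (EuclideanSpace ℝ (Fin k))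
    (fun x : M => TangentSpace (𝓡 k) x)]
  [isRiemannianManifold : IsRiemannianManifold (𝓡 k) M]
  /-- the length scale of the brane -/
  r₀ : ℝ
  r₀_pos : 0 < r₀
  /-- the string coupling -/
  gs : ℝ
  gs_pos : 0 < gs
  /-- the size of the end -/
  ε : ℝ
  ε_pos : 0 < ε
  /-- the coordinates of the end -/
  chart : PartialDiffeomorph ((𝓡 k).prod 𝓘(ℝ, Transverse p)) (𝓡 (k + (9 - p)))
    (M × Transverse p) U ∞
  source_eq : chart.source = {q | 0 < ‖q.2‖ ∧ ‖q.2‖ < ε}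
  /-- `g` is asymptotic to `dx² + H(r) (dr² + r² ds²)` as `r → 0`, uniformly -/
  metric_asymptotic : ∀ η : ℝ, 0 < η → ∃ δ : ℝ, 0 < δ ∧ δ ≤ ε ∧
    ∀ (x : M) (y : Transverse p), 0 < ‖y‖ → ‖y‖ < δ →
      ∀ (v : TangentSpace (𝓡 k) x) (w : Transverse p),
        |‖mfderiv ((𝓡 k).prod 𝓘(ℝ, Transverse p)) (𝓡 (k + (9 - p))) chart (x, y) (v, w)‖ ^ 2
          - (‖v‖ ^ 2 + braneH p gs r₀ ‖y‖ * ‖w‖ ^ 2)|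
        ≤ η * (‖v‖ ^ 2 + braneH p gs r₀ ‖y‖ * ‖w‖ ^ 2)
  /-- the multiplicative constant in the asymptotics of the weight -/
  c : ℝ
  c_pos : 0 < c
  /-- `e^f ∼ c H^{(p-7)/2}` as `r → 0`, uniformly -/
  weight_asymptotic : ∀ η : ℝ, 0 < η → ∃ δ : ℝ, 0 < δ ∧ δ ≤ ε ∧
    ∀ (x : M) (y : Transverse p), 0 < ‖y‖ → ‖y‖ < δ →
      |Real.exp (f (chart (x, y))) / braneH p gs r₀ ‖y‖ ^ (((p : ℝ) - 7) / 2) - c| ≤ η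

attribute [instance] DpBraneEnd.metricSpace DpBraneEnd.completeSpace DpBraneEnd.secondCountable
  DpBraneEnd.measurableSpace DpBraneEnd.borelSpace DpBraneEnd.chartedSpace DpBraneEnd.isManifold
  DpBraneEnd.riemannianBundle DpBraneEnd.smoothMetric DpBraneEnd.isRiemannianManifold

/-- An asymptotically Dp-brane structure on the metric space `X` with singular set `S`. The regular
part `X ∖ S` is a smooth Riemannian manifold, whose distance (the infimum of the lengths of curves)
is the restriction of that of `X`, `X` is its metric completion, and near `S` the regular part
consists of finitely many Dp-brane ends, `S` being made of their tips `{r = 0}`. -/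
structure AsymptoticallyDpBrane (p k : ℕ) {X : Type u} [MetricSpace X] (S : Set X)
    [ChartedSpace (EuclideanSpace ℝ (Fin (k + (9 - p)))) ↥Sᶜ]
    [RiemannianBundle (fun x : ↥Sᶜ => TangentSpace (𝓡 (k + (9 - p))) x)] where
  isClosed : IsClosed S
  dense_compl : Dense Sᶜ
  isManifold : IsManifold (𝓡 (k + (9 - p))) ∞ ↥Sᶜ
  smoothMetric : IsContMDiffRiemannianBundle (𝓡 (k + (9 - p))) ∞
    (EuclideanSpace ℝ (Fin (k + (9 - p)))) (fun x : ↥Sᶜ => TangentSpace (𝓡 (k + (9 - p))) x)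
  isRiemannianManifold : IsRiemannianManifold (𝓡 (k + (9 - p))) ↥Sᶜ
  /-- the logarithm of the weight -/
  f : ↥Sᶜ → ℝ
  smooth_f : ContMDiff (𝓡 (k + (9 - p))) 𝓘(ℝ, ℝ) ∞ f
  /-- the number of ends -/
  N : ℕ
  /-- the ends -/
  brane : Fin N → DpBraneEnd.{u, v} p k f
  disjoint : ∀ a b : Fin N, a ≠ b → Disjoint (brane a).chart.target (brane b).chart.target
  /-- `{r < δ}`, tips included, is a neighbourhood of `S` in `X` -/
  isOpen_nhd : ∀ δ : ℝ, 0 < δ → IsOpen (S ∪ ⋃ a : Fin N, Subtype.val ''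
    ((brane a).chart '' {q | 0 < ‖q.2‖ ∧ ‖q.2‖ < δ ∧ ‖q.2‖ < (brane a).ε}))
  /-- `{r ≤ δ}`, tips included, is closed in `X`: the ends are glued to the rest of the space only
  along their outer boundaries, and the regular part contains no tip -/
  isClosed_nhd : ∀ δ : ℝ, 0 < δ → (∀ a, δ < (brane a).ε) → IsClosed (S ∪ ⋃ a : Fin N, Subtype.val ''
    ((brane a).chart '' {q | 0 < ‖q.2‖ ∧ ‖q.2‖ ≤ δ}))

namespace AsymptoticallyDpBrane

variable {p k : ℕ} {X : Type u} [MetricSpace X] {S : Set X}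
  [ChartedSpace (EuclideanSpace ℝ (Fin (k + (9 - p)))) ↥Sᶜ]
  [RiemannianBundle (fun x : ↥Sᶜ => TangentSpace (𝓡 (k + (9 - p))) x)]

/-- The measure `m = e^f dvol_g` of `X`; the singular set has measure zero. -/
def measure [MeasurableSpace X] (D : AsymptoticallyDpBrane.{u, v} p k S) : Measure X :=
  Measure.map Subtype.val
    ((riemannianVolume (k + (9 - p)) ↥Sᶜ).withDensity fun x => ENNReal.ofReal (Real.exp (D.f x)))

/-- Each parallel factor has finite volume. -/
def FiniteVolumeFactors (D : AsymptoticallyDpBrane.{u, v} p k S) : Prop :=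
  ∀ a, riemannianVolume k (D.brane a).M Set.univ < ⊤

/-- The (classes of) smooth functions with compact support in `X ∖ S`, extended by zero. -/
def testFunctions [MeasurableSpace X] (D : AsymptoticallyDpBrane.{u, v} p k S) :
    Set (Lp ℝ 2 D.measure) :=
  {u | ∃ φ : ↥Sᶜ → ℝ, ContMDiff (𝓡 (k + (9 - p))) 𝓘(ℝ, ℝ) ∞ φ ∧ HasCompactSupport φ ∧
    u =ᵐ[D.measure] Function.extend Subtype.val φ 0}

end AsymptoticallyDpBrane

end

/-! The tips have zero capacity, and the logarithmic cutoff shows it. On an end let χ_δ be 0 for r ≤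
δ², 1 for r ≥ δ, and affine in log r in between. Near the tip g is comparable to dx² + H dy², so the
square of the slope of χ_δ is at most 8 / (H r² log² δ). If p ≤ 5, then H r² ≥ r₀² near the tip and
the slope tends to 0 uniformly. If p = 6 or 7, the weight H^{(p-7)/2} and the volume element
H^{(9-p)/2} multiply to H, which cancels the 1/H; the energy of χ_δ is then at most a constant times
vol(M) log^{-2} δ times the integral of |y|^{-2} over δ² ≤ |y| ≤ δ in ℝ^{9-p}. That dimension is at
least 2, so the integral is O(|log δ|) and the energy is O(1/|log δ|). Finite volume of M is used
exactly here.

Compact support also requires a cutoff far away in the noncompact directions. It comes from a local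
Hopf–Rinow argument in the region away from the tips, which lies in a complete set
(`exists_cutoff`). After truncation, the two cutoffs and mollification in charts, every Lipschitz
function F in L² is an L² limit of test functions whose slopes have asymptotically no larger L² norm
than that of F (`AsymptoticallyDpBrane.exists_smooth_approx`).

The rest is Hilbert space theory. Mazur's lemma and the parallelogram law in L² identify the Cheeger
energy with half the square of the relaxed seminorm obtained from Lipschitz functions and the L²
norms of their slopes. By the approximation result, relaxing from test functions alone gives the
same seminorm (`relax_testRel_iff`). For test functions the slope is the norm of the differential,
hence obeys the parallelogram law, and this law survives relaxation: W^{1,2} is a Hilbert space.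
Finally, by the parallelogram law and lower semicontinuity, an approximating family with nearly
optimal seminorms converges in the graph norm and not merely in L²
(`QuadraticRelation.exists_rel_norm_sub_lt`), which is the density of test functions. -/

noncomputable section

set_option linter.unusedSectionVars false

/-! ### Relaxation of quadratic functionals on a Hilbert space -/

section Relaxation

variable {H : Type*} [NormedAddCommGroup H] [InnerProductSpace ℝ H]

/-- `A f c` is read as: the seminorm of `f` is at most `c`. -/
structure QuadraticRelation (A : H → ℝ → Prop) : Prop where
  nonneg : ∀ {f c}, A f c → 0 ≤ c
  zero : A 0 0
  smul : ∀ (a : ℝ) {f c}, A f c → A (a • f) (|a| * c)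
  add : ∀ {f c g d}, A f c → A g d → A (f + g) (c + d)
  parallelogram : ∀ {f c g d}, A f c → A g d →
    ∃ s t, A (f + g) s ∧ A (f - g) t ∧ s ^ 2 + t ^ 2 ≤ 2 * (c ^ 2 + d ^ 2)

/-- The lower semicontinuous relaxation of a relation. -/
def Relax (A : H → ℝ → Prop) (f : H) (c : ℝ) : Prop :=
  ∀ ε > 0, ∃ g c', A g c' ∧ ‖g - f‖ < ε ∧ c' < c + ε

variable {A : H → ℝ → Prop}

theorem Relax.of_rel {f : H} {c : ℝ} (h : A f c) : Relax A f c :=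
  fun ε hε => ⟨f, c, h, by simpa using hε, by linarith⟩

/-- Lower semicontinuity: relaxing a second time adds nothing, as one sees by splitting ε in two. -/
theorem Relax.closed {f : H} {c : ℝ}
    (h : ∀ ε > 0, ∃ g, ‖g - f‖ < ε ∧ Relax A g (c + ε)) : Relax A f c := by
  intro ε hε
  obtain ⟨g, hg, hr⟩ := h (ε / 2) (by linarith)
  obtain ⟨g', c', hA, hg', hc'⟩ := hr (ε / 2) (by linarith)
  refine ⟨g', c', hA, ?_, by linarith⟩
  calc ‖g' - f‖ = ‖(g' - g) + (g - f)‖ := by congr 1; abel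
    _ ≤ ‖g' - g‖ + ‖g - f‖ := norm_add_le _ _
    _ < ε := by linarith

theorem Relax.mono {f : H} {c d : ℝ} (h : Relax A f c) (hcd : c ≤ d) : Relax A f d := by
  intro ε hε
  obtain ⟨g, c', hA, hg, hc⟩ := h ε hε
  exact ⟨g, c', hA, hg, by linarith⟩

theorem Relax.of_tendsto {f : H} {c : ℝ} {F : ℕ → H} {C : ℕ → ℝ} (hA : ∀ k, A (F k) (C k))
    (hF : Tendsto F atTop (𝓝 f)) (hC : Tendsto C atTop (𝓝 c)) : Relax A f c := by
  intro ε hε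
  have h1 := (Metric.tendsto_nhds.1 hF ε hε)
  have h2 := hC.eventually (gt_mem_nhds (show c < c + ε by linarith))
  obtain ⟨k, hk1, hk2⟩ := (h1.and h2).exists
  exact ⟨F k, C k, hA k, by simpa [dist_eq_norm] using hk1, hk2⟩

theorem Relax.exists_seq {f : H} {c : ℝ} (h : Relax A f c) :
    ∃ (F : ℕ → H) (C : ℕ → ℝ), (∀ k, A (F k) (C k)) ∧ Tendsto F atTop (𝓝 f) ∧
      ∀ k, C k < c + 1 / ((k : ℝ) + 1) := by
  choose F C hA hF hC using fun k : ℕ => h (1 / ((k : ℝ) + 1)) Nat.one_div_pos_of_nat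
  refine ⟨F, C, hA, ?_, hC⟩
  rw [tendsto_iff_norm_sub_tendsto_zero]
  exact squeeze_zero (fun k => norm_nonneg _) (fun k => (hF k).le)
    tendsto_one_div_add_atTop_nhds_zero_nat

/-- Only the parallelogram inequality needs more than an ε-argument. Along approximating sequences
the bounds for f + g and f - g are controlled only through the sum of their squares. They remain
bounded, so along a common subsequence both converge, and the inequality passes to the limit. -/
theorem QuadraticRelation.relax (hA : QuadraticRelation A) : QuadraticRelation (Relax A) where
  nonneg := by
    intro f c h
    by_contra hc
    push Not at hc
    obtain ⟨g, c', hg, -, hc'⟩ := h (-c) (by linarith)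
    have := hA.nonneg hg
    linarith
  zero := Relax.of_rel hA.zero
  smul := by
    intro a f c h ε hε
    obtain ⟨g, c', hg, h1, h2⟩ := h (ε / (|a| + 1)) (by positivity)
    have ha : |a| * (ε / (|a| + 1)) < ε := by
      rw [mul_div_assoc', div_lt_iff₀ (by positivity)]
      nlinarith [abs_nonneg a]
    refine ⟨a • g, |a| * c', hA.smul a hg, ?_, ?_⟩
    · rw [← smul_sub, norm_smul, Real.norm_eq_abs]
      exact lt_of_le_of_lt (mul_le_mul_of_nonneg_left h1.le (abs_nonneg a)) ha
    · have := mul_le_mul_of_nonneg_left h2.le (abs_nonneg a)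
      linarith
  add := by
    intro f c g d hf hg ε hε
    obtain ⟨f', c', hf', h1, h2⟩ := hf (ε / 2) (by linarith)
    obtain ⟨g', d', hg', h3, h4⟩ := hg (ε / 2) (by linarith)
    refine ⟨f' + g', c' + d', hA.add hf' hg', ?_, by linarith⟩
    calc ‖f' + g' - (f + g)‖ = ‖(f' - f) + (g' - g)‖ := by congr 1; abel
      _ ≤ ‖f' - f‖ + ‖g' - g‖ := norm_add_le _ _
      _ < ε := by linarith
  parallelogram := by
    intro f c g d hf hg
    have hc0 : 0 ≤ c := by
      by_contra hc
      push Not at hc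
      obtain ⟨g, c', hg, -, hc'⟩ := hf (-c) (by linarith)
      have := hA.nonneg hg
      linarith
    have hd0 : 0 ≤ d := by
      by_contra hc
      push Not at hc
      obtain ⟨g, c', hg, -, hc'⟩ := hg (-d) (by linarith)
      have := hA.nonneg hg
      linarith
    obtain ⟨F, C, hFA, hF, hC⟩ := hf.exists_seq
    obtain ⟨G, D, hGA, hG, hD⟩ := hg.exists_seq
    choose s t hs ht hst using fun k => hA.parallelogram (hFA k) (hGA k)
    have hone : ∀ k : ℕ, 1 / ((k : ℝ) + 1) ≤ 1 := fun k => by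
      rw [div_le_one (by positivity)]
      linarith [Nat.cast_nonneg (α := ℝ) k]
    have hC0 := fun k => hA.nonneg (hFA k)
    have hD0 := fun k => hA.nonneg (hGA k)
    have hs0 := fun k => hA.nonneg (hs k)
    have ht0 := fun k => hA.nonneg (ht k)
    have hbd : ∀ k, (s k, t k) ∈ Icc (0 : ℝ) (2 * (c + d + 2)) ×ˢ Icc (0 : ℝ) (2 * (c + d + 2)) := by
      intro k
      have h1 := hC k
      have h2 := hD k
      have h3 := hone k
      have h4 : C k ^ 2 ≤ (c + d + 2) ^ 2 := pow_le_pow_left₀ (hC0 k) (by linarith) 2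
      have h5 : D k ^ 2 ≤ (c + d + 2) ^ 2 := pow_le_pow_left₀ (hD0 k) (by linarith) 2
      have h6 := hst k
      refine ⟨⟨hs0 k, abs_le_of_sq_le_sq' ?_ (by positivity) |>.2⟩,
        ⟨ht0 k, abs_le_of_sq_le_sq' ?_ (by positivity) |>.2⟩⟩ <;>
      nlinarith [sq_nonneg (s k), sq_nonneg (t k)]
    obtain ⟨⟨s', t'⟩, -, κ, hκ, hlim⟩ := tendsto_subseq_of_bounded
      (((Metric.isBounded_Icc _ _).prod (Metric.isBounded_Icc _ _))) hbd
    have hlims : Tendsto (fun k => s (κ k)) atTop (𝓝 s') := (continuous_fst.tendsto _).comp hlim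
    have hlimt : Tendsto (fun k => t (κ k)) atTop (𝓝 t') := (continuous_snd.tendsto _).comp hlim
    have hF' := hF.comp hκ.tendsto_atTop
    have hG' := hG.comp hκ.tendsto_atTop
    refine ⟨s', t', Relax.of_tendsto (fun k => hs (κ k)) (hF'.add hG') hlims,
      Relax.of_tendsto (fun k => ht (κ k)) (hF'.sub hG') hlimt, ?_⟩
    have hz : Tendsto (fun k => 1 / ((κ k : ℝ) + 1)) atTop (𝓝 0) :=
      tendsto_one_div_add_atTop_nhds_zero_nat.comp hκ.tendsto_atTop
    have hr : Tendsto (fun k => 2 * ((c + 1 / ((κ k : ℝ) + 1)) ^ 2 + (d + 1 / ((κ k : ℝ) + 1)) ^ 2))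
        atTop (𝓝 (2 * (c ^ 2 + d ^ 2))) := by
      simpa using (((hz.const_add c).pow 2).add ((hz.const_add d).pow 2)).const_mul 2
    refine le_of_tendsto_of_tendsto' ((hlims.pow 2).add (hlimt.pow 2)) hr fun k => ?_
    have h4 := pow_le_pow_left₀ (hC0 (κ k)) (hC (κ k)).le 2
    have h5 := pow_le_pow_left₀ (hD0 (κ k)) (hD (κ k)).le 2
    linarith [hst (κ k)]

/-- The relaxed seminorm. -/
def relaxNorm (A : H → ℝ → Prop) (f : H) : ℝ := sInf {c | Relax A f c}

namespace QuadraticRelation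

variable (hA : QuadraticRelation A)
include hA

theorem bddBelow (f : H) : BddBelow {c | Relax A f c} := ⟨0, fun _ h => hA.relax.nonneg h⟩

theorem relaxNorm_le {f : H} {c : ℝ} (h : Relax A f c) : relaxNorm A f ≤ c :=
  csInf_le (hA.bddBelow f) h

theorem relaxNorm_nonneg (f : H) : 0 ≤ relaxNorm A f :=
  Real.sInf_nonneg fun _ h => hA.relax.nonneg h

/-- The infimum is attained because the relaxation is closed. -/
theorem relax_relaxNorm {f : H} {c : ℝ} (h : Relax A f c) : Relax A f (relaxNorm A f) := by
  refine Relax.closed fun ε hε => ⟨f, by simpa using hε, ?_⟩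
  obtain ⟨c', hc', hlt⟩ := exists_lt_of_csInf_lt (s := {c | Relax A f c}) ⟨c, h⟩
    (show sInf {c | Relax A f c} < relaxNorm A f + ε by unfold relaxNorm; linarith)
  exact Relax.mono hc' hlt.le

/-- The domain of the relaxation. -/
def domain : Submodule ℝ H where
  carrier := {f | ∃ c, Relax A f c}
  add_mem' := fun ⟨_, hc⟩ ⟨_, hd⟩ => ⟨_, hA.relax.add hc hd⟩
  zero_mem' := ⟨0, hA.relax.zero⟩
  smul_mem' := fun a _ ⟨_, hc⟩ => ⟨_, hA.relax.smul a hc⟩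

omit hA in
/-- The domain of the relaxation, to be endowed with the graph norm. -/
def Space (hA : QuadraticRelation A) : Type _ := hA.domain

omit hA in
instance (hA : QuadraticRelation A) : AddCommGroup hA.Space :=
  inferInstanceAs (AddCommGroup hA.domain)

omit hA in
instance (hA : QuadraticRelation A) : Module ℝ hA.Space :=
  inferInstanceAs (Module ℝ hA.domain)

/-- The inclusion of the domain of the relaxation. -/
def incl : hA.Space →ₗ[ℝ] H := hA.domain.subtype

theorem incl_injective : Function.Injective hA.incl := Subtype.val_injective

theorem relax_incl (u : hA.Space) : Relax A (hA.incl u) (relaxNorm A (hA.incl u)) := by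
  obtain ⟨c, hc⟩ := u.2
  exact hA.relax_relaxNorm hc

omit hA in
instance (hA : QuadraticRelation A) : Norm hA.Space :=
  ⟨fun u => √(‖hA.incl u‖ ^ 2 + relaxNorm A (hA.incl u) ^ 2)⟩

theorem norm_def (u : hA.Space) :
    ‖u‖ = √(‖hA.incl u‖ ^ 2 + relaxNorm A (hA.incl u) ^ 2) := rfl

theorem norm_sq (u : hA.Space) : ‖u‖ ^ 2 = ‖hA.incl u‖ ^ 2 + relaxNorm A (hA.incl u) ^ 2 := by
  rw [norm_def, Real.sq_sqrt (by positivity)]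

theorem relaxNorm_add_le (u v : hA.Space) : relaxNorm A (hA.incl (u + v)) ≤
    relaxNorm A (hA.incl u) + relaxNorm A (hA.incl v) := by
  rw [map_add]
  exact hA.relaxNorm_le (hA.relax.add (hA.relax_incl u) (hA.relax_incl v))

theorem relaxNorm_smul (a : ℝ) (u : hA.Space) :
    relaxNorm A (hA.incl (a • u)) = |a| * relaxNorm A (hA.incl u) := by
  have key : ∀ (a : ℝ) (u : hA.Space),
      relaxNorm A (hA.incl (a • u)) ≤ |a| * relaxNorm A (hA.incl u) := by
    intro a u
    rw [map_smul]
    exact hA.relaxNorm_le (hA.relax.smul a (hA.relax_incl u))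
  refine le_antisymm (key a u) ?_
  rcases eq_or_ne a 0 with rfl | ha
  · simpa using hA.relaxNorm_nonneg _
  · have h := key a⁻¹ (a • u)
    rw [smul_smul, inv_mul_cancel₀ ha, one_smul, abs_inv] at h
    calc |a| * relaxNorm A (hA.incl u) ≤ |a| * (|a|⁻¹ * relaxNorm A (hA.incl (a • u))) := by gcongr
      _ = _ := by rw [mul_inv_cancel_left₀ (abs_ne_zero.2 ha)]

theorem core : NormedSpace.Core ℝ hA.Space where
  norm_nonneg u := Real.sqrt_nonneg _
  norm_smul a u := by
    rw [norm_def, norm_def, relaxNorm_smul, map_smul, norm_smul, mul_pow, mul_pow,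
      Real.norm_eq_abs, ← mul_add, Real.sqrt_mul (sq_nonneg _), Real.sqrt_sq (abs_nonneg a)]
  norm_triangle u v := by
    have h1 : ‖hA.incl (u + v)‖ ≤ ‖hA.incl u‖ + ‖hA.incl v‖ := by
      rw [map_add]; exact norm_add_le _ _
    have h2 := hA.relaxNorm_add_le u v
    have h3 := hA.relaxNorm_nonneg (hA.incl (u + v))
    have hu := hA.norm_sq u
    have hv := hA.norm_sq v
    have hu0 : 0 ≤ ‖u‖ := Real.sqrt_nonneg _
    have hv0 : 0 ≤ ‖v‖ := Real.sqrt_nonneg _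
    rw [norm_def hA (u + v)]
    refine Real.sqrt_le_iff.2 ⟨by positivity, ?_⟩
    set a := ‖hA.incl u‖
    set b := ‖hA.incl v‖
    set x := relaxNorm A (hA.incl u)
    set y := relaxNorm A (hA.incl v)
    -- Cauchy–Schwarz in ℝ² for the pairs (‖u‖_H, relaxed seminorm of u) and (‖v‖_H, relaxed
    -- seminorm of v).
    have hcs : a * b + x * y ≤ ‖u‖ * ‖v‖ := by
      refine abs_le_of_sq_le_sq' ?_ (by positivity) |>.2
      rw [mul_pow, hu, hv]
      nlinarith [sq_nonneg (a * y - b * x)]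
    have h4 := pow_le_pow_left₀ (norm_nonneg (hA.incl (u + v))) h1 2
    have h5 := pow_le_pow_left₀ h3 h2 2
    nlinarith
  norm_eq_zero_iff u := by
    rw [norm_def]
    constructor
    · intro h
      have h' := (Real.sqrt_eq_zero (by positivity)).1 h
      have : ‖hA.incl u‖ ^ 2 = 0 := by
        nlinarith [sq_nonneg ‖hA.incl u‖, sq_nonneg (relaxNorm A (hA.incl u))]
      have h0 : hA.incl u = 0 := by simpa using this
      exact hA.incl_injective (by rw [h0, map_zero])
    · rintro rfl
      have h0 : relaxNorm A (0 : H) = 0 :=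
        le_antisymm (hA.relaxNorm_le hA.relax.zero) (hA.relaxNorm_nonneg _)
      simp [h0]

omit hA in
instance (hA : QuadraticRelation A) : NormedAddCommGroup hA.Space :=
  NormedAddCommGroup.ofCore hA.core

omit hA in
instance (hA : QuadraticRelation A) : NormedSpace ℝ hA.Space :=
  NormedSpace.ofCore hA.core

theorem norm_sq' (u : hA.Space) : ‖u‖ ^ 2 = ‖hA.incl u‖ ^ 2 + relaxNorm A (hA.incl u) ^ 2 :=
  hA.norm_sq u

theorem relaxNorm_parallelogram_le (u v : hA.Space) :
    relaxNorm A (hA.incl (u + v)) ^ 2 + relaxNorm A (hA.incl (u - v)) ^ 2 ≤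
      2 * (relaxNorm A (hA.incl u) ^ 2 + relaxNorm A (hA.incl v) ^ 2) := by
  obtain ⟨s, t, hs, ht, hst⟩ := hA.relax.parallelogram (hA.relax_incl u) (hA.relax_incl v)
  rw [map_add, map_sub]
  have h1 := pow_le_pow_left₀ (hA.relaxNorm_nonneg _) (hA.relaxNorm_le hs) 2
  have h2 := pow_le_pow_left₀ (hA.relaxNorm_nonneg _) (hA.relaxNorm_le ht) 2
  linarith

/-- The sum and difference of u + v and u - v are 2u and 2v, so the inequality applied to that pair
is the reverse inequality. -/
theorem relaxNorm_parallelogram (u v : hA.Space) :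
    relaxNorm A (hA.incl (u + v)) ^ 2 + relaxNorm A (hA.incl (u - v)) ^ 2 =
      2 * (relaxNorm A (hA.incl u) ^ 2 + relaxNorm A (hA.incl v) ^ 2) := by
  refine le_antisymm (hA.relaxNorm_parallelogram_le u v) ?_
  have h := hA.relaxNorm_parallelogram_le (u + v) (u - v)
  rw [show u + v + (u - v) = (2 : ℝ) • u by rw [two_smul]; abel,
    show u + v - (u - v) = (2 : ℝ) • v by rw [two_smul]; abel, relaxNorm_smul, relaxNorm_smul] at h
  rw [abs_of_pos two_pos, mul_pow, mul_pow] at h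
  linarith

omit hA in
instance (hA : QuadraticRelation A) : InnerProductSpace ℝ hA.Space :=
  InnerProductSpace.ofNorm ℝ fun u v => by
    have h1 := hA.relaxNorm_parallelogram u v
    have h2 := parallelogram_law_with_norm ℝ (hA.incl u) (hA.incl v)
    rw [← map_add, ← map_sub] at h2
    have e1 := hA.norm_sq' (u + v)
    have e2 := hA.norm_sq' (u - v)
    have e3 := hA.norm_sq' u
    have e4 := hA.norm_sq' v
    simp only [← sq]
    linarith

theorem norm_incl_le (u : hA.Space) : ‖hA.incl u‖ ≤ ‖u‖ := by
  refine abs_le_of_sq_le_sq' ?_ (norm_nonneg _) |>.2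
  rw [hA.norm_sq']
  nlinarith [sq_nonneg (relaxNorm A (hA.incl u))]

theorem relaxNorm_incl_le (u : hA.Space) : relaxNorm A (hA.incl u) ≤ ‖u‖ := by
  refine abs_le_of_sq_le_sq' ?_ (norm_nonneg _) |>.2
  rw [hA.norm_sq']
  nlinarith [sq_nonneg ‖hA.incl u‖]

theorem norm_le_add (u : hA.Space) : ‖u‖ ≤ ‖hA.incl u‖ + relaxNorm A (hA.incl u) := by
  have h0 := hA.relaxNorm_nonneg (hA.incl u)
  refine abs_le_of_sq_le_sq' ?_ (by positivity) |>.2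
  rw [hA.norm_sq']
  nlinarith [norm_nonneg (hA.incl u)]

/-- A Cauchy sequence converges in H; by lower semicontinuity the seminorm bound on x m - x n passes
to x m minus the limit. -/
theorem completeSpace [CompleteSpace H] : CompleteSpace hA.Space := by
  refine Metric.complete_of_cauchySeq_tendsto fun x hx => ?_
  have hincl : CauchySeq fun k => hA.incl (x k) := by
    rw [Metric.cauchySeq_iff] at hx ⊢
    intro ε hε
    obtain ⟨N, hN⟩ := hx ε hε
    refine ⟨N, fun m hm n hn => lt_of_le_of_lt ?_ (hN m hm n hn)⟩
    rw [dist_eq_norm, dist_eq_norm, ← map_sub]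
    exact hA.norm_incl_le _
  obtain ⟨f, hf⟩ := cauchySeq_tendsto_of_complete hincl
  have key : ∀ ε > 0, ∃ N, ∀ m ≥ N, Relax A (hA.incl (x m) - f) ε := by
    intro ε hε
    obtain ⟨N, hN⟩ := Metric.cauchySeq_iff.1 hx ε hε
    refine ⟨N, fun m hm => Relax.closed fun η hη => ?_⟩
    obtain ⟨n, hn, hnN⟩ := ((Metric.tendsto_nhds.1 hf η hη).and (eventually_ge_atTop N)).exists
    refine ⟨hA.incl (x m - x n), ?_, (hA.relax_incl _).mono ?_⟩
    · rw [map_sub, dist_eq_norm] at *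
      rw [show hA.incl (x m) - hA.incl (x n) - (hA.incl (x m) - f) = -(hA.incl (x n) - f) by abel,
        norm_neg]
      exact hn
    · have := hN m hm n hnN
      rw [dist_eq_norm] at this
      linarith [hA.relaxNorm_incl_le (x m - x n)]
  obtain ⟨N, hN⟩ := key 1 one_pos
  have hmem : f ∈ hA.domain := by
    have h1 : hA.incl (x N) - f ∈ hA.domain := ⟨1, hN N le_rfl⟩
    have h2 : hA.incl (x N) ∈ hA.domain := (x N).2
    simpa using hA.domain.sub_mem h2 h1
  let y : hA.Space := (⟨f, hmem⟩ : hA.domain)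
  have hy : hA.incl y = f := rfl
  refine ⟨y, Metric.tendsto_nhds.2 fun ε hε => ?_⟩
  obtain ⟨N, hN⟩ := key (ε / 2) (by linarith)
  filter_upwards [Metric.tendsto_nhds.1 hf (ε / 2) (by linarith), eventually_ge_atTop N] with m h1 h2
  rw [dist_eq_norm] at h1 ⊢
  have h3 := hA.norm_le_add (x m - y)
  rw [map_sub, hy] at h3
  have h4 := hA.relaxNorm_le (hN m h2)
  linarith

/-- The elements of `A` are dense in the domain of the relaxation, for the graph norm. -/
theorem exists_rel_norm_sub_lt (u : hA.Space) {ε : ℝ} (hε : 0 < ε) :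
    ∃ v : hA.Space, (∃ c, A (hA.incl v) c) ∧ ‖v - u‖ < ε := by
  set c := relaxNorm A (hA.incl u) with hc
  have hc0 : 0 ≤ c := hA.relaxNorm_nonneg _
  -- Lower semicontinuity at 2u: the squared seminorm of any point close to 2u is nearly at least
  -- (2c)².
  have hlow : ∃ η > 0, ∀ g : H, ‖g - (2 : ℝ) • hA.incl u‖ < η → ∀ d, Relax A g d →
      (2 * c) ^ 2 - ε ^ 2 / 8 ≤ d ^ 2 := by
    by_contra hcon
    push Not at hcon
    have hneg : ∀ η > 0, ∃ g : H, ‖g - (2 : ℝ) • hA.incl u‖ < η ∧ ∃ d, Relax A g d ∧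
        d ≤ √((2 * c) ^ 2 - ε ^ 2 / 8) ∧ 0 < (2 * c) ^ 2 - ε ^ 2 / 8 := by
      intro η hη
      obtain ⟨g, hg, d, hd, hlt⟩ := hcon η hη
      exact ⟨g, hg, d, hd, Real.le_sqrt_of_sq_le hlt.le, lt_of_le_of_lt (sq_nonneg d) hlt⟩
    have hpos : 0 < (2 * c) ^ 2 - ε ^ 2 / 8 := by
      obtain ⟨_, _, _, _, _, h⟩ := hneg 1 one_pos
      exact h
    have hr : Relax A ((2 : ℝ) • hA.incl u) (√((2 * c) ^ 2 - ε ^ 2 / 8)) := by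
      refine Relax.closed fun η hη => ?_
      obtain ⟨g, hg, d, hd, hle, -⟩ := hneg η hη
      exact ⟨g, hg, hd.mono (by linarith)⟩
    have h1 := hA.relaxNorm_le hr
    rw [← map_smul, relaxNorm_smul, abs_of_pos two_pos] at h1
    have h2 := pow_le_pow_left₀ (by positivity) h1 2
    rw [Real.sq_sqrt hpos.le] at h2
    nlinarith
  obtain ⟨η, hη, hlow⟩ := hlow
  -- By the parallelogram law the squared seminorm of v - u is at most 2(c + δ)² + 2c² - (4c² -
  -- ε²/8) ≤ (ε/2)². Together with a distance below ε/4 in H this bounds the graph norm by 3ε/4.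
  obtain ⟨δ, hδ0, hδη, hδε, hδc⟩ : ∃ δ > 0, δ ≤ η ∧ δ ≤ ε / 4 ∧ (c + δ) ^ 2 ≤ c ^ 2 + ε ^ 2 / 16 := by
    have hcont : Tendsto (fun δ : ℝ => (c + δ) ^ 2) (𝓝[>] 0) (𝓝 (c ^ 2)) := by
      have : ContinuousAt (fun δ : ℝ => (c + δ) ^ 2) 0 := by fun_prop
      simpa using this.tendsto.mono_left nhdsWithin_le_nhds
    have h1 := hcont.eventually (ge_mem_nhds (show c ^ 2 < c ^ 2 + ε ^ 2 / 16 by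
      have := pow_pos hε 2; linarith))
    have h2 : ∀ᶠ δ : ℝ in 𝓝[>] 0, δ ≤ min η (ε / 4) :=
      nhdsWithin_le_nhds (ge_mem_nhds (lt_min hη (by linarith)))
    obtain ⟨δ, ⟨h1, h2⟩, h3⟩ := ((h1.and h2).and self_mem_nhdsWithin).exists
    exact ⟨δ, h3, h2.trans (min_le_left _ _), h2.trans (min_le_right _ _), h1⟩
  obtain ⟨g, d, hg, hgu, hd⟩ := hA.relax_incl u δ hδ0
  have hgm : g ∈ hA.domain := ⟨d, Relax.of_rel hg⟩
  let v : hA.Space := (⟨g, hgm⟩ : hA.domain)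
  have hv : hA.incl v = g := rfl
  refine ⟨v, ⟨d, hg⟩, ?_⟩
  have hp := hA.relaxNorm_parallelogram v u
  have hN : relaxNorm A (hA.incl v) ≤ d := hA.relaxNorm_le (Relax.of_rel hg)
  have hN2 := pow_le_pow_left₀ (hA.relaxNorm_nonneg _) (hN.trans hd.le) 2
  have hl := hlow (hA.incl (v + u)) (by
    rw [map_add, hv, two_smul, add_sub_add_right_eq_sub]; exact hgu.trans_le hδη) _
    (hA.relax_incl (v + u))
  have hsq : relaxNorm A (hA.incl (v - u)) ^ 2 ≤ (ε / 2) ^ 2 := by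
    rw [← hc] at hp hN2
    nlinarith
  have hle := abs_le_of_sq_le_sq' hsq (by positivity) |>.2
  have := hA.norm_le_add (v - u)
  rw [map_sub, hv] at this hle
  linarith

end QuadraticRelation

end Relaxation

/-! ### Slopes -/

section Slope

variable {X : Type*} [MetricSpace X]

/-- `f` is pointwise Lipschitz at `x`. -/
def PtLip (f : X → ℝ) (x : X) : Prop := ∃ K : ℝ, ∀ᶠ y in 𝓝 x, |f y - f x| ≤ K * dist y x

theorem lipSlope_nonneg (f : X → ℝ) (x : X) : 0 ≤ lipSlope f x := ENNReal.toReal_nonneg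

theorem limsup_slope_le {f : X → ℝ} {x : X} {C : ℝ}
    (h : ∀ᶠ y in 𝓝 x, |f y - f x| ≤ C * dist y x) :
    limsup (fun y => ENNReal.ofReal (|f y - f x| / dist y x)) (𝓝[≠] x) ≤ ENNReal.ofReal C := by
  refine limsup_le_of_le (by isBoundedDefault) ?_
  filter_upwards [nhdsWithin_le_nhds h, self_mem_nhdsWithin] with y hy hne
  exact ENNReal.ofReal_le_ofReal ((div_le_iff₀ (dist_pos.2 hne)).2 hy)

theorem lipSlope_le {f : X → ℝ} {x : X} {C : ℝ} (hC : 0 ≤ C)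
    (h : ∀ᶠ y in 𝓝 x, |f y - f x| ≤ C * dist y x) : lipSlope f x ≤ C :=
  ENNReal.toReal_le_of_le_ofReal hC (limsup_slope_le h)

theorem lipSlope_le_of_forall_gt {f : X → ℝ} {x : X} {C : ℝ} (hC : 0 ≤ C)
    (h : ∀ C' > C, ∀ᶠ y in 𝓝 x, |f y - f x| ≤ C' * dist y x) : lipSlope f x ≤ C :=
  le_of_forall_gt_imp_ge_of_dense fun C' hC' => lipSlope_le (hC.trans hC'.le) (h C' hC')

/-- `lipSlope` sends an infinite upper limit to 0, so a bound on the slope controls difference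
quotients only at points where the function is pointwise Lipschitz. -/
theorem PtLip.eventually_le {f : X → ℝ} {x : X} (hf : PtLip f x) {C : ℝ} (hC : lipSlope f x < C) :
    ∀ᶠ y in 𝓝 x, |f y - f x| ≤ C * dist y x := by
  obtain ⟨K, hK⟩ := hf
  have hfin : limsup (fun y => ENNReal.ofReal (|f y - f x| / dist y x)) (𝓝[≠] x) ≠ ⊤ :=
    ((limsup_slope_le hK).trans_lt ENNReal.ofReal_lt_top).ne
  have hlt : limsup (fun y => ENNReal.ofReal (|f y - f x| / dist y x)) (𝓝[≠] x) <
      ENNReal.ofReal C := by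
    rw [← ENNReal.ofReal_toReal hfin]
    exact (ENNReal.ofReal_lt_ofReal_iff_of_nonneg ENNReal.toReal_nonneg).2 hC
  have h := eventually_lt_of_limsup_lt hlt
  rw [eventually_nhdsWithin_iff] at h
  filter_upwards [h] with y hy
  rcases eq_or_ne y x with rfl | hne
  · simp
  · have h1 := (ENNReal.ofReal_lt_ofReal_iff_of_nonneg (by positivity)).1 (hy hne)
    exact ((div_lt_iff₀ (dist_pos.2 hne)).1 h1).le

theorem PtLip.continuousAt {f : X → ℝ} {x : X} (hf : PtLip f x) : ContinuousAt f x := by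
  obtain ⟨K, hK⟩ := hf
  rw [ContinuousAt, tendsto_iff_dist_tendsto_zero]
  have h0 : Tendsto (fun y => K * dist y x) (𝓝 x) (𝓝 0) := by
    have : ContinuousAt (fun y => K * dist y x) x := by fun_prop
    simpa using this.tendsto
  exact squeeze_zero' (Eventually.of_forall fun _ => dist_nonneg)
    (hK.mono fun y hy => by rwa [Real.dist_eq]) h0

theorem PtLip.smul {f : X → ℝ} {x : X} (a : ℝ) (hf : PtLip f x) : PtLip (a • f) x := by
  obtain ⟨K, hK⟩ := hf
  refine ⟨|a| * K, ?_⟩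
  filter_upwards [hK] with y h1
  simp only [Pi.smul_apply, smul_eq_mul, ← mul_sub, abs_mul, mul_assoc]
  gcongr

theorem LipschitzWith.ptLip {f : X → ℝ} {K : ℝ≥0} (hf : LipschitzWith K f) (x : X) : PtLip f x :=
  ⟨K, Eventually.of_forall fun y => by simpa [Real.dist_eq] using hf.dist_le_mul y x⟩

theorem LipschitzWith.lipSlope_le {f : X → ℝ} {K : ℝ≥0} (hf : LipschitzWith K f) (x : X) :
    lipSlope f x ≤ K :=
  _root_.lipSlope_le K.2
    (Eventually.of_forall fun y => by simpa [Real.dist_eq] using hf.dist_le_mul y x)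

theorem lipSlope_congr {f g : X → ℝ} {x : X} (h : f =ᶠ[𝓝 x] g) : lipSlope f x = lipSlope g x := by
  unfold lipSlope
  congr 1
  refine limsup_congr ?_
  filter_upwards [nhdsWithin_le_nhds h] with y hy
  rw [hy, h.self_of_nhds]

theorem lipSlope_eq_zero {f : X → ℝ} {x : X} {c : ℝ} (h : f =ᶠ[𝓝 x] fun _ => c) :
    lipSlope f x = 0 :=
  le_antisymm (lipSlope_le le_rfl (by
    filter_upwards [h] with y hy
    rw [hy, h.self_of_nhds]; simp)) (lipSlope_nonneg f x)

theorem lipSlope_add_le {f g : X → ℝ} {x : X} (hf : PtLip f x) (hg : PtLip g x) :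
    lipSlope (f + g) x ≤ lipSlope f x + lipSlope g x := by
  refine lipSlope_le_of_forall_gt (add_nonneg (lipSlope_nonneg f x) (lipSlope_nonneg g x))
    fun C' hC' => ?_
  have h1 := hf.eventually_le
    (show lipSlope f x < lipSlope f x + (C' - (lipSlope f x + lipSlope g x)) / 2 by linarith)
  have h2 := hg.eventually_le
    (show lipSlope g x < lipSlope g x + (C' - (lipSlope f x + lipSlope g x)) / 2 by linarith)
  filter_upwards [h1, h2] with y h1 h2
  calc |(f + g) y - (f + g) x| = |(f y - f x) + (g y - g x)| := by
        simp only [Pi.add_apply]; congr 1; ring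
    _ ≤ |f y - f x| + |g y - g x| := abs_add_le _ _
    _ ≤ C' * dist y x := by linarith

theorem lipSlope_smul_le {f : X → ℝ} {x : X} (a : ℝ) (hf : PtLip f x) :
    lipSlope (a • f) x ≤ |a| * lipSlope f x := by
  refine lipSlope_le_of_forall_gt (mul_nonneg (abs_nonneg a) (lipSlope_nonneg f x)) fun C' hC' => ?_
  obtain ⟨D, hD, hD'⟩ : ∃ D > lipSlope f x, |a| * D ≤ C' := by
    refine ⟨lipSlope f x + (C' - |a| * lipSlope f x) / (|a| + 1), ?_, ?_⟩
    · have : 0 < (C' - |a| * lipSlope f x) / (|a| + 1) := div_pos (by linarith) (by positivity)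
      linarith
    · rw [mul_add, mul_div_assoc', ← le_sub_iff_add_le', div_le_iff₀ (by positivity)]
      nlinarith [abs_nonneg a]
  filter_upwards [hf.eventually_le hD] with y hy
  simp only [Pi.smul_apply, smul_eq_mul, ← mul_sub, abs_mul]
  calc |a| * |f y - f x| ≤ |a| * (D * dist y x) := by gcongr
    _ = |a| * D * dist y x := by ring
    _ ≤ C' * dist y x := by gcongr

theorem lipSlope_mul_le {f g : X → ℝ} {x : X} (hf : PtLip f x) (hg : PtLip g x) :
    lipSlope (f * g) x ≤ |f x| * lipSlope g x + |g x| * lipSlope f x := by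
  set F := lipSlope f x
  set G := lipSlope g x
  have hF : 0 ≤ F := lipSlope_nonneg f x
  have hG : 0 ≤ G := lipSlope_nonneg g x
  refine lipSlope_le_of_forall_gt (by positivity) fun C' hC' => ?_
  have hlim : Tendsto (fun e : ℝ => (|f x| + e) * (G + e) + |g x| * (F + e)) (𝓝[>] 0)
      (𝓝 (|f x| * G + |g x| * F)) := by
    have : ContinuousAt (fun e : ℝ => (|f x| + e) * (G + e) + |g x| * (F + e)) 0 := by fun_prop
    simpa using this.tendsto.mono_left nhdsWithin_le_nhds
  obtain ⟨e, he, he0⟩ := ((hlim.eventually (ge_mem_nhds hC')).and self_mem_nhdsWithin).exists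
  have he0 : 0 < e := he0
  have hfc : ∀ᶠ y in 𝓝 x, |f y| < |f x| + e :=
    hf.continuousAt.abs.eventually (gt_mem_nhds (by linarith))
  filter_upwards [hfc, hf.eventually_le (show F < F + e by linarith),
    hg.eventually_le (show G < G + e by linarith)] with y h1 h2 h3
  calc |(f * g) y - (f * g) x| = |f y * (g y - g x) + g x * (f y - f x)| := by
        simp only [Pi.mul_apply]; congr 1; ring
    _ ≤ |f y| * |g y - g x| + |g x| * |f y - f x| := by
        rw [← abs_mul, ← abs_mul]; exact abs_add_le _ _
    _ ≤ (|f x| + e) * ((G + e) * dist y x) + |g x| * ((F + e) * dist y x) := by gcongr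
    _ = ((|f x| + e) * (G + e) + |g x| * (F + e)) * dist y x := by ring
    _ ≤ C' * dist y x := by gcongr

theorem lipSlope_comp_le {f : X → ℝ} {x : X} (hf : PtLip f x) {θ : ℝ → ℝ}
    (hθ : LipschitzWith 1 θ) : lipSlope (θ ∘ f) x ≤ lipSlope f x :=
  lipSlope_le_of_forall_gt (lipSlope_nonneg f x) fun C' hC' =>
    (hf.eventually_le hC').mono fun y hy => le_trans
      (by simpa [Real.dist_eq] using hθ.dist_le_mul (f y) (f x)) hy

/-- For a fixed radius the supremum of the difference quotients over the punctured ball is lower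
semicontinuous in the centre. The slope is the infimum of these suprema over the radii 1/(k+1). -/
theorem measurable_lipSlope [MeasurableSpace X] [BorelSpace X] {f : X → ℝ} (hf : Continuous f) :
    Measurable (lipSlope f) := by
  unfold lipSlope
  refine ENNReal.measurable_toReal.comp ?_
  have hb : ∀ x : X, (𝓝[≠] x).HasBasis (fun _ : ℕ => True)
      fun k => Metric.ball x (1 / ((k : ℝ) + 1)) ∩ {x}ᶜ :=
    fun x => nhdsWithin_hasBasis Metric.nhds_basis_ball_inv_nat_succ _
  have he : (fun x => limsup (fun y => ENNReal.ofReal (|f y - f x| / dist y x)) (𝓝[≠] x)) =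
      fun x => ⨅ k : ℕ, ⨆ y ∈ Metric.ball x (1 / ((k : ℝ) + 1)) ∩ {x}ᶜ,
        ENNReal.ofReal (|f y - f x| / dist y x) := by
    funext x
    rw [(hb x).limsup_eq_iInf_iSup]
    simp
  rw [he]
  refine Measurable.iInf fun k => measurable_of_Ioi fun a => IsOpen.measurableSet ?_
  rw [isOpen_iff_mem_nhds]
  intro x hx
  simp only [mem_preimage, mem_Ioi, lt_iSup_iff] at hx
  obtain ⟨y, hy, hlt⟩ := hx
  have hne : dist y x ≠ 0 := dist_ne_zero.2 hy.2
  have hc : ContinuousAt (fun z => ENNReal.ofReal (|f y - f z| / dist y z)) x :=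
    ENNReal.continuous_ofReal.continuousAt.comp
      (ContinuousAt.div (by fun_prop) (by fun_prop) hne)
  have hd : ∀ᶠ z in 𝓝 x, dist y z < 1 / ((k : ℝ) + 1) :=
    (show ContinuousAt (fun z => dist y z) x by fun_prop).eventually (gt_mem_nhds hy.1)
  have hz : ∀ᶠ z in 𝓝 x, z ≠ y := isOpen_ne.mem_nhds (Ne.symm hy.2)
  filter_upwards [hc.eventually (lt_mem_nhds hlt), hd, hz] with z h1 h2 h3
  simp only [mem_preimage, mem_Ioi, lt_iSup_iff]
  exact ⟨y, ⟨h2, h3.symm⟩, h1⟩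

/-- Slopes on an open subset are slopes in the ambient space. -/
theorem lipSlope_comp_val {U : Set X} (hU : IsOpen U) (F : X → ℝ) (x : U) :
    lipSlope (fun y : U => F y) x = lipSlope F x := by
  unfold lipSlope
  congr 1
  have : Filter.map (Subtype.val : U → X) (𝓝[≠] x) = 𝓝[≠] (x : X) := by
    have h := hU.isOpenEmbedding_subtypeVal.map_nhdsWithin_preimage_eq {(x : X)}ᶜ x
    rwa [show (Subtype.val : U → X) ⁻¹' {(x : X)}ᶜ = {x}ᶜ by
      ext y; simp [Subtype.ext_iff]] at h
  rw [← this]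
  rfl

end Slope

/-! ### The Cheeger energy as a relaxation -/

section CheegerRelaxation

variable {X : Type*} [MetricSpace X] [MeasurableSpace X] {m : Measure X}

/-- `g` is the class of a Lipschitz function whose slope has class `s`. -/
def LipPair (m : Measure X) (g s : Lp ℝ 2 m) : Prop :=
  ∃ (F : X → ℝ) (hF : MemLp F 2 m) (hD : MemLp (lipSlope F) 2 m),
    (∃ K : ℝ≥0, LipschitzWith K F) ∧ g = hF.toLp F ∧ s = hD.toLp (lipSlope F)

/-- `g` is the class of a Lipschitz function whose slope has `L²` norm at most `c`. -/
def LipRel (m : Measure X) (g : Lp ℝ 2 m) (c : ℝ) : Prop := ∃ s, LipPair m g s ∧ ‖s‖ ≤ c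

theorem LipPair.nonneg {g s : Lp ℝ 2 m} (h : LipPair m g s) : 0 ≤ s := by
  obtain ⟨F, hF, hD, -, -, rfl⟩ := h
  rw [← Lp.coeFn_nonneg]
  filter_upwards [hD.coeFn_toLp] with x hx
  rw [hx]
  exact lipSlope_nonneg F x

theorem Lp.norm_le_norm_of_nonneg_of_le {s t : Lp ℝ 2 m} (h0 : 0 ≤ s) (h : s ≤ t) : ‖s‖ ≤ ‖t‖ := by
  refine Lp.norm_le_norm_of_ae_le ?_
  filter_upwards [(Lp.coeFn_nonneg s).2 h0, (Lp.coeFn_le s t).2 h] with x h1 h2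
  rw [Real.norm_of_nonneg h1, Real.norm_of_nonneg (le_trans h1 h2)]
  exact h2

theorem Lp.smul_le_smul_of_nonneg {s t : Lp ℝ 2 m} {a : ℝ} (ha : 0 ≤ a) (h : s ≤ t) :
    a • s ≤ a • t := by
  rw [← Lp.coeFn_le] at h ⊢
  filter_upwards [h, Lp.coeFn_smul a s, Lp.coeFn_smul a t] with x h1 h2 h3
  rw [h2, h3]
  exact mul_le_mul_of_nonneg_left h1 ha

variable [BorelSpace X]

/-- Sublinearity of the slope. Pairs are stable under nonnegative combinations only up to a
domination of the second entry, and convexity enters below in this form. -/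
theorem LipPair.combine {g s g' s' : Lp ℝ 2 m} (h : LipPair m g s) (h' : LipPair m g' s') {a b : ℝ}
    (ha : 0 ≤ a) (hb : 0 ≤ b) :
    ∃ t, LipPair m (a • g + b • g') t ∧ t ≤ a • s + b • s' := by
  obtain ⟨F, hF, hD, ⟨K, hK⟩, rfl, rfl⟩ := h
  obtain ⟨F', hF', hD', ⟨K', hK'⟩, rfl, rfl⟩ := h'
  have hL : LipschitzWith (‖a‖₊ * K + ‖b‖₊ * K') (a • F + b • F') :=
    ((lipschitzWith_smul a).comp hK).add ((lipschitzWith_smul b).comp hK')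
  have hle : ∀ x, lipSlope (a • F + b • F') x ≤ a * lipSlope F x + b * lipSlope F' x := by
    intro x
    refine (lipSlope_add_le ((hK.ptLip x).smul a) ((hK'.ptLip x).smul b)).trans ?_
    have h1 := lipSlope_smul_le a (hK.ptLip x)
    have h2 := lipSlope_smul_le b (hK'.ptLip x)
    rw [abs_of_nonneg ha] at h1
    rw [abs_of_nonneg hb] at h2
    linarith
  have hM : MemLp (lipSlope (a • F + b • F')) 2 m := by
    refine ((hD.const_smul a).add (hD'.const_smul b)).mono
      (measurable_lipSlope hL.continuous).aestronglyMeasurable (Eventually.of_forall fun x => ?_)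
    rw [Real.norm_of_nonneg (lipSlope_nonneg _ _)]
    exact (hle x).trans (Real.le_norm_self _)
  refine ⟨hM.toLp _, ⟨_, (hF.const_smul a).add (hF'.const_smul b), hM, ⟨_, hL⟩, rfl, rfl⟩, ?_⟩
  rw [← Lp.coeFn_le]
  filter_upwards [hM.coeFn_toLp, Lp.coeFn_add (a • hD.toLp (lipSlope F)) (b • hD'.toLp (lipSlope F')),
    Lp.coeFn_smul a (hD.toLp (lipSlope F)), Lp.coeFn_smul b (hD'.toLp (lipSlope F')),
    hD.coeFn_toLp, hD'.coeFn_toLp] with x h1 h2 h3 h4 h5 h6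
  rw [h1, h2, Pi.add_apply, h3, h4, Pi.smul_apply, Pi.smul_apply, h5, h6]
  exact hle x

/-- Mazur's lemma. The functions dominating the slope of some Lipschitz function ε-close to f form a
convex set, so its norm closure contains the weak limit G'; otherwise a separating functional would
contradict weak convergence. Norm approximation then controls the norms of the slopes. -/
theorem IsRelaxedGradient.relax {f G : Lp ℝ 2 m} (h : IsRelaxedGradient m f G) :
    Relax (LipRel m) f ‖G‖ := by
  obtain ⟨F, hF, hD, G', hlip, hlim, hweak, hle⟩ := h
  have hpair : ∀ j, LipPair m ((hF j).toLp (F j)) ((hD j).toLp (lipSlope (F j))) :=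
    fun j => ⟨F j, hF j, hD j, hlip j, rfl, rfl⟩
  have key : ∀ ε > 0, G' ∈ closure {t : Lp ℝ 2 m | ∃ g s, LipPair m g s ∧ ‖g - f‖ < ε ∧ s ≤ t} := by
    intro ε hε
    set Γ := {t : Lp ℝ 2 m | ∃ g s, LipPair m g s ∧ ‖g - f‖ < ε ∧ s ≤ t} with hΓ
    have hconv : Convex ℝ Γ := by
      rintro t ⟨g, s, hp, hg, hs⟩ t' ⟨g', s', hp', hg', hs'⟩ a b ha hb hab
      obtain ⟨r, hr, hrle⟩ := hp.combine hp' ha hb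
      refine ⟨_, r, hr, ?_, hrle.trans
        (add_le_add (Lp.smul_le_smul_of_nonneg ha hs) (Lp.smul_le_smul_of_nonneg hb hs'))⟩
      have := (convex_ball f ε) (mem_ball_iff_norm.2 hg) (mem_ball_iff_norm.2 hg') ha hb hab
      exact mem_ball_iff_norm.1 this
    by_contra hcon
    obtain ⟨ℓ, u, h1, h2⟩ := geometric_hahn_banach_point_closed hconv.closure isClosed_closure hcon
    have hw := hweak ((InnerProductSpace.toDual ℝ _).symm ℓ)
    have hℓ : ∀ a, inner ℝ a ((InnerProductSpace.toDual ℝ _).symm ℓ) = ℓ a := fun a => by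
      rw [real_inner_comm, InnerProductSpace.toDual_symm_apply]
    simp only [hℓ] at hw
    have hev := hw.eventually (gt_mem_nhds h1)
    have hev2 := Metric.tendsto_nhds.1 hlim ε hε
    obtain ⟨j, hj1, hj2⟩ := (hev.and hev2).exists
    have := h2 _ (subset_closure (⟨_, _, hpair j, by rwa [← dist_eq_norm], le_rfl⟩ :
      (hD j).toLp (lipSlope (F j)) ∈ Γ))
    linarith
  -- The norm is monotone only among nonnegative functions, so the sign of G' is needed before
  -- comparing G' with G.
  have hG'0 : 0 ≤ G' := by
    have hcl : IsClosed {t : Lp ℝ 2 m | 0 ≤ t} := isClosed_Ici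
    refine hcl.closure_subset_iff.2 ?_ (key 1 one_pos)
    rintro t ⟨g, s, hp, -, hs⟩
    exact hp.nonneg.trans hs
  have hnorm : ‖G'‖ ≤ ‖G‖ := Lp.norm_le_norm_of_nonneg_of_le hG'0 ((Lp.coeFn_le _ _).1 hle)
  intro ε hε
  obtain ⟨t, ⟨g, s, hp, hg, hs⟩, ht⟩ := Metric.mem_closure_iff.1 (key ε hε) ε hε
  refine ⟨g, ‖s‖, ⟨s, hp, le_rfl⟩, hg, ?_⟩
  have h1 := Lp.norm_le_norm_of_nonneg_of_le hp.nonneg hs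
  have h2 : ‖t‖ ≤ ‖G'‖ + ‖t - G'‖ := by
    calc ‖t‖ = ‖G' + (t - G')‖ := by congr 1; abel
      _ ≤ _ := norm_add_le _ _
  rw [dist_comm, dist_eq_norm] at ht
  linarith

/-- Let e k be the infimum of the norms of slopes of Lipschitz functions within 1/(k+1) of f. Nearly
minimal slopes form a Cauchy sequence: the slope of the average of two functions is dominated by the
average of the slopes and has norm at least e N, so the parallelogram law makes the difference of
the slopes small. The slopes thus converge strongly, hence weakly, and no weak compactness is
needed. -/
theorem Relax.exists_relaxedGradient {f : Lp ℝ 2 m} {c : ℝ} (h : Relax (LipRel m) f c) :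
    ∃ G, IsRelaxedGradient m f G ∧ ‖G‖ ≤ c := by
  have hpos : ∀ k : ℕ, (0 : ℝ) < 1 / ((k : ℝ) + 1) := fun k => Nat.one_div_pos_of_nat
  let S : ℕ → Set ℝ := fun k =>
    {r | ∃ g s, LipPair m g s ∧ ‖g - f‖ < 1 / ((k : ℝ) + 1) ∧ r = ‖s‖}
  have hSb : ∀ k, BddBelow (S k) := fun k => ⟨0, by rintro _ ⟨g, s, -, -, rfl⟩; exact norm_nonneg _⟩
  have hex : ∀ k, ∀ ε > 0, ∃ r ∈ S k, r < c + ε := by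
    intro k ε hε
    obtain ⟨g, c', ⟨s, hp, hs⟩, hg, hc'⟩ := h (min ε (1 / ((k : ℝ) + 1))) (lt_min hε (hpos k))
    exact ⟨‖s‖, ⟨g, s, hp, hg.trans_le (min_le_right _ _), rfl⟩,
      by linarith [min_le_left ε (1 / ((k : ℝ) + 1))]⟩
  have hSn : ∀ k, (S k).Nonempty := fun k => by
    obtain ⟨r, hr, -⟩ := hex k 1 one_pos
    exact ⟨r, hr⟩
  let e : ℕ → ℝ := fun k => sInf (S k)
  have hec : ∀ k, e k ≤ c := fun k => le_of_forall_pos_lt_add fun ε hε => by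
    obtain ⟨r, hr, hlt⟩ := hex k ε hε
    exact (csInf_le (hSb k) hr).trans_lt hlt
  have he0 : ∀ k, 0 ≤ e k := fun k => le_csInf (hSn k) (by
    rintro _ ⟨g, s, -, -, rfl⟩; exact norm_nonneg _)
  have hanti : ∀ {j k : ℕ}, j ≤ k → 1 / ((k : ℝ) + 1) ≤ 1 / ((j : ℝ) + 1) := fun hjk =>
    Nat.one_div_le_one_div hjk
  have hmono : Monotone e := by
    intro j k hjk
    refine csInf_le_csInf (hSb j) (hSn k) ?_
    rintro _ ⟨g, s, hp, hg, rfl⟩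
    exact ⟨g, s, hp, hg.trans_le (hanti hjk), rfl⟩
  obtain ⟨L, hL⟩ : ∃ L, Tendsto e atTop (𝓝 L) :=
    ⟨_, tendsto_atTop_ciSup hmono ⟨c, by rintro _ ⟨k, rfl⟩; exact hec k⟩⟩
  have heL : ∀ k, e k ≤ L := fun k => hmono.ge_of_tendsto hL k
  have hLc : L ≤ c := le_of_tendsto' hL hec
  have hch : ∀ k : ℕ, ∃ g s, LipPair m g s ∧ ‖g - f‖ < 1 / ((k : ℝ) + 1) ∧
      ‖s‖ < L + 1 / ((k : ℝ) + 1) := by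
    intro k
    obtain ⟨_, ⟨g, s, hp, hg, rfl⟩, hlt⟩ := exists_lt_of_csInf_lt (hSn k)
      (show sInf (S k) < L + 1 / ((k : ℝ) + 1) from lt_of_le_of_lt (heL k) (by linarith [hpos k]))
    exact ⟨g, s, hp, hg, hlt⟩
  choose g s hp hg hs using hch
  have hmid : ∀ N j k : ℕ, N ≤ j → N ≤ k → ‖s j - s k‖ ^ 2 ≤
      4 * (L + 1 / ((N : ℝ) + 1)) ^ 2 - 4 * e N ^ 2 := by
    intro N j k hj hk
    obtain ⟨t, ht, htle⟩ := (hp j).combine (hp k) (a := 1 / 2) (b := 1 / 2) (by norm_num)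
      (by norm_num)
    have h1 : e N ≤ ‖t‖ := by
      refine csInf_le (hSb N) ⟨_, t, ht, ?_, rfl⟩
      have := (convex_ball f (1 / ((N : ℝ) + 1)))
        (mem_ball_iff_norm.2 ((hg j).trans_le (hanti hj)))
        (mem_ball_iff_norm.2 ((hg k).trans_le (hanti hk)))
        (a := 1 / 2) (b := 1 / 2) (by norm_num) (by norm_num) (by norm_num)
      exact mem_ball_iff_norm.1 this
    have h2 : ‖t‖ ≤ 1 / 2 * ‖s j + s k‖ := by
      have := Lp.norm_le_norm_of_nonneg_of_le ht.nonneg htle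
      rwa [← smul_add, norm_smul, Real.norm_of_nonneg (by norm_num)] at this
    have h3 := pow_le_pow_left₀ (he0 N) (h1.trans h2) 2
    have h4 := parallelogram_law_with_norm ℝ (s j) (s k)
    have h5 := pow_le_pow_left₀ (norm_nonneg (s j)) ((hs j).le.trans
      (add_le_add_right (hanti hj) L)) 2
    have h6 := pow_le_pow_left₀ (norm_nonneg (s k)) ((hs k).le.trans
      (add_le_add_right (hanti hk) L)) 2
    nlinarith
  have hcau : CauchySeq s := by
    rw [Metric.cauchySeq_iff]
    intro ε hε
    have hz : Tendsto (fun N : ℕ => 4 * (L + 1 / ((N : ℝ) + 1)) ^ 2 - 4 * e N ^ 2) atTop (𝓝 0) := by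
      have := (((tendsto_one_div_add_atTop_nhds_zero_nat (𝕜 := ℝ)).const_add L).pow 2).const_mul 4
        |>.sub ((hL.pow 2).const_mul 4)
      simpa using this
    obtain ⟨N, hN⟩ := (hz.eventually (gt_mem_nhds (show (0 : ℝ) < ε ^ 2 by positivity))).exists
    refine ⟨N, fun j hj k hk => ?_⟩
    rw [dist_eq_norm]
    exact lt_of_pow_lt_pow_left₀ 2 hε.le ((hmid N j k hj hk).trans_lt hN)
  obtain ⟨G, hG⟩ := cauchySeq_tendsto_of_complete hcau
  have hGc : ‖G‖ ≤ c := by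
    refine le_trans (le_of_tendsto_of_tendsto' hG.norm ?_ fun k => (hs k).le) hLc
    simpa using (tendsto_one_div_add_atTop_nhds_zero_nat (𝕜 := ℝ)).const_add L
  choose F hF hD hlip hgF hsF using hp
  refine ⟨G, ⟨F, hF, hD, G, hlip, ?_, fun h => ?_, Eventually.of_forall fun _ => le_rfl⟩, hGc⟩
  · have : Tendsto g atTop (𝓝 f) := by
      rw [tendsto_iff_norm_sub_tendsto_zero]
      exact squeeze_zero (fun _ => norm_nonneg _) (fun k => (hg k).le)
        tendsto_one_div_add_atTop_nhds_zero_nat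
    exact this.congr hgF
  · have : Tendsto (fun k => inner ℝ (s k) h) atTop (𝓝 (inner ℝ G h)) :=
      hG.inner tendsto_const_nhds
    exact this.congr fun k => by rw [← hsF k]

theorem cheegerEnergy_le {f : Lp ℝ 2 m} {c : ℝ} (h : Relax (LipRel m) f c) :
    cheegerEnergy m f ≤ ENNReal.ofReal (c ^ 2 / 2) := by
  obtain ⟨G, hG, hc⟩ := h.exists_relaxedGradient
  refine (iInf₂_le G hG).trans (ENNReal.ofReal_le_ofReal ?_)
  gcongr

theorem cheegerEnergy_lt_top_iff {f : Lp ℝ 2 m} :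
    cheegerEnergy m f < ⊤ ↔ ∃ c, Relax (LipRel m) f c := by
  constructor
  · intro h
    simp only [cheegerEnergy, iInf_lt_iff] at h
    obtain ⟨G, hG, -⟩ := h
    exact ⟨_, hG.relax⟩
  · rintro ⟨c, hc⟩
    exact (cheegerEnergy_le hc).trans_lt ENNReal.ofReal_lt_top

/-- The theorem reducing the Sobolev space to the relaxation of a quadratic relation. -/
theorem QuadraticRelation.isSobolevHilbertSpace {A : Lp ℝ 2 m → ℝ → Prop}
    (hA : QuadraticRelation A) (hrel : ∀ f c, Relax A f c ↔ Relax (LipRel m) f c) :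
    IsSobolevHilbertSpace m hA.Space hA.incl where
  complete := hA.completeSpace
  injective := hA.incl_injective
  range_eq := by
    ext f
    rw [mem_ofPred_eq, cheegerEnergy_lt_top_iff]
    simp only [← hrel]
    exact ⟨by rintro ⟨u, rfl⟩; exact u.2, fun h => ⟨(⟨f, h⟩ : hA.domain), rfl⟩⟩
  norm_sq u := by
    have h0 := hA.relaxNorm_nonneg (hA.incl u)
    have hch : cheegerEnergy m (hA.incl u) =
        ENNReal.ofReal (relaxNorm A (hA.incl u) ^ 2 / 2) := by
      refine le_antisymm (cheegerEnergy_le ((hrel _ _).1 (hA.relax_incl u)))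
        (le_iInf₂ fun G hG => ENNReal.ofReal_le_ofReal ?_)
      have := hA.relaxNorm_le ((hrel _ _).2 hG.relax)
      gcongr
    rw [hA.norm_sq', hch, ENNReal.toReal_ofReal (by positivity)]
    ring

end CheegerRelaxation

/-! ### Local Riemannian geometry -/

section Riemannian

variable {n : ℕ} {U : Type*} [MetricSpace U] [ChartedSpace (EuclideanSpace ℝ (Fin n)) U]
  [RiemannianBundle (fun x : U => TangentSpace (𝓡 n) x)]
  {F : Type*} [NormedAddCommGroup F] [NormedSpace ℝ F]

variable (n) in
/-- The differential of a vector-valued function. -/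
def covd (φ : U → F) (z : U) : TangentSpace (𝓡 n) z →L[ℝ] F := mfderiv (𝓡 n) 𝓘(ℝ, F) φ z

variable [IsManifold (𝓡 n) ∞ U]

theorem enorm_le_mul_enorm {V W : Type*} [SeminormedAddCommGroup V] [SeminormedAddCommGroup W]
    {v : V} {w : W} {C : ℝ≥0} (h : ‖v‖ ≤ C * ‖w‖) : ‖v‖ₑ ≤ C * ‖w‖ₑ := by
  simp only [enorm, ← ENNReal.coe_mul, ENNReal.coe_le_coe]
  exact_mod_cast h

theorem enorm_sub_le_of_covd_le {φ : U → F} {s : Set U} (hs : IsOpen s)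
    (hφ : ContMDiffOn (𝓡 n) 𝓘(ℝ, F) 1 φ s) {C : ℝ≥0} (hC : ∀ z ∈ s, ∀ ξ, ‖covd n φ z ξ‖ ≤ C * ‖ξ‖)
    {γ : ℝ → U} (hγ : ContMDiffOn 𝓘(ℝ) (𝓡 n) 1 γ (Icc 0 1)) (hγs : MapsTo γ (Icc 0 1) s) :
    ‖φ (γ 1) - φ (γ 0)‖ₑ ≤ C * pathELength (𝓡 n) γ 0 1 := by
  have hcomp : ContMDiffOn 𝓘(ℝ) 𝓘(ℝ, F) 1 (φ ∘ γ) (Icc 0 1) := hφ.comp hγ hγs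
  have h1 := enorm_sub_le_lintegral_derivWithin_Icc_of_contDiffOn_Icc
    (contMDiffOn_iff_contDiffOn.1 hcomp) zero_le_one
  refine h1.trans ?_
  rw [pathELength_eq_lintegral_mfderivWithin_Icc, ← lintegral_const_mul' _ _ ENNReal.coe_ne_top]
  refine setLIntegral_mono' measurableSet_Icc fun t ht => ?_
  have hd : mfderivWithin 𝓘(ℝ) 𝓘(ℝ, F) (φ ∘ γ) (Icc 0 1) t =
      (mfderiv (𝓡 n) 𝓘(ℝ, F) φ (γ t)).comp (mfderivWithin 𝓘(ℝ) (𝓡 n) γ (Icc 0 1) t) := by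
    refine mfderiv_comp_mfderivWithin t ?_ (hγ.mdifferentiableOn one_ne_zero t ht) ?_
    · exact ((hφ (γ t) (hγs ht)).contMDiffAt (hs.mem_nhds (hγs ht))).mdifferentiableAt one_ne_zero
    · rw [uniqueMDiffWithinAt_iff_uniqueDiffWithinAt]
      exact uniqueDiffOn_Icc zero_lt_one t ht
  have he : derivWithin (φ ∘ γ) (Icc 0 1) t =
      covd n φ (γ t) (mfderivWithin 𝓘(ℝ) (𝓡 n) γ (Icc 0 1) t (1 : ℝ)) := by
    rw [← fderivWithin_derivWithin, ← mfderivWithin_eq_fderivWithin, hd]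
    rfl
  rw [he]
  refine enorm_le_mul_enorm (hC _ (hγs ht) _)

variable [IsContMDiffRiemannianBundle (𝓡 n) ∞ (EuclideanSpace ℝ (Fin n))
    (fun x : U => TangentSpace (𝓡 n) x)]

theorem isContinuousRiemannianBundle_tangent :
    IsContinuousRiemannianBundle (EuclideanSpace ℝ (Fin n)) (fun x : U => TangentSpace (𝓡 n) x) := by
  obtain ⟨g, hg, h⟩ := IsContMDiffRiemannianBundle.exists_contMDiff (IB := 𝓡 n) (n := ∞)
    (F := EuclideanSpace ℝ (Fin n)) (E := fun x : U => TangentSpace (𝓡 n) x)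
  exact ⟨g, hg.continuous, h⟩

/-- The norm of the tangent space varies with the point, so the differential is read in a
trivialization around x. In the constant C r + e C₁, the factor r is the distortion of the norm
between z and x, and e C₁ bounds the variation of the differential. -/
theorem eventually_covd_le {φ : U → F} {x : U} (hφ : ContMDiffAt (𝓡 n) 𝓘(ℝ, F) 1 φ x) {C C' : ℝ}
    (hC0 : 0 ≤ C) (hC : ∀ ξ, ‖covd n φ x ξ‖ ≤ C * ‖ξ‖) (hCC' : C < C') :
    ∀ᶠ z in 𝓝 x, ∀ ξ, ‖covd n φ z ξ‖ ≤ C' * ‖ξ‖ := by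
  have : IsContinuousRiemannianBundle (EuclideanSpace ℝ (Fin n))
    (fun x : U => TangentSpace (𝓡 n) x) := isContinuousRiemannianBundle_tangent
  let τ := trivializationAt (EuclideanSpace ℝ (Fin n)) (fun x : U => TangentSpace (𝓡 n) x) x
  let A : U → EuclideanSpace ℝ (Fin n) →L[ℝ] F := fun z => (covd n φ z).comp (τ.symmL ℝ z)
  have hA : ContinuousAt A x := by
    have h := (hφ.mfderiv_const (m := 0) (by simp)).continuousAt
    convert! h using 1
    funext z
    simp [A, inTangentCoordinates, ContinuousLinearMap.inCoordinates, covd, τ]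
    rfl
  obtain ⟨C₁, hC₁, hτ⟩ := eventually_norm_trivializationAt_lt (EuclideanSpace ℝ (Fin n))
    (fun x : U => TangentSpace (𝓡 n) x) x
  obtain ⟨r, hr1, e, he, hre⟩ : ∃ r > 1, ∃ e > 0, C * r + e * C₁ ≤ C' := by
    refine ⟨1 + (C' - C) / (2 * (C + 1)), ?_, (C' - C) / (2 * C₁), ?_, ?_⟩
    · have : 0 < (C' - C) / (2 * (C + 1)) := div_pos (by linarith) (by linarith)
      linarith
    · exact div_pos (by linarith) (by linarith)
    · have h1 : (C' - C) / (2 * C₁) * C₁ = (C' - C) / 2 := by field_simp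
      have h2 : C * ((C' - C) / (2 * (C + 1))) ≤ (C' - C) / 2 := by
        rw [mul_div_assoc', div_le_div_iff₀ (by linarith) two_pos]
        nlinarith
      rw [h1, mul_add, mul_one]
      linarith
  have hr := eventually_norm_symmL_trivializationAt_self_comp_lt (EuclideanSpace ℝ (Fin n))
    (fun x : U => TangentSpace (𝓡 n) x) x hr1
  have hb : ∀ᶠ z in 𝓝 x, z ∈ τ.baseSet :=
    τ.open_baseSet.mem_nhds (FiberBundle.mem_baseSet_trivializationAt' x)
  filter_upwards [hτ, hr, hb, Metric.tendsto_nhds.1 hA e he] with z h1 h2 h3 h4 ξ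
  have e1 : covd n φ z ξ = A x (τ.continuousLinearMapAt ℝ z ξ) +
      (A z - A x) (τ.continuousLinearMapAt ℝ z ξ) := by
    rw [sub_apply, add_sub_cancel]
    simp only [A, ContinuousLinearMap.comp_apply]
    rw [τ.symmL_continuousLinearMapAt h3]
  have hz : ‖τ.continuousLinearMapAt ℝ z ξ‖ ≤ C₁ * ‖ξ‖ :=
    (ContinuousLinearMap.le_opNorm _ _).trans (by gcongr)
  rw [e1]
  refine (norm_add_le _ _).trans ?_
  have h5 : ‖A x (τ.continuousLinearMapAt ℝ z ξ)‖ ≤ C * (r * ‖ξ‖) := by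
    refine (hC _).trans ?_
    gcongr
    exact (ContinuousLinearMap.le_opNorm ((τ.symmL ℝ x).comp (τ.continuousLinearMapAt ℝ z)) ξ).trans
      (by gcongr)
  have h6 : ‖(A z - A x) (τ.continuousLinearMapAt ℝ z ξ)‖ ≤ e * (C₁ * ‖ξ‖) := by
    refine (ContinuousLinearMap.le_opNorm _ _).trans ?_
    rw [dist_eq_norm] at h4
    gcongr
  nlinarith [norm_nonneg ξ]

variable [IsRiemannianManifold (𝓡 n) U]

theorem exists_path_lt {x y : U} {r : ℝ} (h : dist x y < r) :
    ∃ γ : ℝ → U, γ 0 = x ∧ γ 1 = y ∧ ContMDiffOn 𝓘(ℝ) (𝓡 n) 1 γ (Icc 0 1) ∧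
      pathELength (𝓡 n) γ 0 1 < ENNReal.ofReal r := by
  refine exists_lt_of_riemannianEDist_lt ?_
  rw [← IsRiemannianManifold.out (I := 𝓡 n) x y, edist_dist]
  exact (ENNReal.ofReal_lt_ofReal_iff_of_nonneg dist_nonneg).2 h

theorem edist_le_pathELength {γ : ℝ → U} {a b : ℝ} (hab : a ≤ b)
    (hγ : ContMDiffOn 𝓘(ℝ) (𝓡 n) 1 γ (Icc a b)) :
    edist (γ a) (γ b) ≤ pathELength (𝓡 n) γ a b := by
  rw [IsRiemannianManifold.out (I := 𝓡 n) (γ a) (γ b)]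
  exact riemannianEDist_le_pathELength hγ rfl rfl hab

/-- Approximate midpoints. -/
theorem exists_dist_lt_dist_lt (_ : IsRiemannianManifold (𝓡 n) U) {x y : U} {a b : ℝ} (ha : 0 < a) (hb : 0 < b)
    (h : dist x y < a + b) : ∃ z, dist x z < a ∧ dist z y < b := by
  obtain ⟨γ, h0, h1, hγ, hlen⟩ := exists_path_lt (n := n) h
  -- A nearly minimal curve is cut at a point at distance c from x. What remains of it has length at
  -- most the total length minus c, which is less than b.
  obtain ⟨c, hc1, hc2⟩ : ∃ c, max 0 (((pathELength (𝓡 n) γ 0 1).toReal) - b) < c ∧ c < a := by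
    refine exists_between (max_lt ha ?_)
    have := ENNReal.toReal_lt_of_lt_ofReal hlen
    linarith
  by_cases hxy : dist x y < c
  · exact ⟨y, hxy.trans hc2, by simpa using hb⟩
  have hcont : ContinuousOn (fun t => dist x (γ t)) (Icc 0 1) :=
    Continuous.comp_continuousOn (continuous_const.dist continuous_id) hγ.continuousOn
  have hmem : c ∈ Icc (dist x (γ 0)) (dist x (γ 1)) := by
    rw [h0, h1, dist_self]
    exact ⟨((le_max_left _ _).trans_lt hc1).le, not_lt.1 hxy⟩
  obtain ⟨t, ht, hct⟩ := intermediate_value_Icc zero_le_one hcont hmem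
  refine ⟨γ t, by rw [show dist x (γ t) = c from hct]; exact hc2, ?_⟩
  have h2 := edist_le_pathELength (n := n) ht.1 (hγ.mono (Icc_subset_Icc_right ht.2))
  have h3 := edist_le_pathELength (n := n) ht.2 (hγ.mono (Icc_subset_Icc_left ht.1))
  have h4 : pathELength (𝓡 n) γ 0 t + pathELength (𝓡 n) γ t 1 = pathELength (𝓡 n) γ 0 1 :=
    pathELength_add ht.1 ht.2
  have hfin : pathELength (𝓡 n) γ 0 1 ≠ ⊤ := (hlen.trans ENNReal.ofReal_lt_top).ne
  have h5 := ENNReal.toReal_mono hfin (h4 ▸ add_le_add h2 h3)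
  rw [edist_dist, edist_dist, ← ENNReal.ofReal_add dist_nonneg dist_nonneg,
    ENNReal.toReal_ofReal (by positivity), h0, h1] at h5
  have h6 := (le_max_right _ _).trans_lt hc1
  change dist x (γ t) = c at hct
  linarith

/-- The distance is finite, so any two points are joined by a curve of finite length. -/
theorem preconnectedSpace_of_riemannian (_ : IsRiemannianManifold (𝓡 n) U) : PreconnectedSpace U := by
  refine ⟨isPreconnected_of_forall_pair fun x _ y _ => ?_⟩
  obtain ⟨γ, h0, h1, hγ, -⟩ := exists_path_lt (n := n) (lt_add_one (dist x y))
  exact ⟨γ '' Icc 0 1, subset_univ _, ⟨0, by simp, h0⟩, ⟨1, by simp, h1⟩,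
    isPreconnected_Icc.image _ hγ.continuousOn⟩

/-- A function with bounded differential on a ball is Lipschitz on a smaller ball. -/
theorem norm_sub_le_of_covd_le {φ : U → F} {x : U} {r : ℝ}
    (hφ : ContMDiffOn (𝓡 n) 𝓘(ℝ, F) 1 φ (Metric.ball x (3 * r))) {C : ℝ} (hC0 : 0 ≤ C)
    (hC : ∀ z ∈ Metric.ball x (3 * r), ∀ ξ, ‖covd n φ z ξ‖ ≤ C * ‖ξ‖) {y z : U}
    (hy : y ∈ Metric.ball x r) (hz : z ∈ Metric.ball x r) : ‖φ z - φ y‖ ≤ C * dist y z := by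
  have hr : 0 < r := Metric.pos_of_mem_ball hy
  rw [Metric.mem_ball] at hy hz
  have hyz : dist y z < 2 * r := by linarith [dist_triangle_right y z x]
  refine le_of_forall_gt_imp_ge_of_dense fun b hb => ?_
  have hlim : Tendsto (fun e => C * (dist y z + e)) (𝓝[>] 0) (𝓝 (C * dist y z)) := by
    have : ContinuousAt (fun e => C * (dist y z + e)) 0 := by fun_prop
    simpa using this.tendsto.mono_left nhdsWithin_le_nhds
  have h2 : ∀ᶠ e : ℝ in 𝓝[>] 0, e < 2 * r - dist y z :=
    nhdsWithin_le_nhds (gt_mem_nhds (by linarith))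
  obtain ⟨e, ⟨he1, he2⟩, he0⟩ :=
    (((hlim.eventually (ge_mem_nhds hb)).and h2).and self_mem_nhdsWithin).exists
  have he0 : 0 < e := he0
  refine le_trans ?_ he1
  obtain ⟨γ, h0, h1, hγ, hlen⟩ := exists_path_lt (n := n) (show dist y z < dist y z + e by linarith)
  lift C to ℝ≥0 using hC0
  -- A curve of length less than 2r starting in the ball of radius r stays in the ball of radius 3r.
  have hmaps : MapsTo γ (Icc 0 1) (Metric.ball x (3 * r)) := by
    intro t ht
    have h3 := edist_le_pathELength (n := n) ht.1 (hγ.mono (Icc_subset_Icc_right ht.2))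
    have h4 : pathELength (𝓡 n) γ 0 t ≤ pathELength (𝓡 n) γ 0 1 := pathELength_mono le_rfl ht.2
    have h5 := (h3.trans h4).trans_lt hlen
    rw [edist_dist, ENNReal.ofReal_lt_ofReal_iff_of_nonneg dist_nonneg, h0] at h5
    rw [Metric.mem_ball]
    linarith [dist_triangle_left (γ t) x y, dist_comm y x]
  have h6 := enorm_sub_le_of_covd_le Metric.isOpen_ball hφ hC hγ hmaps
  rw [h0, h1] at h6
  have h7 : ‖φ z - φ y‖ₑ ≤ ENNReal.ofReal (C * (dist y z + e)) := by
    rw [ENNReal.ofReal_mul NNReal.zero_le_coe, ENNReal.ofReal_coe_nnreal]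
    exact h6.trans (mul_le_mul_right hlen.le _)
  rw [← ofReal_norm] at h7
  exact (ENNReal.ofReal_le_ofReal_iff (by positivity)).1 h7

theorem exists_nhds_norm_sub_le {φ : U → F} {x : U} (hφ : ContMDiffAt (𝓡 n) 𝓘(ℝ, F) 1 φ x)
    {C C' : ℝ} (hC0 : 0 ≤ C) (hC : ∀ ξ, ‖covd n φ x ξ‖ ≤ C * ‖ξ‖) (hCC' : C < C') :
    ∃ s ∈ 𝓝 x, ∀ y ∈ s, ∀ z ∈ s, ‖φ z - φ y‖ ≤ C' * dist y z := by
  have h1 := eventually_covd_le hφ hC0 hC hCC'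
  have h2 := (contMDiffAt_iff_contMDiffAt_nhds (by simp)).1 hφ
  obtain ⟨r, hr, hball⟩ := Metric.eventually_nhds_iff_ball.1 (h1.and h2)
  have e3 : 3 * (r / 3) = r := by ring
  refine ⟨Metric.ball x (r / 3), Metric.ball_mem_nhds _ (by positivity), fun y hy z hz => ?_⟩
  refine norm_sub_le_of_covd_le (n := n) (C := C') (fun w hw => ?_) (hC0.trans hCC'.le)
    (fun w hw => ?_) hy hz
  · rw [e3] at hw; exact (hball w hw).2.contMDiffWithinAt
  · rw [e3] at hw; exact (hball w hw).1

theorem exists_nhds_norm_sub_le' {φ : U → F} {x : U} (hφ : ContMDiffAt (𝓡 n) 𝓘(ℝ, F) 1 φ x) :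
    ∃ C ≥ 0, ∃ s ∈ 𝓝 x, ∀ y ∈ s, ∀ z ∈ s, ‖φ z - φ y‖ ≤ C * dist y z := by
  obtain ⟨s, hs, h⟩ := exists_nhds_norm_sub_le hφ (norm_nonneg (covd n φ x))
    (fun ξ => (covd n φ x).le_opNorm ξ) (lt_add_one _)
  exact ⟨_, by positivity, s, hs, h⟩

theorem lipSlope_le_of_covd_le {φ : U → ℝ} {x : U} (hφ : ContMDiffAt (𝓡 n) 𝓘(ℝ, ℝ) 1 φ x)
    {C : ℝ} (hC0 : 0 ≤ C) (hC : ∀ ξ, |covd n φ x ξ| ≤ C * ‖ξ‖) : lipSlope φ x ≤ C := by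
  refine lipSlope_le_of_forall_gt hC0 fun C' hC' => ?_
  obtain ⟨s, hs, h⟩ := exists_nhds_norm_sub_le hφ hC0 hC hC'
  filter_upwards [hs] with y hy
  rw [dist_comm]
  exact h x (mem_of_mem_nhds hs) y hy

theorem ContMDiffAt.ptLip {φ : U → ℝ} {x : U} (hφ : ContMDiffAt (𝓡 n) 𝓘(ℝ, ℝ) 1 φ x) :
    PtLip φ x := by
  obtain ⟨C, -, s, hs, h⟩ := exists_nhds_norm_sub_le' hφ
  refine ⟨C, ?_⟩
  filter_upwards [hs] with y hy
  rw [dist_comm]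
  exact h x (mem_of_mem_nhds hs) y hy

end Riemannian

/-! ### Parametrizations of a Riemannian manifold -/

section Parametrization

variable {n : ℕ} {U : Type*} [MetricSpace U] [ChartedSpace (EuclideanSpace ℝ (Fin n)) U]
  [RiemannianBundle (fun x : U => TangentSpace (𝓡 n) x)]
  {F : Type*} [NormedAddCommGroup F] [NormedSpace ℝ F]

variable (n) in
/-- The differential of a parametrization. -/
def pushd (Ψ : F → U) (y : F) : F →L[ℝ] TangentSpace (𝓡 n) (Ψ y) := mfderiv 𝓘(ℝ, F) (𝓡 n) Ψ y

variable [IsManifold (𝓡 n) ∞ U]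
  [IsContMDiffRiemannianBundle (𝓡 n) ∞ (EuclideanSpace ℝ (Fin n))
    (fun x : U => TangentSpace (𝓡 n) x)]

theorem continuousOn_inner_pushd {Ψ : F → U} {V : Set F} (hV : IsOpen V)
    (hΨ : ContMDiffOn 𝓘(ℝ, F) (𝓡 n) 1 Ψ V) (v w : F) :
    ContinuousOn (fun y => inner ℝ (pushd n Ψ y v) (pushd n Ψ y w)) V := by
  have : IsContinuousRiemannianBundle (EuclideanSpace ℝ (Fin n))
    (fun x : U => TangentSpace (𝓡 n) x) := isContinuousRiemannianBundle_tangent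
  have h := hΨ.continuousOn_tangentMapWithin le_rfl hV.uniqueMDiffOn
  have hsec : ∀ v : F, Continuous fun y : F => (⟨y, v⟩ : TangentBundle 𝓘(ℝ, F) F) := fun v =>
    (tangentBundleModelSpaceHomeomorph 𝓘(ℝ, F)).symm.continuous.comp
      (Continuous.prodMk continuous_id continuous_const)
  have key : ∀ v : F, ContinuousOn (fun y : F => (⟨Ψ y, pushd n Ψ y v⟩ :
      TotalSpace (EuclideanSpace ℝ (Fin n)) (fun x : U => TangentSpace (𝓡 n) x))) V := by
    intro v
    have h1 := h.comp (hsec v).continuousOn (s := V) (fun y hy => hy)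
    refine h1.congr fun y hy => ?_
    simp only [Function.comp_apply, tangentMapWithin, pushd]
    rw [mfderivWithin_of_isOpen hV hy]
    rfl
  exact (key v).inner_bundle (key w)

theorem continuousOn_norm_pushd {Ψ : F → U} {V : Set F} (hV : IsOpen V)
    (hΨ : ContMDiffOn 𝓘(ℝ, F) (𝓡 n) 1 Ψ V) (v : F) :
    ContinuousOn (fun y => ‖pushd n Ψ y v‖) V := by
  have h := (continuousOn_inner_pushd hV hΨ v v).sqrt
  refine h.congr fun y _ => ?_
  rw [norm_eq_sqrt_real_inner]

variable [IsRiemannianManifold (𝓡 n) U]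

theorem dist_le_of_norm_pushd_le {Ψ : F → U} {V : Set F} (hV : IsOpen V)
    (hΨ : ContMDiffOn 𝓘(ℝ, F) (𝓡 n) 1 Ψ V) {a v : F} {L : ℝ} (hL0 : 0 ≤ L)
    (hseg : ∀ s ∈ Icc (0 : ℝ) 1, a + s • v ∈ V ∧ ‖pushd n Ψ (a + s • v) v‖ ≤ L) :
    dist (Ψ a) (Ψ (a + v)) ≤ L := by
  let γ : ℝ → U := fun s => Ψ (a + s • v)
  have hline : ContMDiff 𝓘(ℝ) 𝓘(ℝ, F) 1 (fun s : ℝ => a + s • v) := by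
    rw [contMDiff_iff_contDiff]; fun_prop
  have hγ : ContMDiffOn 𝓘(ℝ) (𝓡 n) 1 γ (Icc 0 1) :=
    hΨ.comp hline.contMDiffOn fun s hs => (hseg s hs).1
  have h1 := edist_le_pathELength (n := n) zero_le_one hγ
  have h2 : pathELength (𝓡 n) γ 0 1 ≤ ENNReal.ofReal L := by
    rw [pathELength_eq_lintegral_mfderiv_Icc]
    calc ∫⁻ t in Icc (0 : ℝ) 1, ‖mfderiv 𝓘(ℝ) (𝓡 n) γ t (1 : ℝ)‖ₑ
        ≤ ∫⁻ t in Icc (0 : ℝ) 1, ENNReal.ofReal L := by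
          refine setLIntegral_mono' measurableSet_Icc fun t ht => ?_
          have hd : mfderiv 𝓘(ℝ) (𝓡 n) γ t = (mfderiv 𝓘(ℝ, F) (𝓡 n) Ψ (a + t • v)).comp
              (mfderiv 𝓘(ℝ) 𝓘(ℝ, F) (fun s : ℝ => a + s • v) t) :=
            mfderiv_comp t (((hΨ _ (hseg t ht).1).contMDiffAt (hV.mem_nhds (hseg t ht).1)
              ).mdifferentiableAt one_ne_zero) (hline.mdifferentiableAt one_ne_zero)
          have hd1 : mfderiv 𝓘(ℝ) 𝓘(ℝ, F) (fun s : ℝ => a + s • v) t (1 : ℝ) = v := by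
            rw [mfderiv_eq_fderiv]
            have : HasDerivAt (fun s : ℝ => a + s • v) v t := by
              simpa using ((hasDerivAt_id t).smul_const v).const_add a
            exact this.deriv
          have hd2 : mfderiv 𝓘(ℝ) (𝓡 n) γ t (1 : ℝ) = pushd n Ψ (a + t • v) v := by
            rw [hd]
            exact congrArg _ hd1
          rw [hd2, ← ofReal_norm]
          exact ENNReal.ofReal_le_ofReal (hseg t ht).2
      _ = ENNReal.ofReal L := by simp
  have h3 := h1.trans h2
  rw [edist_dist, ENNReal.ofReal_le_ofReal_iff hL0] at h3
  simpa [γ] using h3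

theorem eventually_norm_pushd_le {E : Type*} [NormedAddCommGroup E] [NormedSpace ℝ E]
    [FiniteDimensional ℝ E] {Ψ : E → U} {V : Set E} (hV : IsOpen V)
    (hΨ : ContMDiffOn 𝓘(ℝ, E) (𝓡 n) 1 Ψ V) {a : E} (ha : a ∈ V) :
    ∃ C ≥ 0, ∀ᶠ y in 𝓝 a, ∀ v, ‖pushd n Ψ y v‖ ≤ C * ‖v‖ := by
  let b := Module.finBasis ℝ E
  let B := b.equivFun.toContinuousLinearEquiv
  have hev : ∀ᶠ y in 𝓝 a, ∀ i, ‖pushd n Ψ y (b i)‖ < ‖pushd n Ψ a (b i)‖ + 1 :=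
    eventually_all.2 fun i => ((continuousOn_norm_pushd hV hΨ (b i)).continuousAt
      (hV.mem_nhds ha)).eventually (gt_mem_nhds (lt_add_one _))
  refine ⟨(∑ i, (‖pushd n Ψ a (b i)‖ + 1)) * ‖(B : E →L[ℝ] (Fin (Module.finrank ℝ E) → ℝ))‖, by positivity, ?_⟩
  filter_upwards [hev] with y hy v
  have hv : v = ∑ i, b.equivFun v i • b i := (b.sum_equivFun v).symm
  calc ‖pushd n Ψ y v‖ = ‖∑ i, b.equivFun v i • pushd n Ψ y (b i)‖ := by
        conv_lhs => rw [hv]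
        rw [map_sum]
        simp only [map_smul]
    _ ≤ ∑ i, ‖b.equivFun v i • pushd n Ψ y (b i)‖ := norm_sum_le _ _
    _ ≤ ∑ i, (‖pushd n Ψ a (b i)‖ + 1) * (‖(B : E →L[ℝ] (Fin (Module.finrank ℝ E) → ℝ))‖ * ‖v‖) := by
        refine Finset.sum_le_sum fun i _ => ?_
        rw [norm_smul, mul_comm]
        refine mul_le_mul (hy i).le ?_ (norm_nonneg _) (by positivity)
        exact (norm_le_pi_norm (b.equivFun v) i).trans ((B : E →L[ℝ] (Fin (Module.finrank ℝ E) → ℝ)).le_opNorm v)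
    _ = _ := by rw [← Finset.sum_mul, mul_assoc]

theorem exists_nhds_dist_le {E : Type*} [NormedAddCommGroup E] [NormedSpace ℝ E]
    [FiniteDimensional ℝ E] {Ψ : E → U} {V : Set E} (hV : IsOpen V)
    (hΨ : ContMDiffOn 𝓘(ℝ, E) (𝓡 n) 1 Ψ V) {a : E} (ha : a ∈ V) :
    ∃ C ≥ 0, ∃ s ∈ 𝓝 a, ∀ y ∈ s, ∀ z ∈ s, dist (Ψ y) (Ψ z) ≤ C * dist y z := by
  obtain ⟨C, hC0, hC⟩ := eventually_norm_pushd_le hV hΨ ha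
  obtain ⟨r, hr, hball⟩ := Metric.eventually_nhds_iff_ball.1 (hC.and (hV.mem_nhds ha))
  refine ⟨C, hC0, Metric.ball a r, Metric.ball_mem_nhds _ hr, fun y hy z hz => ?_⟩
  have h := dist_le_of_norm_pushd_le hV hΨ (a := y) (v := z - y) (L := C * ‖z - y‖)
    (by positivity) fun s hs => by
      have hm := hball _ ((convex_ball a r).add_smul_sub_mem hy hz hs)
      exact ⟨hm.2, hm.1 _⟩
  rw [add_sub_cancel] at h
  rwa [dist_comm y z, dist_eq_norm z y]

theorem covd_pushd {φ : U → F} {G : Type*} [NormedAddCommGroup G] [NormedSpace ℝ G] {Ψ : G → U}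
    {a : G} (hφ : ContMDiffAt (𝓡 n) 𝓘(ℝ, F) 1 φ (Ψ a)) (hΨ : ContMDiffAt 𝓘(ℝ, G) (𝓡 n) 1 Ψ a)
    (v : G) : covd n φ (Ψ a) (pushd n Ψ a v) = fderiv ℝ (φ ∘ Ψ) a v := by
  have h : mfderiv 𝓘(ℝ, G) 𝓘(ℝ, F) (φ ∘ Ψ) a =
      (mfderiv (𝓡 n) 𝓘(ℝ, F) φ (Ψ a)).comp (mfderiv 𝓘(ℝ, G) (𝓡 n) Ψ a) :=
    mfderiv_comp a (hφ.mdifferentiableAt one_ne_zero) (hΨ.mdifferentiableAt one_ne_zero)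
  rw [← mfderiv_eq_fderiv, h]
  rfl

theorem finrank_tangentSpace (x : U) : Module.finrank ℝ (TangentSpace (𝓡 n) x) = n := by
  have : Module.finrank ℝ (TangentSpace (𝓡 n) x) =
    Module.finrank ℝ (EuclideanSpace ℝ (Fin n)) := rfl
  rw [this, finrank_euclideanSpace_fin]

instance (x : U) : FiniteDimensional ℝ (TangentSpace (𝓡 n) x) :=
  inferInstanceAs (FiniteDimensional ℝ (EuclideanSpace ℝ (Fin n)))

/-- The differential of the chart is a left inverse of that of the parametrization, hence also a
right inverse because the dimensions agree. -/
theorem pushd_covd {e : OpenPartialHomeomorph U (EuclideanSpace ℝ (Fin n))}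
    (he : ContMDiffOn (𝓡 n) (𝓡 n) 1 e e.source) (hs : ContMDiffOn (𝓡 n) (𝓡 n) 1 e.symm e.target)
    {a : EuclideanSpace ℝ (Fin n)} (ha : a ∈ e.target) (ξ : TangentSpace (𝓡 n) (e.symm a)) :
    pushd n e.symm a (covd n e (e.symm a) ξ) = ξ := by
  have hea : ContMDiffAt (𝓡 n) 𝓘(ℝ, EuclideanSpace ℝ (Fin n)) 1 e (e.symm a) :=
    (he _ (e.map_target ha)).contMDiffAt (e.open_source.mem_nhds (e.map_target ha))
  have hsa : ContMDiffAt 𝓘(ℝ, EuclideanSpace ℝ (Fin n)) (𝓡 n) 1 e.symm a :=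
    (hs _ ha).contMDiffAt (e.open_target.mem_nhds ha)
  have hleft : ∀ v, covd n e (e.symm a) (pushd n e.symm a v) = v := by
    intro v
    rw [covd_pushd hea hsa]
    have : e ∘ e.symm =ᶠ[𝓝 a] id := by
      filter_upwards [e.open_target.mem_nhds ha] with y hy using e.right_inv hy
    rw [this.fderiv_eq, fderiv_id, ContinuousLinearMap.id_apply]
  have hinj : Function.Injective (pushd n e.symm a).toLinearMap :=
    Function.LeftInverse.injective (g := covd n e (e.symm a)) hleft
  have hsurj := (LinearMap.injective_iff_surjective_of_finrank_eq_finrank (by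
    rw [finrank_tangentSpace, finrank_euclideanSpace_fin])).1 hinj
  obtain ⟨v, rfl⟩ := hsurj ξ
  exact congrArg _ (hleft v)

/-- Along t ↦ Ψ (a + t v) the distance travelled is at most t times nearly the initial speed, and
the increment of φ is at most nearly the slope times this distance. Dividing by t and letting t → 0
gives the bound. -/
theorem abs_covd_pushd_le {φ : U → ℝ} {Ψ : F → U} {V : Set F} (hV : IsOpen V)
    (hΨ : ContMDiffOn 𝓘(ℝ, F) (𝓡 n) 1 Ψ V) {a : F} (ha : a ∈ V)
    (hφ : ContMDiffAt (𝓡 n) 𝓘(ℝ, ℝ) 1 φ (Ψ a)) (v : F) :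
    |covd n φ (Ψ a) (pushd n Ψ a v)| ≤ lipSlope φ (Ψ a) * ‖pushd n Ψ a v‖ := by
  have hΨa : ContMDiffAt 𝓘(ℝ, F) (𝓡 n) 1 Ψ a := (hΨ a ha).contMDiffAt (hV.mem_nhds ha)
  have hline : ContinuousAt (fun t : ℝ => a + t • v) 0 := by fun_prop
  have hderiv : HasDerivAt (fun t : ℝ => φ (Ψ (a + t • v)))
      (covd n φ (Ψ a) (pushd n Ψ a v)) 0 := by
    rw [covd_pushd hφ hΨa]
    have hc : ContMDiffAt 𝓘(ℝ, F) 𝓘(ℝ, ℝ) 1 (φ ∘ Ψ) a := hφ.comp a hΨa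
    have h1 : HasFDerivAt (φ ∘ Ψ) (fderiv ℝ (φ ∘ Ψ) a) (a + (0 : ℝ) • v) := by
      rw [zero_smul, add_zero]
      exact ((contMDiffAt_iff_contDiffAt.1 hc).differentiableAt one_ne_zero).hasFDerivAt
    have h2 : HasDerivAt (fun t : ℝ => a + t • v) v 0 := by
      simpa using ((hasDerivAt_id (0 : ℝ)).smul_const v).const_add a
    exact h1.comp_hasDerivAt 0 h2
  have hlim := (hasDerivAt_iff_tendsto_slope_zero.1 hderiv).mono_left
    (nhdsWithin_mono _ (fun t (ht : (0 : ℝ) < t) => ht.ne') : 𝓝[>] (0 : ℝ) ≤ _)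
  simp only [zero_add, zero_smul, add_zero, smul_eq_mul] at hlim
  have key : ∀ ε > 0, |covd n φ (Ψ a) (pushd n Ψ a v)| ≤
      (lipSlope φ (Ψ a) + ε) * (‖pushd n Ψ a v‖ + ε) := by
    intro ε hε
    refine le_of_tendsto hlim.abs ?_
    have hS0 := lipSlope_nonneg φ (Ψ a)
    have h1 := hφ.ptLip.eventually_le (lt_add_of_pos_right (lipSlope φ (Ψ a)) hε)
    have hcomp : Tendsto (fun t : ℝ => Ψ (a + t • v)) (𝓝[>] 0) (𝓝 (Ψ a)) := by
      have : ContinuousAt (fun t : ℝ => Ψ (a + t • v)) 0 :=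
        ContinuousAt.comp (by simpa using hΨa.continuousAt) hline
      simpa [ContinuousAt] using this.mono_left nhdsWithin_le_nhds
    have h2 : ∀ᶠ y in 𝓝 a, y ∈ V ∧ ‖pushd n Ψ y v‖ < ‖pushd n Ψ a v‖ + ε :=
      Filter.Eventually.and (hV.mem_nhds ha) (((continuousOn_norm_pushd hV hΨ v).continuousAt
        (hV.mem_nhds ha)).eventually (gt_mem_nhds (lt_add_of_pos_right _ hε)))
    have h3 : ∀ᶠ t : ℝ in 𝓝 0, a + t • v ∈ V ∧
        ‖pushd n Ψ (a + t • v) v‖ < ‖pushd n Ψ a v‖ + ε :=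
      Tendsto.eventually (show Tendsto (fun t : ℝ => a + t • v) (𝓝 0) (𝓝 a) by
        simpa [ContinuousAt] using hline) h2
    obtain ⟨δ, hδ, hball⟩ := Metric.eventually_nhds_iff.1 h3
    have h4 : ∀ᶠ t : ℝ in 𝓝[>] 0, t < δ := nhdsWithin_le_nhds (gt_mem_nhds hδ)
    filter_upwards [hcomp.eventually h1, h4, self_mem_nhdsWithin] with t ht1 ht2 ht0
    have ht0 : 0 < t := ht0
    have hd : dist (Ψ a) (Ψ (a + t • v)) ≤ t * (‖pushd n Ψ a v‖ + ε) := by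
      refine dist_le_of_norm_pushd_le hV hΨ (by positivity) fun s hs => ?_
      have hst : dist (s * t) 0 < δ := by
        rw [Real.dist_eq, sub_zero, abs_of_nonneg (mul_nonneg hs.1 ht0.le)]
        nlinarith [hs.2]
      have := hball hst
      rw [smul_smul]
      refine ⟨this.1, ?_⟩
      rw [map_smul, norm_smul, Real.norm_of_nonneg ht0.le]
      exact mul_le_mul_of_nonneg_left this.2.le ht0.le
    rw [abs_mul, abs_of_pos (inv_pos.2 ht0), inv_mul_le_iff₀ ht0]
    rw [dist_comm] at hd
    calc _ ≤ (lipSlope φ (Ψ a) + ε) * dist (Ψ (a + t • v)) (Ψ a) := ht1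
      _ ≤ (lipSlope φ (Ψ a) + ε) * (t * (‖pushd n Ψ a v‖ + ε)) := by gcongr
      _ = _ := by ring
  have hlim2 : Tendsto (fun ε => (lipSlope φ (Ψ a) + ε) * (‖pushd n Ψ a v‖ + ε)) (𝓝[>] 0)
      (𝓝 (lipSlope φ (Ψ a) * ‖pushd n Ψ a v‖)) := by
    have : ContinuousAt (fun ε => (lipSlope φ (Ψ a) + ε) * (‖pushd n Ψ a v‖ + ε)) 0 := by fun_prop
    simpa using this.tendsto.mono_left nhdsWithin_le_nhds
  exact ge_of_tendsto hlim2 (by filter_upwards [self_mem_nhdsWithin] with ε hε using key ε hε)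

theorem abs_covd_le_lipSlope {φ : U → ℝ} {x : U} (hφ : ContMDiffAt (𝓡 n) 𝓘(ℝ, ℝ) 1 φ x)
    (ξ : TangentSpace (𝓡 n) x) : |covd n φ x ξ| ≤ lipSlope φ x * ‖ξ‖ := by
  let e := chartAt (EuclideanSpace ℝ (Fin n)) x
  have hex : e.symm (e x) = x := e.left_inv (mem_chart_source _ x)
  -- Stated at a general coordinate point, so that the identity between `e.symm (e x)` and x is
  -- substituted once, in the whole statement including the tangent space.
  have key : ∀ a ∈ e.target, ContMDiffAt (𝓡 n) 𝓘(ℝ, ℝ) 1 φ (e.symm a) →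
      ∀ ξ : TangentSpace (𝓡 n) (e.symm a), |covd n φ (e.symm a) ξ| ≤
        lipSlope φ (e.symm a) * ‖ξ‖ := by
    intro a ha hφ ξ
    rw [← pushd_covd contMDiffOn_chart contMDiffOn_chart_symm ha ξ]
    exact abs_covd_pushd_le e.open_target contMDiffOn_chart_symm ha hφ _
  have := key (e x) (e.map_source (mem_chart_source _ x))
  rw [hex] at this
  exact this hφ ξ

/-- The slope of a `C¹` function is the norm of its differential. -/
theorem lipSlope_eq_norm_covd {φ : U → ℝ} {x : U} (hφ : ContMDiffAt (𝓡 n) 𝓘(ℝ, ℝ) 1 φ x) :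
    lipSlope φ x = ‖covd n φ x‖ :=
  le_antisymm (lipSlope_le_of_covd_le hφ (ContinuousLinearMap.opNorm_nonneg _) fun ξ => (covd n φ x).le_opNorm ξ)
    ((covd n φ x).opNorm_le_bound (lipSlope_nonneg _ _) fun ξ => abs_covd_le_lipSlope hφ ξ)

/-- The slope of a C¹ function is the norm of a linear form on an inner product space, and Riesz
duality carries the parallelogram law over. The Hilbert structure of the Sobolev space originates
here. -/
theorem lipSlope_parallelogram {φ ψ : U → ℝ} {x : U} (hφ : ContMDiffAt (𝓡 n) 𝓘(ℝ, ℝ) 1 φ x)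
    (hψ : ContMDiffAt (𝓡 n) 𝓘(ℝ, ℝ) 1 ψ x) :
    lipSlope (φ + ψ) x ^ 2 + lipSlope (φ - ψ) x ^ 2 =
      2 * (lipSlope φ x ^ 2 + lipSlope ψ x ^ 2) := by
  have h1 : covd n (φ + ψ) x = covd n φ x + covd n ψ x :=
    mfderiv_add (hφ.mdifferentiableAt one_ne_zero) (hψ.mdifferentiableAt one_ne_zero)
  have h2 : covd n (φ - ψ) x = covd n φ x - covd n ψ x :=
    mfderiv_sub (hφ.mdifferentiableAt one_ne_zero) (hψ.mdifferentiableAt one_ne_zero)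
  have : CompleteSpace (TangentSpace (𝓡 n) x) := FiniteDimensional.complete ℝ _
  have h3 : lipSlope (φ + ψ) x = ‖covd n (φ + ψ) x‖ := lipSlope_eq_norm_covd (hφ.add hψ)
  have h4 : lipSlope (φ - ψ) x = ‖covd n (φ - ψ) x‖ := lipSlope_eq_norm_covd (hφ.sub hψ)
  rw [lipSlope_eq_norm_covd hφ, lipSlope_eq_norm_covd hψ, h3, h4, h1, h2]
  let L := (InnerProductSpace.toDual ℝ (TangentSpace (𝓡 n) x)).symm
  have hL : ∀ l, ‖l‖ = ‖L l‖ := fun l => (L.norm_map l).symm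
  rw [hL, hL (_ - _), hL (covd n φ x), hL (covd n ψ x), map_add, map_sub]
  have := parallelogram_law_with_norm ℝ (L (covd n φ x)) (L (covd n ψ x))
  simpa only [sq] using this

end Parametrization

/-! ### Change of variables for the Riemannian volume -/

/-- The Gram matrix of a linear map defined on a Euclidean space. -/
def linGram {n : ℕ} {V : Type*} [NormedAddCommGroup V] [InnerProductSpace ℝ V]
    (p : EuclideanSpace ℝ (Fin n) →L[ℝ] V) : Matrix (Fin n) (Fin n) ℝ :=
  Matrix.of fun i j => inner ℝ (p (EuclideanSpace.single i 1)) (p (EuclideanSpace.single j 1))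

theorem det_linGram_comp {n : ℕ} {V : Type*} [NormedAddCommGroup V] [InnerProductSpace ℝ V]
    (p : EuclideanSpace ℝ (Fin n) →L[ℝ] V)
    (L : EuclideanSpace ℝ (Fin n) →L[ℝ] EuclideanSpace ℝ (Fin n)) :
    (linGram (p.comp L)).det = L.det ^ 2 * (linGram p).det := by
  let b := (EuclideanSpace.basisFun (Fin n) ℝ).toBasis
  let J := LinearMap.toMatrix b b (L : EuclideanSpace ℝ (Fin n) →ₗ[ℝ] EuclideanSpace ℝ (Fin n))
  have hb : ∀ i, b i = EuclideanSpace.single i (1 : ℝ) := fun i => by simp [b]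
  have hL : ∀ i, L (EuclideanSpace.single i 1) = ∑ k, J k i • EuclideanSpace.single k (1 : ℝ) := by
    intro i
    have := b.sum_repr (L (b i))
    rw [hb i] at this
    rw [← this]
    refine Finset.sum_congr rfl fun k _ => ?_
    simp [J, LinearMap.toMatrix_apply, hb]
  have h : linGram (p.comp L) = J.transpose * linGram p * J := by
    ext i j
    simp only [linGram, Matrix.of_apply, ContinuousLinearMap.comp_apply, hL, map_sum, map_smul,
      sum_inner, inner_sum, inner_smul_left, inner_smul_right, Matrix.mul_apply,
      Matrix.transpose_apply, Finset.sum_mul, Finset.mul_sum, RCLike.conj_to_real]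
    exact Finset.sum_congr rfl fun k _ => Finset.sum_congr rfl fun l _ => by ring
  have hdet : L.det = J.det := (LinearMap.det_toMatrix b _).symm
  rw [h, Matrix.det_mul, Matrix.det_mul, Matrix.det_transpose, hdet]
  ring

theorem ContinuousOn.measurableSet_inter_preimage {α β : Type*} [TopologicalSpace α]
    [MeasurableSpace α] [BorelSpace α] [TopologicalSpace β] [MeasurableSpace β] [BorelSpace β]
    {f : α → β} {s : Set α} (hf : ContinuousOn f s) (hs : MeasurableSet s) {t : Set β}
    (ht : MeasurableSet t) : MeasurableSet (s ∩ f ⁻¹' t) := by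
  have h := hs.subtype_image ((continuousOn_iff_continuous_domRestrict.1 hf).measurable ht)
  convert! h using 1
  ext x
  simp [and_comm]

section Volume

variable {n : ℕ} {U : Type*} [MetricSpace U] [ChartedSpace (EuclideanSpace ℝ (Fin n)) U]
  [RiemannianBundle (fun x : U => TangentSpace (𝓡 n) x)] [MeasurableSpace U]

/-- The Riemannian volume element of a parametrization. -/
def volElement (Ψ : EuclideanSpace ℝ (Fin n) → U) (y : EuclideanSpace ℝ (Fin n)) : ℝ≥0∞ :=
  ENNReal.ofReal (√(linGram (pushd n Ψ y)).det)

/-- The Riemannian volume carried by the domain of a coordinate system. -/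
def coordVolume (e : OpenPartialHomeomorph U (EuclideanSpace ℝ (Fin n))) : Measure U :=
  Measure.map e.symm ((volume.restrict e.target).withDensity (volElement e.symm))

theorem chartVolume_eq (x : U) :
    chartVolume (n := n) x = coordVolume (chartAt (EuclideanSpace ℝ (Fin n)) x) := rfl

variable [BorelSpace U]

theorem coordVolume_apply (e : OpenPartialHomeomorph U (EuclideanSpace ℝ (Fin n))) {A : Set U}
    (hA : MeasurableSet A) :
    coordVolume e A = ∫⁻ y in e.target ∩ e.symm ⁻¹' A, volElement e.symm y := by
  have hm : AEMeasurable e.symm ((volume.restrict e.target).withDensity (volElement e.symm)) :=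
    (e.continuousOn_symm.aemeasurable e.open_target.measurableSet).mono_ac
      (withDensity_absolutelyContinuous _ _)
  rw [coordVolume, Measure.map_apply_of_aemeasurable hm hA, withDensity_apply',
    Measure.restrict_restrict' e.open_target.measurableSet, inter_comm]

theorem coordVolume_inter_source (e : OpenPartialHomeomorph U (EuclideanSpace ℝ (Fin n)))
    {A : Set U} (hA : MeasurableSet A) : coordVolume e (A ∩ e.source) = coordVolume e A := by
  rw [coordVolume_apply e hA, coordVolume_apply e (hA.inter e.open_source.measurableSet)]
  congr 2
  ext y
  constructor
  · rintro ⟨h1, h2, -⟩; exact ⟨h1, h2⟩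
  · rintro ⟨h1, h2⟩; exact ⟨h1, h2, e.map_target h1⟩

theorem linGram_pushd_congr {Ψ Ψ' : EuclideanSpace ℝ (Fin n) → U} {a : EuclideanSpace ℝ (Fin n)}
    (h : Ψ =ᶠ[𝓝 a] Ψ') : linGram (pushd n Ψ a) = linGram (pushd n Ψ' a) := by
  -- The two derivatives take values in tangent spaces at points that are only propositionally
  -- equal; this transports the inner product from one to the other.
  have key : ∀ z z' : U, z = z' → ∀ v w : EuclideanSpace ℝ (Fin n),
      inner ℝ (show TangentSpace (𝓡 n) z from v) (show TangentSpace (𝓡 n) z from w) =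
      inner ℝ (show TangentSpace (𝓡 n) z' from v) (show TangentSpace (𝓡 n) z' from w) := by
    rintro z _ rfl v w
    rfl
  have hm := h.mfderiv_eq (I := 𝓘(ℝ, EuclideanSpace ℝ (Fin n))) (I' := 𝓡 n)
  ext i j
  simp only [linGram, Matrix.of_apply]
  rw [pushd, hm]
  exact key _ _ h.self_of_nhds _ _

/-- Change of variables along the transition map: the Gram determinant is multiplied by the square
of the Jacobian determinant, so its square root absorbs the Jacobian factor. -/
theorem coordVolume_eq {e e' : OpenPartialHomeomorph U (EuclideanSpace ℝ (Fin n))}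
    (he : ContMDiffOn (𝓡 n) (𝓡 n) 1 e e.source) (hs : ContMDiffOn (𝓡 n) (𝓡 n) 1 e.symm e.target)
    (hs' : ContMDiffOn (𝓡 n) (𝓡 n) 1 e'.symm e'.target) {A : Set U} (hA : MeasurableSet A)
    (hAe : A ⊆ e.source) (hAe' : A ⊆ e'.source) : coordVolume e A = coordVolume e' A := by
  set D := e'.target ∩ e'.symm ⁻¹' A with hD
  have hDm : MeasurableSet D :=
    e'.continuousOn_symm.measurableSet_inter_preimage e'.open_target.measurableSet hA
  let f : EuclideanSpace ℝ (Fin n) → EuclideanSpace ℝ (Fin n) := e ∘ e'.symm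
  have himg : f '' D = e.target ∩ e.symm ⁻¹' A := by
    ext y
    constructor
    · rintro ⟨z, ⟨hz, hzA⟩, rfl⟩
      refine ⟨e.map_source (hAe hzA), ?_⟩
      simp only [f, mem_preimage, Function.comp_apply]
      rwa [e.left_inv (hAe hzA)]
    · rintro ⟨hy, hyA⟩
      have hyA : e.symm y ∈ A := hyA
      refine ⟨e' (e.symm y), ⟨e'.map_source (hAe' hyA), ?_⟩, ?_⟩
      · rwa [mem_preimage, e'.left_inv (hAe' hyA)]
      · simp only [f, Function.comp_apply]
        rw [e'.left_inv (hAe' hyA), e.right_inv hy]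
  have hinj : InjOn f D := by
    rintro y ⟨hy, hyA⟩ z ⟨hz, hzA⟩ hyz
    have h1 := e.injOn (hAe hyA) (hAe hzA) hyz
    exact e'.symm.injOn hy hz h1
  have hfd : ∀ y ∈ D, ContMDiffAt (𝓡 n) (𝓡 n) 1 e'.symm y ∧
      ContMDiffAt (𝓡 n) 𝓘(ℝ, EuclideanSpace ℝ (Fin n)) 1 f y := by
    rintro y ⟨hy, hyA⟩
    have h1 := (hs' y hy).contMDiffAt (e'.open_target.mem_nhds hy)
    exact ⟨h1, ((he _ (hAe hyA)).contMDiffAt (e.open_source.mem_nhds (hAe hyA))).comp y h1⟩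
  have hder : ∀ y ∈ D, HasFDerivWithinAt f (fderiv ℝ f y) D y := fun y hy =>
    ((contMDiffAt_iff_contDiffAt.1 (hfd y hy).2).differentiableAt one_ne_zero).hasFDerivAt
      |>.hasFDerivWithinAt
  rw [coordVolume_apply e hA, coordVolume_apply e' hA, ← himg,
    lintegral_image_eq_lintegral_abs_det_fderiv_mul volume hDm hder hinj]
  refine setLIntegral_congr_fun hDm fun y hy => ?_
  have hyA : e'.symm y ∈ A := hy.2
  have hev : e'.symm =ᶠ[𝓝 y] e.symm ∘ f := by
    have : ∀ᶠ z in 𝓝 y, e'.symm z ∈ e.source :=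
      (hfd y hy).1.continuousAt.eventually (e.open_source.mem_nhds (hAe hyA))
    filter_upwards [this] with z hz
    exact (e.left_inv hz).symm
  have hfy : f y ∈ e.target := e.map_source (hAe hyA)
  have hcomp : pushd n (e.symm ∘ f) y = (pushd n e.symm (f y)).comp (fderiv ℝ f y) := by
    have h : mfderiv 𝓘(ℝ, EuclideanSpace ℝ (Fin n)) (𝓡 n) (e.symm ∘ f) y =
        (mfderiv 𝓘(ℝ, EuclideanSpace ℝ (Fin n)) (𝓡 n) e.symm (f y)).comp
          (mfderiv 𝓘(ℝ, EuclideanSpace ℝ (Fin n)) 𝓘(ℝ, EuclideanSpace ℝ (Fin n)) f y) :=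
      mfderiv_comp y (((hs _ hfy).contMDiffAt (e.open_target.mem_nhds hfy)).mdifferentiableAt
        one_ne_zero) ((hfd y hy).2.mdifferentiableAt one_ne_zero)
    rw [mfderiv_eq_fderiv] at h
    exact h
  have hgram : (linGram (pushd n e'.symm y)).det =
      (fderiv ℝ f y).det ^ 2 * (linGram (pushd n e.symm (f y))).det := by
    rw [linGram_pushd_congr hev, hcomp]
    exact det_linGram_comp _ _
  simp only [volElement]
  rw [hgram, Real.sqrt_mul (sq_nonneg _), Real.sqrt_sq_eq_abs, ENNReal.ofReal_mul (abs_nonneg _)]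

variable [IsManifold (𝓡 n) ∞ U]

theorem chartVolume_le (x : U) {e : OpenPartialHomeomorph U (EuclideanSpace ℝ (Fin n))}
    (hs : ContMDiffOn (𝓡 n) (𝓡 n) 1 e.symm e.target) {A : Set U} (hA : MeasurableSet A)
    (hAe : A ⊆ e.source) : chartVolume (n := n) x A ≤ coordVolume e A := by
  set e' := chartAt (EuclideanSpace ℝ (Fin n)) x
  rw [chartVolume_eq, ← coordVolume_inter_source _ hA]
  rw [coordVolume_eq (e := e') contMDiffOn_chart contMDiffOn_chart_symm hs
    (hA.inter e'.open_source.measurableSet) inter_subset_right (inter_subset_left.trans hAe)]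
  exact measure_mono inter_subset_left

/-- A supremum of measures is not computed set by set. Instead one exhibits a measure above all
chart volumes: the coordinate volume of e plus the restriction of the Riemannian volume to the
complement of the source, and the latter does not charge A. -/
theorem riemannianVolume_le_coordVolume {e : OpenPartialHomeomorph U (EuclideanSpace ℝ (Fin n))}
    (hs : ContMDiffOn (𝓡 n) (𝓡 n) 1 e.symm e.target) {A : Set U} (hA : MeasurableSet A)
    (hAe : A ⊆ e.source) : riemannianVolume n U A ≤ coordVolume e A := by
  have hle : riemannianVolume n U ≤
      coordVolume e + (riemannianVolume n U).restrict e.sourceᶜ := by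
    refine iSup_le fun x => Measure.le_iff.2 fun B hB => ?_
    have hsm := e.open_source.measurableSet
    calc chartVolume (n := n) x B
        ≤ chartVolume (n := n) x (B ∩ e.source) + chartVolume (n := n) x (B ∩ e.sourceᶜ) := by
          rw [← sdiff_eq, measure_inter_add_sdiff B hsm]
      _ ≤ coordVolume e B + riemannianVolume n U (B ∩ e.sourceᶜ) := by
          refine add_le_add ((chartVolume_le x hs (hB.inter hsm) inter_subset_right).trans
            (measure_mono inter_subset_left)) ?_
          exact (le_iSup (fun x : U => chartVolume (n := n) x) x) _
      _ = _ := by rw [Measure.add_apply, Measure.restrict_apply hB]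
  refine (hle A).trans ?_
  rw [Measure.add_apply, Measure.restrict_apply hA,
    (disjoint_compl_right_iff_subset.2 hAe).inter_eq, measure_empty, add_zero]

/-- Carries almost-everywhere statements from a chart to the manifold, such as the convergence of
mollifications. -/
theorem riemannianVolume_source_inter_preimage_null
    {e : OpenPartialHomeomorph U (EuclideanSpace ℝ (Fin n))}
    (hs : ContMDiffOn (𝓡 n) (𝓡 n) 1 e.symm e.target) {N : Set (EuclideanSpace ℝ (Fin n))}
    (hN : volume N = 0) : riemannianVolume n U (e.source ∩ e ⁻¹' N) = 0 := by
  have hm := e.continuousOn.measurableSet_inter_preimage e.open_source.measurableSet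
    (measurableSet_toMeasurable volume N)
  refine measure_mono_null (inter_subset_inter_right _
    (preimage_mono (subset_toMeasurable volume N))) (le_antisymm ?_ bot_le)
  refine (riemannianVolume_le_coordVolume hs hm inter_subset_left).trans ?_
  rw [coordVolume_apply e hm]
  refine (setLIntegral_measure_zero _ _ (measure_mono_null ?_
    ((measure_toMeasurable N).trans hN))).le
  rintro y ⟨hy, -, hyN⟩
  rwa [mem_preimage, e.right_inv hy] at hyN

variable [IsContMDiffRiemannianBundle (𝓡 n) ∞ (EuclideanSpace ℝ (Fin n))
    (fun x : U => TangentSpace (𝓡 n) x)]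

theorem continuousOn_volElement {Ψ : EuclideanSpace ℝ (Fin n) → U}
    {V : Set (EuclideanSpace ℝ (Fin n))} (hV : IsOpen V)
    (hΨ : ContMDiffOn 𝓘(ℝ, EuclideanSpace ℝ (Fin n)) (𝓡 n) 1 Ψ V) :
    ContinuousOn (volElement Ψ) V := by
  have h : ContinuousOn (fun y => linGram (pushd n Ψ y)) V :=
    continuousOn_pi.2 fun i => continuousOn_pi.2 fun j => continuousOn_inner_pushd hV hΨ _ _
  exact ENNReal.continuous_ofReal.comp_continuousOn
    ((Continuous.matrix_det continuous_id).comp_continuousOn h).sqrt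

instance isLocallyFiniteMeasure_riemannianVolume :
    IsLocallyFiniteMeasure (riemannianVolume n U) := by
  refine ⟨fun x => ?_⟩
  let e := chartAt (EuclideanSpace ℝ (Fin n)) x
  have hs : ContMDiffOn (𝓡 n) (𝓡 n) 1 e.symm e.target := contMDiffOn_chart_symm
  have hx : e x ∈ e.target := e.map_source (mem_chart_source _ x)
  have hc := (continuousOn_volElement e.open_target hs).continuousAt (e.open_target.mem_nhds hx)
  have hlt : ∀ᶠ y in 𝓝 (e x), volElement e.symm y < volElement e.symm (e x) + 1 :=
    hc.eventually (gt_mem_nhds (ENNReal.lt_add_right ENNReal.ofReal_ne_top one_ne_zero))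
  obtain ⟨r, hr, hball⟩ := Metric.eventually_nhds_iff_ball.1 hlt
  have hO : IsOpen (e.source ∩ e ⁻¹' Metric.ball (e x) r) :=
    e.isOpen_inter_preimage Metric.isOpen_ball
  refine ⟨_, hO.mem_nhds ⟨mem_chart_source _ x, Metric.mem_ball_self hr⟩, ?_⟩
  refine (riemannianVolume_le_coordVolume hs hO.measurableSet inter_subset_left).trans_lt ?_
  rw [coordVolume_apply e hO.measurableSet]
  have hsub : e.target ∩ e.symm ⁻¹' (e.source ∩ e ⁻¹' Metric.ball (e x) r) ⊆
      Metric.ball (e x) r := by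
    rintro y ⟨hy, -, hyb⟩
    rwa [mem_preimage, e.right_inv hy] at hyb
  calc ∫⁻ y in e.target ∩ e.symm ⁻¹' (e.source ∩ e ⁻¹' Metric.ball (e x) r), volElement e.symm y
      ≤ ∫⁻ y in Metric.ball (e x) r, volElement e.symm y := lintegral_mono_set hsub
    _ ≤ ∫⁻ y in Metric.ball (e x) r, (volElement e.symm (e x) + 1) :=
        setLIntegral_mono' measurableSet_ball fun y hy => (hball y hy).le
    _ < ⊤ := by
        rw [setLIntegral_const]
        exact ENNReal.mul_lt_top (ENNReal.add_lt_top.2 ⟨ENNReal.ofReal_lt_top, ENNReal.one_lt_top⟩)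
          measure_ball_lt_top

theorem isLocallyFiniteMeasure_withDensity_riemannianVolume {w : U → ℝ} (hw : Continuous w) :
    IsLocallyFiniteMeasure ((riemannianVolume n U).withDensity fun x => ENNReal.ofReal (w x)) := by
  refine ⟨fun x => ?_⟩
  obtain ⟨s, hs, hfin⟩ := (riemannianVolume n U).finiteAt_nhds x
  have hlt : ∀ᶠ y in 𝓝 x, w y < w x + 1 := hw.continuousAt.eventually (gt_mem_nhds (lt_add_one _))
  obtain ⟨t, ht, hto, hxt⟩ := mem_nhds_iff.1 (inter_mem hs hlt)
  refine ⟨t, hto.mem_nhds hxt, ?_⟩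
  rw [withDensity_apply _ hto.measurableSet]
  calc ∫⁻ y in t, ENNReal.ofReal (w y) ∂(riemannianVolume n U)
      ≤ ∫⁻ y in t, ENNReal.ofReal (w x + 1) ∂(riemannianVolume n U) :=
        setLIntegral_mono' hto.measurableSet fun y hy =>
          ENNReal.ofReal_le_ofReal (ht hy).2.le
    _ < ⊤ := by
        rw [setLIntegral_const]
        exact ENNReal.mul_lt_top ENNReal.ofReal_lt_top
          ((measure_mono fun y hy => (ht hy).1).trans_lt hfin)

end Volume

/-! ### Cutoff functions at infinity -/

section HopfRinow

variable {U : Type*} [MetricSpace U]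

/-- `Reach V x₀ c x`: one can go from `x₀` to `x` by finitely many jumps of total length `c`, each
of which is short compared with the distance to the complement of `V`. -/
inductive Reach (V : Set U) (x₀ : U) : ℝ → U → Prop
  | base : x₀ ∈ V → Reach V x₀ 0 x₀
  | step {c : ℝ} {x y : U} {r : ℝ} : Reach V x₀ c x → 2 * dist x y < r → Metric.ball x r ⊆ V →
      Reach V x₀ (c + dist x y) y

theorem IsComplete.of_isClosed_subset {C K : Set U} (hC : IsComplete C) (hK : IsClosed K)
    (hKC : K ⊆ C) : IsComplete K := fun l hl hlK => by
  obtain ⟨x, -, hx⟩ := hC l hl (hlK.trans (principal_mono.2 hKC))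
  have := hl.1
  exact ⟨x, hK.mem_of_tendsto (f := id) hx (le_principal_iff.1 hlK), hx⟩

variable {V : Set U} {x₀ : U}

theorem Reach.mono {W : Set U} (hVW : V ⊆ W) {c : ℝ} {x : U} (h : Reach V x₀ c x) :
    Reach W x₀ c x := by
  induction h with
  | base h => exact .base (hVW h)
  | step _ h1 h2 ih => exact .step ih h1 (h2.trans hVW)

theorem Reach.mem {c : ℝ} {x : U} (h : Reach V x₀ c x) : x ∈ V := by
  cases h with
  | base h => exact h
  | @step c y _ r _ h1 h2 =>
    refine h2 (Metric.mem_ball'.2 ?_)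
    linarith [dist_nonneg (x := y) (y := x)]

theorem Reach.dist_le {c : ℝ} {x : U} (h : Reach V x₀ c x) : dist x₀ x ≤ c := by
  induction h with
  | base h => simp
  | step _ h1 h2 ih => exact (dist_triangle _ _ _).trans (by gcongr)

/-- The chain is cut where its cost would reach a. An approximate midpoint shortens the jump that
crosses a; the shortened jump starts from the same centre and is no longer than the original, so the
same ball in V makes it admissible. -/
theorem Reach.exists_intermediate (hmid : ∀ (x y : U) (a b : ℝ), 0 < a → 0 < b →
    dist x y < a + b → ∃ z, dist x z < a ∧ dist z y < b) {c : ℝ} {x : U} (h : Reach V x₀ c x) {a : ℝ}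
    (ha : 0 < a) : ∀ {b : ℝ}, 0 < b → c < a + b →
      ∃ z c', Reach V x₀ c' z ∧ c' < a ∧ dist z x < b := by
  induction h with
  | base h => exact fun hb hc => ⟨x₀, 0, .base h, ha, by simpa using hb⟩
  | @step c x y r h h1 h2 ih =>
    intro b hb hc
    by_cases hca : c + dist x y < a
    · exact ⟨y, _, .step h h1 h2, hca, by simpa using hb⟩
    by_cases hc' : c < a
    · obtain ⟨z, hz1, hz2⟩ := hmid x y (a - c) b (by linarith) hb (by linarith)
      exact ⟨z, _, .step h (r := r) (by linarith) h2, by linarith, hz2⟩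
    · obtain ⟨z, c', hz, hca', hd⟩ := ih (b := b - dist x y) (by linarith) (by linarith)
      exact ⟨z, c', hz, hca', by linarith [dist_triangle z x y]⟩

/-- A local form of the Hopf–Rinow theorem. -/
theorem totallyBounded_reach [LocallyCompactSpace U]
    (hmid : ∀ (x y : U) (a b : ℝ), 0 < a → 0 < b →
      dist x y < a + b → ∃ z, dist x z < a ∧ dist z y < b)
    {C : Set U} (hC : IsComplete C) (hVC : V ⊆ C) (L : ℝ) :
    TotallyBounded {x | ∃ c < L, Reach V x₀ c x} := by
  set R : ℝ → Set U := fun L => {x | ∃ c < L, Reach V x₀ c x} with hR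
  have hmono : ∀ {a b : ℝ}, a ≤ b → R a ⊆ R b := fun hab x ⟨c, hc, h⟩ => ⟨c, hc.trans_le hab, h⟩
  by_contra hL
  have hbdd : BddAbove {a | TotallyBounded (R a)} :=
    ⟨L, fun a ha => not_lt.1 fun hlt => hL (ha.subset (hmono hlt.le))⟩
  have hball : ∀ a, R a ⊆ Metric.ball x₀ a := fun a x ⟨c, hc, h⟩ =>
    Metric.mem_ball'.2 (h.dist_le.trans_lt hc)
  obtain ⟨t₀, ht₀, htb⟩ : ∃ t > 0, TotallyBounded (R t) := by
    obtain ⟨K, hK, hxK⟩ := exists_compact_mem_nhds x₀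
    obtain ⟨t, ht, htK⟩ := Metric.mem_nhds_iff.1 hxK
    exact ⟨t, ht, hK.totallyBounded.subset ((hball t).trans htK)⟩
  -- The costs with a totally bounded reachable set include their supremum s, since points reached
  -- at cost below s are close to points reached at cost below s - d. Completeness of C makes the
  -- closure of `R s` compact and local compactness gives it a compact thickening, so costs slightly
  -- above s qualify too: a contradiction.
  set s := sSup {a | TotallyBounded (R a)} with hs
  have hs0 : 0 < s := ht₀.trans_le (le_csSup hbdd htb)
  have hlt : ∀ a < s, TotallyBounded (R a) := fun a ha => by
    obtain ⟨b, hb, hab⟩ := exists_lt_of_lt_csSup ⟨t₀, htb⟩ ha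
    exact TotallyBounded.subset (hmono hab.le) hb
  have hst : TotallyBounded (R s) := by
    rw [Metric.totallyBounded_iff]
    intro ε hε
    obtain ⟨d, hd0, hds, hdε⟩ : ∃ d > 0, d < s ∧ d < ε / 2 :=
      ⟨min s (ε / 2) / 2, by positivity, by linarith [min_le_left s (ε / 2)],
        by linarith [min_le_right s (ε / 2), lt_min hs0 (half_pos hε)]⟩
    obtain ⟨T, hT, hcov⟩ := Metric.totallyBounded_iff.1 (hlt (s - d) (by linarith)) (ε / 2)
      (by linarith)
    refine ⟨T, hT, fun x ⟨c, hc, h⟩ => ?_⟩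
    obtain ⟨z, c', hz, hc', hd⟩ := h.exists_intermediate hmid (a := s - d) (by linarith)
      (b := d) hd0 (by linarith)
    obtain ⟨y, hy, hzy⟩ := mem_iUnion₂.1 (hcov ⟨c', hc', hz⟩)
    refine mem_iUnion₂.2 ⟨y, hy, ?_⟩
    rw [Metric.mem_ball] at hzy ⊢
    linarith [dist_triangle_left x y z]
  have hKC : closure (R s) ⊆ C := closure_minimal (fun x ⟨c, _, h⟩ => hVC h.mem) hC.isClosed
  have hK : IsCompact (closure (R s)) :=
    isCompact_iff_totallyBounded_isComplete.2 ⟨hst.closure, hC.of_isClosed_subset isClosed_closure hKC⟩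
  obtain ⟨t, ht, hcomp⟩ := hK.exists_isCompact_cthickening
  have htb : TotallyBounded (R (s + t)) := by
    refine hcomp.totallyBounded.subset fun x ⟨c, hc, h⟩ => ?_
    obtain ⟨z, c', hz, hc', hd⟩ := h.exists_intermediate hmid hs0 ht hc
    exact Metric.mem_cthickening_of_dist_le x z t _ (subset_closure ⟨c', hc', hz⟩)
      (by rw [dist_comm]; exact hd.le)
  have := le_csSup hbdd htb
  linarith

/-- A distance cutoff built from the chain cost inside V: η x is the supremum of θ c over the costs
c of chains reaching x, where θ is 1 up to R, 0 from 2R on, and has slope 1/R. Balls of the ambient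
distance would not do, because short curves may leave V, where completeness is not available. Nearby
points of V are one jump apart, whence the local Lipschitz bound. -/
theorem exists_cutoff [LocallyCompactSpace U]
    (hmid : ∀ (x y : U) (a b : ℝ), 0 < a → 0 < b →
      dist x y < a + b → ∃ z, dist x z < a ∧ dist z y < b)
    (hV : IsOpen V) {C : Set U} (hC : IsComplete C) (hVC : V ⊆ C) {R : ℝ} (hR : 0 < R) :
    ∃ η : U → ℝ, (∀ x, 0 ≤ η x ∧ η x ≤ 1) ∧ HasCompactSupport η ∧
      (∀ x ∈ V, ∃ s ∈ 𝓝 x, ∀ y ∈ s, ∀ z ∈ s, |η y - η z| ≤ 1 / R * dist y z) ∧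
      ∀ x, ∀ c ≤ R, Reach V x₀ c x → η x = 1 := by
  let θ : ℝ → ℝ := fun c => max 0 (min 1 (2 - c / R))
  have hθ0 : ∀ c, 0 ≤ θ c := fun c => le_max_left _ _
  have hθ1 : ∀ c, θ c ≤ 1 := fun c => max_le zero_le_one (min_le_left _ _)
  have hθl : ∀ c d, 0 ≤ d → θ c ≤ θ (c + d) + 1 / R * d := by
    intro c d hd
    have hd' : 0 ≤ 1 / R * d := by positivity
    have e : 2 - (c + d) / R = 2 - c / R - 1 / R * d := by ring
    simp only [θ, e]
    rcases le_total (2 - c / R) 0 with h | h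
    · rw [min_eq_right (by linarith), max_eq_left h]
      positivity
    · have h1 := le_max_right (0 : ℝ) (min 1 (2 - c / R - 1 / R * d))
      have h2 : min 1 (2 - c / R) - 1 / R * d ≤ min 1 (2 - c / R - 1 / R * d) :=
        le_min (by linarith [min_le_left 1 (2 - c / R)]) (by linarith [min_le_right 1 (2 - c / R)])
      rw [max_eq_right (le_min zero_le_one h)]
      linarith
  -- The value 0 is adjoined so that points reached by no chain get η = 0.
  let S : U → Set ℝ := fun x => {0} ∪ {t | ∃ c, Reach V x₀ c x ∧ t = θ c}
  have hSb : ∀ x, BddAbove (S x) := fun x => ⟨1, by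
    rintro t (rfl | ⟨c, -, rfl⟩)
    · exact zero_le_one
    · exact hθ1 c⟩
  have hSn : ∀ x, (S x).Nonempty := fun x => ⟨0, Or.inl rfl⟩
  have hS1 : ∀ x, sSup (S x) ≤ 1 := fun x => csSup_le (hSn x) (by
    rintro t (rfl | ⟨c, -, rfl⟩)
    · exact zero_le_one
    · exact hθ1 c)
  refine ⟨fun x => sSup (S x), fun x => ⟨le_csSup (hSb x) (Or.inl rfl), hS1 x⟩, ?_, ?_, ?_⟩
  · have htb := totallyBounded_reach (x₀ := x₀) hmid hC hVC (2 * R)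
    have hKC : closure {x | ∃ c < 2 * R, Reach V x₀ c x} ⊆ C :=
      closure_minimal (fun x ⟨c, _, h⟩ => hVC h.mem) hC.isClosed
    have hK : IsCompact (closure {x | ∃ c < 2 * R, Reach V x₀ c x}) :=
      isCompact_iff_totallyBounded_isComplete.2
        ⟨htb.closure, hC.of_isClosed_subset isClosed_closure hKC⟩
    refine hK.of_isClosed_subset (isClosed_tsupport _) (closure_mono fun x hx => ?_)
    by_contra hcon
    refine hx (le_antisymm (csSup_le (hSn x) ?_) (le_csSup (hSb x) (Or.inl rfl)))
    rintro t (rfl | ⟨c, hc, rfl⟩)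
    · exact le_rfl
    · have h2 : 2 * R ≤ c := not_lt.1 fun hlt => hcon ⟨c, hlt, hc⟩
      have h3 : 2 - c / R ≤ 0 := by
        rw [sub_nonpos, le_div_iff₀ hR]; exact h2
      exact max_le le_rfl ((min_le_right _ _).trans h3)
  · intro x hx
    obtain ⟨r, hr, hball⟩ := Metric.isOpen_iff.1 hV x hx
    have key : ∀ y ∈ Metric.ball x (r / 8), ∀ z ∈ Metric.ball x (r / 8),
        sSup (S y) ≤ sSup (S z) + 1 / R * dist y z := by
      intro y hy z hz
      rw [Metric.mem_ball] at hy hz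
      refine csSup_le (hSn y) ?_
      rintro t (rfl | ⟨c, hc, rfl⟩)
      · have := le_csSup (hSb z) (Or.inl rfl : (0 : ℝ) ∈ S z)
        positivity
      · have hyz : dist y z < r / 4 := by linarith [dist_triangle_right y z x]
        have hstep : Reach V x₀ (c + dist y z) z := by
          refine hc.step (r := 3 * r / 4) (by linarith) ((fun w hw => hball ?_))
          rw [Metric.mem_ball] at hw ⊢
          linarith [dist_triangle w y x]
        have := le_csSup (hSb z) (Or.inr ⟨_, hstep, rfl⟩ : θ (c + dist y z) ∈ S z)
        linarith [hθl c (dist y z) dist_nonneg]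
    refine ⟨_, Metric.ball_mem_nhds x (by positivity : 0 < r / 8), fun y hy z hz => ?_⟩
    rw [abs_sub_le_iff]
    have h1 := key y hy z hz
    have h2 := key z hz y hy
    rw [dist_comm z y] at h2
    constructor <;> linarith
  · intro x c hc h
    have hθc : θ c = 1 := by
      have : 1 ≤ 2 - c / R := by
        have : c / R ≤ 1 := (div_le_one hR).2 hc
        linarith
      simp [θ, min_eq_left this]
    refine le_antisymm (hS1 x) ?_
    rw [← hθc]
    exact le_csSup (hSb x) (Or.inr ⟨c, h, rfl⟩)

/-- The points reachable inside some member of the exhaustion form a nonempty clopen set. A fixed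
finite cost then works for all later members, so the cutoffs of growing radius are eventually 1 at
each point. -/
theorem exists_reach [PreconnectedSpace U] {V : ℕ → Set U} (hV : ∀ k, IsOpen (V k))
    (hmono : Monotone V) (hcov : ∀ x, ∃ k, x ∈ V k) (x₀ x : U) :
    ∃ c k₀, ∀ k ≥ k₀, Reach (V k) x₀ c x := by
  let Z : Set U := {x | ∃ c k, Reach (V k) x₀ c x}
  have hopen : IsOpen Z := by
    rw [Metric.isOpen_iff]
    rintro x ⟨c, k, h⟩
    obtain ⟨r, hr, hball⟩ := Metric.isOpen_iff.1 (hV k) x h.mem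
    refine ⟨r / 2, by positivity, fun y hy => ⟨_, k, h.step (r := r) ?_ hball⟩⟩
    rw [Metric.mem_ball'] at hy
    linarith
  have hclosed : IsClosed Z := by
    refine isClosed_of_closure_subset fun y hy => ?_
    obtain ⟨k, hk⟩ := hcov y
    obtain ⟨r, hr, hball⟩ := Metric.isOpen_iff.1 (hV k) y hk
    obtain ⟨x, ⟨c, k', h⟩, hxy⟩ := Metric.mem_closure_iff.1 hy (r / 4) (by positivity)
    rw [dist_comm] at hxy
    refine ⟨_, max k k', (h.mono (hmono (le_max_right k k'))).step (r := 3 * r / 4) (by linarith)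
      (fun w hw => hmono (le_max_left k k') (hball ?_))⟩
    rw [Metric.mem_ball] at hw ⊢
    linarith [dist_triangle w x y]
  have hne : Z.Nonempty := by
    obtain ⟨k, hk⟩ := hcov x₀
    exact ⟨x₀, 0, k, .base hk⟩
  obtain ⟨c, k, h⟩ : x ∈ Z := by
    rw [IsClopen.eq_univ ⟨hclosed, hopen⟩ hne]
    exact mem_univ x
  exact ⟨c, k, fun k' hk' => h.mono (hmono hk')⟩

end HopfRinow

/-! ### Mollification of Lipschitz functions on a vector space -/

section Mollification

open scoped Convolution

variable {E : Type*} [NormedAddCommGroup E] [NormedSpace ℝ E]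

theorem HasFDerivAt.lipSlope_le {h : E → ℝ} {h' : E →L[ℝ] ℝ} {x : E} (hh : HasFDerivAt h h' x) :
    lipSlope h x ≤ ‖h'‖ := by
  refine lipSlope_le_of_forall_gt (norm_nonneg _) fun C hC => ?_
  filter_upwards [hh.isLittleO.def (sub_pos.2 hC)] with y hy
  have h1 := h'.le_opNorm (y - x)
  rw [dist_eq_norm]
  calc |h y - h x| = ‖(h y - h x - h' (y - x)) + h' (y - x)‖ := by
        rw [sub_add_cancel, Real.norm_eq_abs]
    _ ≤ (C - ‖h'‖) * ‖y - x‖ + ‖h'‖ * ‖y - x‖ := (norm_add_le _ _).trans (add_le_add hy h1)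
    _ = C * ‖y - x‖ := by ring

variable [FiniteDimensional ℝ E] [MeasurableSpace E] [BorelSpace E] {μ : Measure E}
  [μ.IsAddHaarMeasure]

/-- The derivative is placed on the merely Lipschitz factor: a translation moves the difference
quotient onto v, where it converges in the integral to the line derivative. Derivatives of
mollifications are thereby mollifications of derivatives. -/
theorem fderiv_convolution_apply {ρ v : E → ℝ} {C : ℝ≥0} (hρ : ContDiff ℝ ∞ ρ)
    (hρc : HasCompactSupport ρ) (hv : LipschitzWith C v) (x w : E) :
    fderiv ℝ (ρ ⋆[ContinuousLinearMap.lsmul ℝ ℝ, μ] v) x w =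
      (ρ ⋆[ContinuousLinearMap.lsmul ℝ ℝ, μ] fun y => lineDeriv ℝ v y w) x := by
  have hsm : ContDiff ℝ ∞ (ρ ⋆[ContinuousLinearMap.lsmul ℝ ℝ, μ] v) :=
    hρc.contDiff_convolution_left _ hρ hv.continuous.locallyIntegrable
  have hd : DifferentiableAt ℝ (ρ ⋆[ContinuousLinearMap.lsmul ℝ ℝ, μ] v) x :=
    hsm.differentiable (by simp) x
  have h1 := (hd.hasFDerivAt.hasLineDerivAt w).tendsto_slope_zero_right
  have hsub : ∀ z : E, Continuous fun y => ρ (z - y) := fun z =>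
    hρ.continuous.comp (continuous_const.sub continuous_id)
  have hcs : ∀ z : E, HasCompactSupport fun y => ρ (z - y) := fun z =>
    hρc.comp_homeomorph (Homeomorph.subLeft z)
  have h2 := hv.integral_inv_smul_sub_mul_tendsto_integral_lineDeriv_mul (μ := μ)
    ((hsub x).integrable_of_hasCompactSupport (hcs x)) w
  have h3 : ∀ t : ℝ, t⁻¹ • ((ρ ⋆[ContinuousLinearMap.lsmul ℝ ℝ, μ] v) (x + t • w) -
      (ρ ⋆[ContinuousLinearMap.lsmul ℝ ℝ, μ] v) x) =
      ∫ y, (t⁻¹ • (v (y + t • w) - v y)) * ρ (x - y) ∂μ := by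
    intro t
    have e1 : (ρ ⋆[ContinuousLinearMap.lsmul ℝ ℝ, μ] v) (x + t • w) =
        ∫ y, v (y + t • w) * ρ (x - y) ∂μ := by
      rw [convolution_eq_swap, ← integral_add_right_eq_self _ (t • w)]
      refine integral_congr_ae (Eventually.of_forall fun y => ?_)
      simp [mul_comm]
    have e2 : (ρ ⋆[ContinuousLinearMap.lsmul ℝ ℝ, μ] v) x = ∫ y, v y * ρ (x - y) ∂μ := by
      rw [convolution_eq_swap]
      refine integral_congr_ae (Eventually.of_forall fun y => ?_)
      simp [mul_comm]
    rw [e1, e2, ← integral_sub, smul_eq_mul, ← integral_const_mul]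
    · refine integral_congr_ae (Eventually.of_forall fun y => ?_)
      simp only [smul_eq_mul]
      ring
    · exact ((hv.continuous.comp (continuous_add_const _)).mul
        (hsub x)).integrable_of_hasCompactSupport (hcs x).mul_left
    · exact (hv.continuous.mul (hsub x)).integrable_of_hasCompactSupport (hcs x).mul_left
  simp only [h3] at h1
  rw [tendsto_nhds_unique h1 h2, convolution_eq_swap]
  refine integral_congr_ae (Eventually.of_forall fun y => ?_)
  simp [mul_comm]

/-- Smooth approximations of a Lipschitz function, converging together with their first
derivatives. -/
theorem LipschitzWith.exists_contDiff_approx {v : E → ℝ} {C : ℝ≥0}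
    (hv : LipschitzWith C v) :
    ∃ w : ℕ → E → ℝ, (∀ j, ContDiff ℝ ∞ (w j)) ∧ (∀ j, LipschitzWith C (w j)) ∧
      (∀ j, tsupport (w j) ⊆ Metric.cthickening (1 / ((j : ℝ) + 1)) (tsupport v)) ∧
      (∀ j x, |w j x - v x| ≤ C * (1 / ((j : ℝ) + 1))) ∧
      ∀ᵐ x ∂μ, Tendsto (fun j => lipSlope (fun y => w j y - v y) x) atTop (𝓝 0) := by
  have hpos : ∀ j : ℕ, 0 < 1 / ((j : ℝ) + 1) := fun j => by positivity
  let b : ℕ → ContDiffBump (0 : E) := fun j =>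
    ⟨1 / ((j : ℝ) + 1) / 2, 1 / ((j : ℝ) + 1), half_pos (hpos j), half_lt_self (hpos j)⟩
  let w : ℕ → E → ℝ := fun j => (b j).normed μ ⋆[ContinuousLinearMap.lsmul ℝ ℝ, μ] v
  have hwsm : ∀ j, ContDiff ℝ ∞ (w j) := fun j =>
    (b j).hasCompactSupport_normed.contDiff_convolution_left _ (b j).contDiff_normed
      hv.continuous.locallyIntegrable
  have hb0 : Tendsto (fun j => (b j).rOut) atTop (𝓝 0) := tendsto_one_div_add_atTop_nhds_zero_nat
  refine ⟨w, hwsm, fun j => ?_, fun j => ?_, fun j x => ?_, ?_⟩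
  · refine LipschitzWith.of_dist_le_mul fun x y => ?_
    have hi : ∀ x, Integrable (fun t => (b j).normed μ t • v (x - t)) μ := fun x =>
      ((b j).continuous_normed.smul (hv.continuous.comp
        (continuous_const.sub continuous_id))).integrable_of_hasCompactSupport
        (b j).hasCompactSupport_normed.smul_right
    have e : w j x - w j y = ∫ t, (b j).normed μ t • (v (x - t) - v (y - t)) ∂μ := by
      simp only [smul_sub]
      rw [integral_sub (hi x) (hi y)]
      rfl
    rw [dist_eq_norm, e]
    calc ‖∫ t, (b j).normed μ t • (v (x - t) - v (y - t)) ∂μ‖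
        ≤ ∫ t, (b j).normed μ t * (C * dist x y) ∂μ := by
          refine norm_integral_le_of_norm_le ((b j).integrable_normed.mul_const _)
            (Eventually.of_forall fun t => ?_)
          rw [norm_smul, Real.norm_of_nonneg ((b j).nonneg_normed t)]
          refine mul_le_mul_of_nonneg_left ?_ ((b j).nonneg_normed t)
          have := hv.dist_le_mul (x - t) (y - t)
          rwa [dist_sub_right, dist_eq_norm] at this
      _ = C * dist x y := by
          rw [integral_mul_const, (b j).integral_normed, one_mul]
  · refine closure_minimal (fun x hx => ?_) Metric.isClosed_cthickening
    by_contra hcon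
    refine hx ?_
    have : ∀ t, (b j).normed μ t • v (x - t) = 0 := by
      intro t
      by_cases ht : t ∈ Metric.ball (0 : E) (b j).rOut
      · have : v (x - t) = 0 := by
          by_contra hne
          refine hcon (Metric.mem_cthickening_of_dist_le x (x - t) _ _
            (subset_tsupport _ hne) ?_)
          rw [mem_ball_zero_iff] at ht
          rw [dist_eq_norm, sub_sub_cancel]
          exact ht.le
        rw [this, smul_zero]
      · rw [← (b j).support_normed_eq (μ := μ), Function.notMem_support] at ht
        rw [ht, zero_smul]
    exact (integral_congr_ae (Eventually.of_forall this)).trans (integral_zero _ _)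
  · refine (b j).dist_normed_convolution_le hv.continuous.aestronglyMeasurable fun y hy => ?_
    exact (hv.dist_le_mul y x).trans (by gcongr; exact (Metric.mem_ball.1 hy).le)
  · let ι := Module.finBasis ℝ E
    -- The bumps keep the ratio of their radii equal to 2, so the mollifications of the locally
    -- integrable line derivatives converge almost everywhere. Rademacher's theorem then identifies
    -- the limits along a basis with the differential of v.
    have hconv : ∀ i, ∀ᵐ x ∂μ, Tendsto (fun j => fderiv ℝ (w j) x (ι i)) atTop
        (𝓝 (lineDeriv ℝ v x (ι i))) := by
      intro i
      filter_upwards [ContDiffBump.ae_convolution_tendsto_right_of_locallyIntegrable (φ := b)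
        (K := 2) hb0 (Eventually.of_forall fun j => (by simp [b]; field_simp; norm_num))
        (hv.locallyIntegrable_lineDeriv (μ := μ) (ι i))] with x hx
      refine hx.congr fun j => ?_
      exact (fderiv_convolution_apply (b j).contDiff_normed (b j).hasCompactSupport_normed hv x
        (ι i)).symm
    filter_upwards [ae_all_iff.2 hconv, hv.ae_differentiableAt (μ := μ)] with x hx hdx
    have hlim : Tendsto (fun j => fderiv ℝ (w j) x) atTop (𝓝 (fderiv ℝ v x)) := by
      have hcoord : Tendsto (fun j => fun i => fderiv ℝ (w j) x (ι i)) atTop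
          (𝓝 fun i => fderiv ℝ v x (ι i)) :=
        tendsto_pi_nhds.2 fun i => by
          rw [← hdx.lineDeriv_eq_fderiv]
          exact hx i
      let T : (Fin (Module.finrank ℝ E) → ℝ) →ₗ[ℝ] (E →L[ℝ] ℝ) :=
        LinearMap.toContinuousLinearMap.toLinearMap ∘ₗ (ι.constr ℝ).toLinearMap
      have hT : ∀ l : E →L[ℝ] ℝ, T (fun i => l (ι i)) = l := fun l => by
        refine ContinuousLinearMap.coe_injective (ι.ext fun i => ?_)
        simp [T]
      have := (T.continuous_of_finiteDimensional.tendsto (fun i => fderiv ℝ v x (ι i))).comp hcoord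
      rw [hT] at this
      refine this.congr fun j => ?_
      exact hT _
    have hz : Tendsto (fun j => ‖fderiv ℝ (w j) x - fderiv ℝ v x‖) atTop (𝓝 0) :=
      tendsto_iff_norm_sub_tendsto_zero.1 hlim
    refine squeeze_zero (fun j => lipSlope_nonneg _ _) (fun j => ?_) hz
    exact (((hwsm j).differentiable (by simp) x).hasFDerivAt.sub hdx.hasFDerivAt).lipSlope_le

/-- A locally Lipschitz function with compact support is Lipschitz. -/
theorem LocallyLipschitz.exists_lipschitzWith {X : Type*} [MetricSpace X] {v : X → ℝ}
    (hv : LocallyLipschitz v) (hc : HasCompactSupport v) : ∃ C, LipschitzWith C v := by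
  obtain ⟨B, hB⟩ := hc.exists_bound_of_continuous hv.continuous
  have hB0 : 0 ≤ B ∨ IsEmpty X := by
    rcases isEmpty_or_nonempty X with h | ⟨⟨x⟩⟩
    · exact Or.inr h
    · exact Or.inl ((norm_nonneg _).trans (hB x))
  rcases hB0 with hB0 | hX
  swap
  · exact ⟨0, fun x => isEmptyElim x⟩
  -- Compactness gives one Lipschitz constant and one radius r valid from every point of the
  -- support. Beyond distance r the sup bound B gives the constant 2B/r.
  obtain ⟨C, r, hC0, hr, hC⟩ : ∃ C r : ℝ, 0 ≤ C ∧ 0 < r ∧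
      ∀ x ∈ tsupport v, ∀ y, dist x y < r → |v x - v y| ≤ C * dist x y := by
    refine hc.isCompact.induction_on (p := fun s => ∃ C r : ℝ, 0 ≤ C ∧ 0 < r ∧
      ∀ x ∈ s, ∀ y, dist x y < r → |v x - v y| ≤ C * dist x y)
      ⟨0, 1, le_rfl, one_pos, by simp⟩
      (fun s t hst ⟨C, r, hC0, hr, h⟩ => ⟨C, r, hC0, hr, fun x hx => h x (hst hx)⟩) ?_ ?_
    · rintro s t ⟨C, r, hC0, hr, h⟩ ⟨C', r', hC0', hr', h'⟩
      refine ⟨max C C', min r r', le_max_of_le_left hC0, lt_min hr hr', ?_⟩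
      rintro x (hx | hx) y hy
      · exact (h x hx y (hy.trans_le (min_le_left _ _))).trans (by gcongr; exact le_max_left _ _)
      · exact (h' x hx y (hy.trans_le (min_le_right _ _))).trans (by gcongr; exact le_max_right _ _)
    · intro x _
      obtain ⟨C, t, ht, h⟩ := hv x
      obtain ⟨r, hr, hball⟩ := Metric.mem_nhds_iff.1 ht
      refine ⟨Metric.ball x (r / 2), mem_nhdsWithin_of_mem_nhds (Metric.ball_mem_nhds _ (by positivity)),
        C, r / 2, C.2, by positivity, fun y hy z hz => ?_⟩
      rw [Metric.mem_ball] at hy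
      refine h.dist_le_mul y (hball ?_) z (hball ?_)
      · rw [Metric.mem_ball]; linarith
      · rw [Metric.mem_ball]; linarith [dist_triangle_left z x y]
  have key : ∀ x ∈ tsupport v, ∀ y, |v x - v y| ≤ max C (2 * B / r) * dist x y := by
    intro x hx y
    rcases lt_or_ge (dist x y) r with h | h
    · exact (hC x hx y h).trans (by gcongr; exact le_max_left _ _)
    · have h1 := hB x
      have h2 := hB y
      calc |v x - v y| ≤ B + B := (norm_sub_le _ _).trans (add_le_add h1 h2)
        _ = 2 * B / r * r := by field_simp; ring
        _ ≤ max C (2 * B / r) * dist x y := by gcongr; exact le_max_right _ _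
  have hm0 : 0 ≤ max C (2 * B / r) := le_max_of_le_left hC0
  refine ⟨⟨_, hm0⟩, LipschitzWith.of_dist_le_mul fun x y => ?_⟩
  change |v x - v y| ≤ max C (2 * B / r) * dist x y
  by_cases hx : x ∈ tsupport v
  · exact key x hx y
  by_cases hy : y ∈ tsupport v
  · rw [abs_sub_comm, dist_comm]
    exact key y hy x
  · rw [image_eq_zero_of_notMem_tsupport hx, image_eq_zero_of_notMem_tsupport hy]
    simpa using mul_nonneg hm0 dist_nonneg

end Mollification

/-! ### Smooth approximation of locally Lipschitz functions on a Riemannian manifold -/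

section General

variable {X : Type*} [MetricSpace X]

theorem lipSlope_comp_le_mul {Y : Type*} [MetricSpace Y] {h : Y → ℝ} {ψ : X → Y} {x : X} {A : ℝ}
    (hA : 0 ≤ A) (hψ : ∀ᶠ y in 𝓝 x, dist (ψ y) (ψ x) ≤ A * dist y x) (hh : PtLip h (ψ x)) :
    lipSlope (fun y => h (ψ y)) x ≤ A * lipSlope h (ψ x) := by
  have hcont : ContinuousAt ψ x := by
    refine tendsto_iff_dist_tendsto_zero.2 (squeeze_zero' (Eventually.of_forall fun _ => dist_nonneg)
      hψ ?_)
    have : Tendsto (fun y => A * dist y x) (𝓝 x) (𝓝 (A * dist x x)) :=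
      (continuous_const.mul (continuous_id.dist continuous_const)).tendsto x
    simpa using this
  have key : ∀ B, lipSlope h (ψ x) < B → lipSlope (fun y => h (ψ y)) x ≤ A * B := by
    intro B hB
    have hB0 : 0 ≤ B := (lipSlope_nonneg _ _).trans hB.le
    refine lipSlope_le (by positivity) ?_
    filter_upwards [hψ, hcont.eventually (hh.eventually_le hB)] with y h1 h2
    calc |h (ψ y) - h (ψ x)| ≤ B * dist (ψ y) (ψ x) := h2
      _ ≤ B * (A * dist y x) := by gcongr
      _ = A * B * dist y x := by ring
  refine ge_of_tendsto (f := fun B => A * B) (x := 𝓝[>] (lipSlope h (ψ x))) ?_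
    (eventually_nhdsWithin_of_forall key)
  exact ((continuous_const.mul continuous_id).tendsto _).mono_left nhdsWithin_le_nhds

theorem LocallyLipschitz.ptLip {f : X → ℝ} (hf : LocallyLipschitz f) (x : X) : PtLip f x := by
  obtain ⟨K, t, ht, h⟩ := hf x
  refine ⟨K, ?_⟩
  filter_upwards [ht] with y hy
  exact h.dist_le_mul y hy x (mem_of_mem_nhds ht)

theorem LocallyLipschitz.of_forall_exists {Y : Type*} [MetricSpace Y] {f : X → Y}
    (h : ∀ x, ∃ C : ℝ, ∃ s ∈ 𝓝 x, ∀ y ∈ s, ∀ z ∈ s, dist (f y) (f z) ≤ C * dist y z) :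
    LocallyLipschitz f := fun x => by
  obtain ⟨C, s, hs, hC⟩ := h x
  refine ⟨C.toNNReal, s, hs, LipschitzOnWith.of_dist_le_mul fun y hy z hz => (hC y hy z hz).trans ?_⟩
  gcongr
  exact Real.le_coe_toNNReal C

theorem LocallyLipschitz.real_add {f g : X → ℝ} (hf : LocallyLipschitz f)
    (hg : LocallyLipschitz g) : LocallyLipschitz fun x => f x + g x := fun x => by
  obtain ⟨K, t, ht, h⟩ := hf x
  obtain ⟨K', t', ht', h'⟩ := hg x
  exact ⟨K + K', t ∩ t', inter_mem ht ht', (h.mono inter_subset_left).add (h'.mono inter_subset_right)⟩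

theorem exists_lipschitzOnWith_mul {f g : X → ℝ} {x : X}
    (hf : ∃ K, ∃ t ∈ 𝓝 x, LipschitzOnWith K f t) (hg : ∃ K, ∃ t ∈ 𝓝 x, LipschitzOnWith K g t) :
    ∃ K, ∃ t ∈ 𝓝 x, LipschitzOnWith K (fun x => f x * g x) t := by
  obtain ⟨K, t, ht, h⟩ := hf
  obtain ⟨K', t', ht', h'⟩ := hg
  have hfb : ∀ᶠ y in 𝓝 x, |f y| < |f x| + 1 :=
    (h.continuousOn.continuousAt ht).abs.eventually (gt_mem_nhds (lt_add_one _))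
  have hgb : ∀ᶠ y in 𝓝 x, |g y| < |g x| + 1 :=
    (h'.continuousOn.continuousAt ht').abs.eventually (gt_mem_nhds (lt_add_one _))
  have hC : 0 ≤ (|f x| + 1) * K' + (|g x| + 1) * K := by positivity
  refine ⟨⟨_, hC⟩, _, inter_mem (inter_mem ht ht') (inter_mem hfb hgb),
    LipschitzOnWith.of_dist_le_mul fun y hy z hz => ?_⟩
  change _ ≤ ((|f x| + 1) * K' + (|g x| + 1) * K) * dist y z
  have h1 := h.dist_le_mul y hy.1.1 z hz.1.1
  have h2 := h'.dist_le_mul y hy.1.2 z hz.1.2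
  have h3 : |f y| ≤ |f x| + 1 := le_of_lt hy.2.1
  have h4 : |g z| ≤ |g x| + 1 := le_of_lt hz.2.2
  rw [Real.dist_eq] at h1 h2 ⊢
  calc |f y * g y - f z * g z| = |f y * (g y - g z) + g z * (f y - f z)| := by ring_nf
    _ ≤ |f y| * |g y - g z| + |g z| * |f y - f z| := by
      rw [← abs_mul, ← abs_mul]; exact abs_add_le _ _
    _ ≤ (|f x| + 1) * (K' * dist y z) + (|g x| + 1) * (K * dist y z) := by gcongr
    _ = _ := by ring

theorem LocallyLipschitz.real_mul {f g : X → ℝ} (hf : LocallyLipschitz f)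
    (hg : LocallyLipschitz g) : LocallyLipschitz fun x => f x * g x := fun x =>
  exists_lipschitzOnWith_mul (hf x) (hg x)

theorem LocallyLipschitz.real_neg {f : X → ℝ} (hf : LocallyLipschitz f) :
    LocallyLipschitz fun x => -f x := fun x => by
  obtain ⟨K, t, ht, h⟩ := hf x
  exact ⟨K, t, ht, h.neg⟩

theorem tendsto_eLpNorm_two_zero {α : Type*} [MeasurableSpace α] {μ : Measure α} {f : ℕ → α → ℝ}
    {b : α → ℝ} (hf : ∀ j, AEStronglyMeasurable (f j) μ) (hb : MemLp b 2 μ)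
    (hfb : ∀ j, ∀ᵐ x ∂μ, |f j x| ≤ b x)
    (hlim : ∀ᵐ x ∂μ, Tendsto (fun j => f j x) atTop (𝓝 0)) :
    Tendsto (fun j => eLpNorm (f j) 2 μ) atTop (𝓝 0) := by
  have e : ∀ g : α → ℝ, eLpNorm g 2 μ = (∫⁻ x, ‖g x‖ₑ ^ (2 : ℝ) ∂μ) ^ (1 / 2 : ℝ) := fun g => by
    rw [eLpNorm_eq_lintegral_rpow_enorm_toReal (by simp) (by simp)]
    simp
  have h1 : Tendsto (fun j => ∫⁻ x, ‖f j x‖ₑ ^ (2 : ℝ) ∂μ) atTop (𝓝 (∫⁻ _, 0 ∂μ)) := by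
    refine tendsto_lintegral_of_dominated_convergence' (fun x => ‖b x‖ₑ ^ (2 : ℝ))
      (fun j => (hf j).enorm.pow_const _) (fun j => ?_) ?_ ?_
    · filter_upwards [hfb j] with x hx
      refine ENNReal.rpow_le_rpow ?_ (by norm_num)
      rw [enorm_le_iff_norm_le]
      exact hx.trans (le_abs_self _)
    · have := hb.2
      rw [e] at this
      intro htop
      rw [htop] at this
      simp at this
    · filter_upwards [hlim] with x hx
      have h2 : Tendsto (fun j => ‖f j x‖ₑ) atTop (𝓝 0) := by
        simpa using hx.enorm
      have := (ENNReal.continuous_rpow_const (y := (2 : ℝ))).tendsto 0 |>.comp h2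
      simpa [Function.comp_def] using this
  have h2 := (ENNReal.continuous_rpow_const (y := (1 / 2 : ℝ))).tendsto 0
  simp only [lintegral_zero] at h1
  have h3 := h2.comp h1
  simp only [e]
  simpa [Function.comp_def] using h3

end General

/-! ### Mollification in charts and gluing by a partition of unity -/

section Manifold

variable {n : ℕ} {U : Type*} [MetricSpace U] [ChartedSpace (EuclideanSpace ℝ (Fin n)) U]
  [RiemannianBundle (fun x : U => TangentSpace (𝓡 n) x)] [IsManifold (𝓡 n) ∞ U]
  [IsContMDiffRiemannianBundle (𝓡 n) ∞ (EuclideanSpace ℝ (Fin n))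
    (fun x : U => TangentSpace (𝓡 n) x)] [IsRiemannianManifold (𝓡 n) U]

theorem ContMDiff.locallyLipschitz {φ : U → ℝ} (hφ : ContMDiff (𝓡 n) 𝓘(ℝ, ℝ) ∞ φ) :
    LocallyLipschitz φ := by
  refine .of_forall_exists fun x => ?_
  obtain ⟨C, -, s, hs, h⟩ := exists_nhds_norm_sub_le' ((hφ.of_le (by simp)) x)
  refine ⟨C, s, hs, fun y hy z hz => ?_⟩
  rw [dist_comm, dist_eq_norm]
  exact h y hy z hz

-- G is mollified in the chart. The errors and their slopes vanish off a fixed compact set K₂, are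
-- bounded there by constants, and tend to 0 almost everywhere; dominated convergence gives both L²
-- estimates. Absolute continuity of μ turns the exceptional Lebesgue-null set of the chart into a
-- μ-null set.
set_option maxHeartbeats 1000000 in
theorem exists_smooth_approx_of_tsupport_subset_chart [MeasurableSpace U] [BorelSpace U]
    {μ : Measure U} [IsLocallyFiniteMeasure μ] (hμ : μ ≪ riemannianVolume n U) {G : U → ℝ}
    (hG : LocallyLipschitz G) (hc : HasCompactSupport G) {x₀ : U}
    (hsupp : tsupport G ⊆ (chartAt (EuclideanSpace ℝ (Fin n)) x₀).source) {ε : ℝ≥0∞} (hε : 0 < ε) :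
    ∃ φ : U → ℝ, ContMDiff (𝓡 n) 𝓘(ℝ, ℝ) ∞ φ ∧ HasCompactSupport φ ∧
      eLpNorm (fun x => φ x - G x) 2 μ ≤ ε ∧ eLpNorm (lipSlope fun x => φ x - G x) 2 μ ≤ ε := by
  set e := chartAt (EuclideanSpace ℝ (Fin n)) x₀ with he
  have hes : ContMDiffOn (𝓡 n) (𝓡 n) ∞ e.symm e.target := contMDiffOn_chart_symm
  have hef : ContMDiffOn (𝓡 n) (𝓡 n) ∞ e e.source := contMDiffOn_chart
  set K := e '' tsupport G with hK
  have hKc : IsCompact K := hc.isCompact.image_of_continuousOn (e.continuousOn.mono hsupp)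
  have hKt : K ⊆ e.target := by
    rintro _ ⟨x, hx, rfl⟩
    exact e.map_source (hsupp hx)
  set v : EuclideanSpace ℝ (Fin n) → ℝ := e.target.indicator fun y => G (e.symm y) with hv
  have hvK : ∀ y, y ∉ K → v y = 0 := by
    intro y hy
    by_cases hyt : y ∈ e.target
    · rw [hv, indicator_of_mem hyt]
      refine image_eq_zero_of_notMem_tsupport fun hmem => hy ?_
      exact ⟨_, hmem, e.right_inv hyt⟩
    · exact indicator_of_notMem hyt _
  have hvsupp : tsupport v ⊆ K :=
    closure_minimal (fun y hy => by_contra fun h => hy (hvK y h)) hKc.isClosed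
  have hve : ∀ x ∈ e.source, v (e x) = G x := fun x hx => by
    rw [hv, indicator_of_mem (e.map_source hx), e.left_inv hx]
  have hvl : LocallyLipschitz v := by
    refine .of_forall_exists fun y => ?_
    by_cases hy : y ∈ K
    · obtain ⟨C, hC0, s, hs, hC⟩ := exists_nhds_dist_le (n := n) e.open_target
        (hes.of_le (by simp)) (hKt hy)
      obtain ⟨L, t, ht, hL⟩ := hG (e.symm y)
      refine ⟨L * C, _, inter_mem (inter_mem hs (e.open_target.mem_nhds (hKt hy)))
        ((e.continuousAt_symm (hKt hy)).preimage_mem_nhds ht), fun a ha b hb => ?_⟩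
      simp only [hv]
      rw [indicator_of_mem ha.1.2, indicator_of_mem hb.1.2]
      calc dist (G (e.symm a)) (G (e.symm b)) ≤ L * dist (e.symm a) (e.symm b) :=
            hL.dist_le_mul _ ha.2 _ hb.2
        _ ≤ L * (C * dist a b) := by gcongr; exact hC a ha.1.1 b hb.1.1
        _ = L * C * dist a b := by ring
    · refine ⟨0, Kᶜ, hKc.isClosed.isOpen_compl.mem_nhds hy, fun a ha b hb => ?_⟩
      rw [hvK a ha, hvK b hb]
      simp
  obtain ⟨L, hL⟩ := hvl.exists_lipschitzWith (hKc.of_isClosed_subset (isClosed_tsupport _) hvsupp)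
  obtain ⟨w, hwsm, hwL, hwsupp, hwd, hwlim⟩ := hL.exists_contDiff_approx (μ := volume)
  obtain ⟨δ, hδ, hδt⟩ := hKc.exists_cthickening_subset_open e.open_target hKt
  obtain ⟨J, hJ⟩ := exists_nat_one_div_lt hδ
  set K₂ := e.symm '' Metric.cthickening δ K with hK₂
  have hK₂c : IsCompact K₂ := hKc.cthickening.image_of_continuousOn (e.continuousOn_symm.mono hδt)
  have hK₂s : K₂ ⊆ e.source := by
    rintro _ ⟨y, hy, rfl⟩
    exact e.map_target (hδt hy)
  have hwK : ∀ j, J ≤ j → ∀ y, y ∉ Metric.cthickening δ K → w j y = 0 := by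
    intro j hj y hy
    refine image_eq_zero_of_notMem_tsupport fun hmem => hy ?_
    refine Metric.cthickening_mono ?_ _ (Metric.cthickening_subset_of_subset _ hvsupp (hwsupp j hmem))
    refine le_trans ?_ hJ.le
    exact one_div_le_one_div_of_le (by positivity) (by gcongr)
  -- The shift by J makes the mollification radius smaller than δ, so that all supports stay in the
  -- δ-thickening of K, inside the target of the chart.
  set φ : ℕ → U → ℝ := fun j => e.source.indicator fun x => w (j + J) (e x) with hφ
  have hφK : ∀ j, ∀ x, x ∉ K₂ → φ j x = 0 := by
    intro j x hx
    by_cases hxs : x ∈ e.source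
    · rw [hφ]
      simp only [indicator_of_mem hxs]
      exact hwK _ (Nat.le_add_left _ _) _ fun hmem => hx ⟨_, hmem, e.left_inv hxs⟩
    · exact indicator_of_notMem hxs _
  have hφsm : ∀ j, ContMDiff (𝓡 n) 𝓘(ℝ, ℝ) ∞ (φ j) := by
    intro j x
    by_cases hxs : x ∈ e.source
    · have h1 : ContMDiffAt (𝓡 n) 𝓘(ℝ, ℝ) ∞ (fun x => w (j + J) (e x)) x :=
        (hwsm (j + J)).contMDiff.contMDiffAt.comp x
          ((hef x hxs).contMDiffAt (e.open_source.mem_nhds hxs))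
      refine h1.congr_of_eventuallyEq ?_
      filter_upwards [e.open_source.mem_nhds hxs] with y hy
      simp only [hφ, indicator_of_mem hy]
    · have hx : x ∉ K₂ := fun h => hxs (hK₂s h)
      refine (contMDiffAt_const (c := (0 : ℝ))).congr_of_eventuallyEq ?_
      filter_upwards [hK₂c.isClosed.isOpen_compl.mem_nhds hx] with y hy
      exact hφK j y hy
  have hφc : ∀ j, HasCompactSupport (φ j) := fun j => HasCompactSupport.intro hK₂c (hφK j)
  have hsuppK : ∀ x, x ∉ K₂ → G x = 0 := by
    intro x hx
    refine image_eq_zero_of_notMem_tsupport fun hmem => hx ?_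
    exact ⟨e x, Metric.self_subset_cthickening _ ⟨x, hmem, rfl⟩, e.left_inv (hsupp hmem)⟩
  have hdiff : ∀ j x, x ∈ e.source → φ j x - G x = w (j + J) (e x) - v (e x) := by
    intro j x hx
    rw [hve x hx]
    simp only [hφ, indicator_of_mem hx]
  obtain ⟨A, hA0, hA⟩ : ∃ A : ℝ, 0 ≤ A ∧ ∀ x ∈ K₂, ∀ᶠ y in 𝓝 x, dist (e y) (e x) ≤ A * dist y x := by
    refine hK₂c.induction_on (p := fun s => ∃ A : ℝ, 0 ≤ A ∧ ∀ x ∈ s, ∀ᶠ y in 𝓝 x,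
      dist (e y) (e x) ≤ A * dist y x) ⟨0, le_rfl, by simp⟩
      (fun s t hst ⟨A, hA0, h⟩ => ⟨A, hA0, fun x hx => h x (hst hx)⟩) ?_ ?_
    · rintro s t ⟨A, hA0, h⟩ ⟨A', hA0', h'⟩
      refine ⟨max A A', le_max_of_le_left hA0, ?_⟩
      rintro x (hx | hx)
      · filter_upwards [h x hx] with y hy
        exact hy.trans (by gcongr; exact le_max_left _ _)
      · filter_upwards [h' x hx] with y hy
        exact hy.trans (by gcongr; exact le_max_right _ _)
    · intro x hx
      obtain ⟨C, hC0, s, hs, hC⟩ := exists_nhds_norm_sub_le' (n := n)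
        (((hef x (hK₂s hx)).contMDiffAt (e.open_source.mem_nhds (hK₂s hx))).of_le (by simp))
      refine ⟨interior s, mem_nhdsWithin_of_mem_nhds (interior_mem_nhds.2 hs), C, hC0, fun y hy => ?_⟩
      filter_upwards [mem_interior_iff_mem_nhds.1 hy] with z hz
      rw [dist_eq_norm, dist_comm]
      exact hC y (interior_subset hy) z hz
  have hslope0 : ∀ j, ∀ x, x ∉ K₂ → lipSlope (fun x => φ j x - G x) x = 0 := by
    intro j x hx
    refine lipSlope_eq_zero (c := 0) ?_
    filter_upwards [hK₂c.isClosed.isOpen_compl.mem_nhds hx] with y hy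
    rw [hφK j y hy, hsuppK y hy, sub_zero]
  have hwvL : ∀ j, LipschitzWith (L + L) fun y => w j y - v y := fun j => (hwL j).sub hL
  have hslope : ∀ j, ∀ x ∈ K₂, lipSlope (fun x => φ j x - G x) x ≤
      A * lipSlope (fun y => w (j + J) y - v y) (e x) := by
    intro j x hx
    have hcomp := lipSlope_comp_le_mul (h := fun y => w (j + J) y - v y) (ψ := e) hA0 (hA x hx)
      ((hwvL _).ptLip _)
    refine le_trans (le_of_eq (lipSlope_congr ?_)) hcomp
    filter_upwards [e.open_source.mem_nhds (hK₂s hx)] with y hy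
    exact hdiff j y hy
  have hcont : ∀ j, Continuous fun x => φ j x - G x := fun j =>
    (hφsm j).continuous.sub hG.continuous
  have hind : ∀ c : ℝ, MemLp (K₂.indicator fun _ => c) 2 μ := fun c =>
    memLp_indicator_const 2 hK₂c.measurableSet c (Or.inr hK₂c.measure_lt_top.ne)
  have hj0 : Tendsto (fun j : ℕ => 1 / (((j + J : ℕ) : ℝ) + 1)) atTop (𝓝 0) :=
    (tendsto_one_div_add_atTop_nhds_zero_nat (𝕜 := ℝ)).comp (tendsto_add_atTop_nat J)
  have hval : ∀ j x, |φ j x - G x| ≤ K₂.indicator (fun _ => L * (1 / (((j + J : ℕ) : ℝ) + 1))) x := by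
    intro j x
    by_cases hx : x ∈ K₂
    · rw [indicator_of_mem hx, hdiff j x (hK₂s hx)]
      exact hwd _ _
    · rw [indicator_of_notMem hx, hφK j x hx, hsuppK x hx]
      simp
  have t1 : Tendsto (fun j => eLpNorm (fun x => φ j x - G x) 2 μ) atTop (𝓝 0) := by
    refine tendsto_eLpNorm_two_zero (b := K₂.indicator fun _ => L * 1)
      (fun j => (hcont j).aestronglyMeasurable) (hind _)
      (fun j => Eventually.of_forall fun x => (hval j x).trans ?_) (Eventually.of_forall fun x => ?_)
    · refine indicator_le_indicator ?_
      gcongr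
      rw [div_le_one (by positivity)]
      linarith [(Nat.cast_nonneg (j + J) : (0 : ℝ) ≤ _)]
    · refine squeeze_zero_norm (hval · x) ?_
      by_cases hx : x ∈ K₂
      · simp only [indicator_of_mem hx]
        simpa using hj0.const_mul (L : ℝ)
      · simp only [indicator_of_notMem hx]
        exact tendsto_const_nhds
  have t2 : Tendsto (fun j => eLpNorm (lipSlope fun x => φ j x - G x) 2 μ) atTop (𝓝 0) := by
    refine tendsto_eLpNorm_two_zero (b := K₂.indicator fun _ => A * ((L + L : ℝ≥0) : ℝ))
      (fun j => (measurable_lipSlope (hcont j)).aestronglyMeasurable) (hind _)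
      (fun j => Eventually.of_forall fun x => ?_) ?_
    · rw [abs_of_nonneg (lipSlope_nonneg _ _)]
      by_cases hx : x ∈ K₂
      · rw [indicator_of_mem hx]
        exact (hslope j x hx).trans (by gcongr; exact (hwvL _).lipSlope_le _)
      · rw [indicator_of_notMem hx, hslope0 j x hx]
    · have hnull := hμ (riemannianVolume_source_inter_preimage_null (n := n) (e := e)
        (hes.of_le (by simp)) (ae_iff.1 hwlim))
      filter_upwards [compl_mem_ae_iff.2 hnull] with x hx
      by_cases hxK : x ∈ K₂
      · have hlim : Tendsto (fun j => lipSlope (fun y => w j y - v y) (e x)) atTop (𝓝 0) := by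
          by_contra hcon
          exact hx ⟨hK₂s hxK, hcon⟩
        refine squeeze_zero (fun j => lipSlope_nonneg _ _) (fun j => hslope j x hxK) ?_
        simpa using (hlim.comp (tendsto_add_atTop_nat J)).const_mul A
      · simp only [hslope0 _ x hxK]
        exact tendsto_const_nhds
  obtain ⟨j, h1, h2⟩ := ((t1.eventually (gt_mem_nhds hε)).and (t2.eventually (gt_mem_nhds hε))).exists
  exact ⟨φ j, hφsm j, hφc j, h1.le, h2.le⟩

/-- A locally Lipschitz function with compact support is approximated by smooth functions with
compact support, in the Sobolev norm. -/
theorem exists_smooth_approx [SecondCountableTopology U] [MeasurableSpace U] [BorelSpace U]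
    {μ : Measure U} [IsLocallyFiniteMeasure μ] (hμ : μ ≪ riemannianVolume n U) {G : U → ℝ}
    (hG : LocallyLipschitz G) (hc : HasCompactSupport G) {ε : ℝ≥0∞} (hε : 0 < ε) :
    ∃ φ : U → ℝ, ContMDiff (𝓡 n) 𝓘(ℝ, ℝ) ∞ φ ∧ HasCompactSupport φ ∧
      eLpNorm (fun x => φ x - G x) 2 μ ≤ ε ∧ eLpNorm (lipSlope fun x => φ x - G x) 2 μ ≤ ε := by
  classical
  have : LocallyCompactSpace U := Manifold.locallyCompact_of_finiteDimensional (𝓡 n)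
  obtain ⟨T, hT⟩ := hc.isCompact.elim_finite_subcover
    (fun x : U => (chartAt (EuclideanSpace ℝ (Fin n)) x).source)
    (fun x => (chartAt (EuclideanSpace ℝ (Fin n)) x).open_source)
    (fun x _ => mem_iUnion.2 ⟨x, mem_chart_source _ x⟩)
  obtain ⟨f, hf⟩ := SmoothPartitionOfUnity.exists_isSubordinate (𝓡 n) (isClosed_tsupport G)
    (fun i : T => (chartAt (EuclideanSpace ℝ (Fin n)) (i : U)).source)
    (fun i => (chartAt (EuclideanSpace ℝ (Fin n)) (i : U)).open_source)
    (fun x hx => by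
      obtain ⟨i, hi, hxi⟩ := mem_iUnion₂.1 (hT hx)
      exact mem_iUnion.2 ⟨⟨i, hi⟩, hxi⟩)
  have hGi : ∀ i, LocallyLipschitz fun x => f i x * G x := fun i =>
    (f i).contMDiff.locallyLipschitz.real_mul hG
  have hsum : ∀ s : Finset T, ∀ ε : ℝ≥0∞, 0 < ε → LocallyLipschitz (fun x => ∑ i ∈ s, f i x * G x) ∧
      ∃ φ : U → ℝ, ContMDiff (𝓡 n) 𝓘(ℝ, ℝ) ∞ φ ∧ HasCompactSupport φ ∧
      eLpNorm (fun x => φ x - ∑ i ∈ s, f i x * G x) 2 μ ≤ ε ∧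
      eLpNorm (lipSlope fun x => φ x - ∑ i ∈ s, f i x * G x) 2 μ ≤ ε := by
    intro s
    induction s using Finset.induction_on with
    | empty =>
      intro ε hε
      have h0 : lipSlope (fun _ : U => (0 : ℝ)) = 0 := by
        funext x
        exact lipSlope_eq_zero (c := 0) (Eventually.of_forall fun _ => rfl)
      refine ⟨by simpa using LocallyLipschitz.const (0 : ℝ), fun _ => 0, contMDiff_const,
        HasCompactSupport.zero, ?_, ?_⟩
      · simp
      · simp [h0]
    | insert i s his ih =>
      intro ε hε
      have hε2 : 0 < ε / 2 := ENNReal.half_pos hε.ne'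
      obtain ⟨hl, φ, hφ, hφc, h1, h2⟩ := ih (ε / 2) hε2
      have hci : HasCompactSupport fun x => f i x * G x := hc.mul_left
      obtain ⟨ψ, hψ, hψc, h3, h4⟩ := exists_smooth_approx_of_tsupport_subset_chart hμ (hGi i) hci
        (x₀ := (i : U)) ((closure_mono (Function.support_mul_subset_left _ _)).trans (hf i)) hε2
      have hl' : LocallyLipschitz fun x => ∑ i ∈ insert i s, f i x * G x := by
        simp only [Finset.sum_insert his]
        exact (hGi i).real_add hl
      have hA : LocallyLipschitz fun x => ψ x - f i x * G x := by
        simpa [sub_eq_add_neg] using hψ.locallyLipschitz.real_add (hGi i).real_neg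
      have hB : LocallyLipschitz fun x => φ x - ∑ i ∈ s, f i x * G x := by
        simpa only [sub_eq_add_neg] using hφ.locallyLipschitz.real_add hl.real_neg
      have e : (fun x => (ψ x + φ x) - ∑ i ∈ insert i s, f i x * G x) =
          fun x => (ψ x - f i x * G x) + (φ x - ∑ i ∈ s, f i x * G x) := by
        funext x
        rw [Finset.sum_insert his]
        ring
      refine ⟨hl', fun x => ψ x + φ x, hψ.add hφ, hψc.add hφc, ?_, ?_⟩
      · rw [e]
        refine (eLpNorm_add_le hA.continuous.aestronglyMeasurable
          hB.continuous.aestronglyMeasurable (by norm_num)).trans ?_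
        exact (add_le_add h3 h1).trans (ENNReal.add_halves ε).le
      · rw [e]
        refine le_trans (eLpNorm_mono_real (g := fun x => lipSlope (fun x => ψ x - f i x * G x) x +
          lipSlope (fun x => φ x - ∑ i ∈ s, f i x * G x) x) fun x => ?_)
          ((eLpNorm_add_le (measurable_lipSlope hA.continuous).aestronglyMeasurable
          (measurable_lipSlope hB.continuous).aestronglyMeasurable (by norm_num)).trans
          ((add_le_add h4 h2).trans (ENNReal.add_halves ε).le))
        rw [Real.norm_of_nonneg (lipSlope_nonneg _ _)]
        exact lipSlope_add_le (hA.ptLip x) (hB.ptLip x)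
  obtain ⟨-, φ, hφ, hφc, h1, h2⟩ := hsum Finset.univ ε hε
  have e : (fun x => ∑ i, f i x * G x) = G := by
    funext x
    by_cases hx : x ∈ tsupport G
    · have := f.sum_eq_one hx
      rw [finsum_eq_sum_of_fintype] at this
      rw [← Finset.sum_mul, this, one_mul]
    · rw [image_eq_zero_of_notMem_tsupport hx]
      simp
  have e' : ∀ x, ∑ i, f i x * G x = G x := congrFun e
  simp only [e'] at h1 h2
  exact ⟨φ, hφ, hφc, h1, h2⟩

end Manifold

/-! ### Gram determinants -/

section Gram

open Matrix

theorem Matrix.PosSemidef.one_le_det_one_add {ι : Type*} [Fintype ι] [DecidableEq ι]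
    {D : Matrix ι ι ℝ} (hD : D.PosSemidef) : 1 ≤ (1 + D).det := by
  have hH : (1 + D).IsHermitian := Matrix.isHermitian_one.add hD.isHermitian
  rw [hH.det_eq_prod_eigenvalues]
  refine Finset.one_le_prod fun i => ?_
  have h1 := hD.re_dotProduct_nonneg (hH.eigenvectorBasis i)
  have h2 : star (hH.eigenvectorBasis i).ofLp ⬝ᵥ (hH.eigenvectorBasis i).ofLp = (1 : ℝ) := by
    have := hH.eigenvectorBasis.orthonormal.1 i
    have h3 := real_inner_self_eq_norm_sq (hH.eigenvectorBasis i)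
    rw [this, EuclideanSpace.inner_eq_star_dotProduct, dotProduct_comm] at h3
    simpa using h3
  simp only [RCLike.ofReal_real_eq_id, id_eq]
  rw [hH.eigenvalues_eq, Matrix.add_mulVec, Matrix.one_mulVec, dotProduct_add, map_add, h2]
  simpa using h1

/-- If det A = 0 the claim is that det B ≥ 0. Otherwise A = CᴴC with C invertible and B = Cᴴ(1 + D)C
with D positive semidefinite, and all eigenvalues of 1 + D are at least 1. -/
theorem Matrix.PosSemidef.det_le_det {ι : Type*} [Fintype ι] [DecidableEq ι]
    {A B : Matrix ι ι ℝ} (hA : A.PosSemidef) (hAB : (B - A).PosSemidef) : A.det ≤ B.det := by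
  have hB : B.PosSemidef := by simpa using hA.add hAB
  rcases hA.det_nonneg.eq_or_lt with h | h
  · rw [← h]
    exact hB.det_nonneg
  obtain ⟨C, rfl⟩ : ∃ C : Matrix ι ι ℝ, A = Cᴴ * C := by
    open scoped MatrixOrder in
    exact CStarAlgebra.nonneg_iff_eq_star_mul_self.mp hA.nonneg
  have hC : IsUnit C.det := by
    rw [isUnit_iff_ne_zero]
    intro h0
    rw [Matrix.det_mul, h0, mul_zero] at h
    exact lt_irrefl _ h
  have hD := hAB.conjTranspose_mul_mul_same C⁻¹
  have e : B = Cᴴ * (1 + C⁻¹ᴴ * (B - Cᴴ * C) * C⁻¹) * C := by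
    have e1 : Cᴴ * C⁻¹ᴴ = 1 := by
      rw [← Matrix.conjTranspose_mul, Matrix.nonsing_inv_mul _ hC, Matrix.conjTranspose_one]
    calc B = Cᴴ * C + (Cᴴ * C⁻¹ᴴ) * (B - Cᴴ * C) * (C⁻¹ * C) := by
          rw [e1, Matrix.nonsing_inv_mul _ hC]; simp
      _ = _ := by simp only [Matrix.mul_add, Matrix.add_mul, Matrix.mul_assoc, Matrix.mul_one]
  rw [e, Matrix.det_mul, Matrix.det_mul, Matrix.det_mul]
  have h1 := hD.one_le_det_one_add
  have h2 : 0 ≤ Cᴴ.det * C.det := by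
    rw [← Matrix.det_mul]; exact h.le
  nlinarith

variable {n : ℕ} {V W : Type*} [NormedAddCommGroup V] [InnerProductSpace ℝ V]
  [NormedAddCommGroup W] [InnerProductSpace ℝ W]

theorem linGram_isHermitian (p : EuclideanSpace ℝ (Fin n) →L[ℝ] V) : (linGram p).IsHermitian := by
  ext i j
  simp [linGram, real_inner_comm]

theorem linGram_dotProduct (p : EuclideanSpace ℝ (Fin n) →L[ℝ] V) (x : Fin n → ℝ) :
    star x ⬝ᵥ (linGram p *ᵥ x) = ‖p (WithLp.toLp 2 x)‖ ^ 2 := by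
  have hx : WithLp.toLp 2 x = ∑ i, x i • EuclideanSpace.single i (1 : ℝ) := by
    have := (EuclideanSpace.basisFun (Fin n) ℝ).sum_repr (WithLp.toLp 2 x)
    simpa using this.symm
  rw [hx, ← real_inner_self_eq_norm_sq]
  simp only [map_sum, map_smul, sum_inner, inner_sum, inner_smul_left, inner_smul_right,
    dotProduct, mulVec, linGram, Matrix.of_apply, RCLike.conj_to_real, star_trivial,
    Finset.mul_sum, Pi.star_apply]
  refine Finset.sum_congr rfl fun i _ => Finset.sum_congr rfl fun j _ => ?_
  rw [real_inner_comm]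
  ring

theorem linGram_posSemidef (p : EuclideanSpace ℝ (Fin n) →L[ℝ] V) : (linGram p).PosSemidef :=
  .of_dotProduct_mulVec_nonneg (linGram_isHermitian p) fun x => by
    rw [linGram_dotProduct]; positivity

theorem det_linGram_le {p : EuclideanSpace ℝ (Fin n) →L[ℝ] V} {q : EuclideanSpace ℝ (Fin n) →L[ℝ] W}
    (h : ∀ x, ‖p x‖ ^ 2 ≤ ‖q x‖ ^ 2) : (linGram p).det ≤ (linGram q).det := by
  refine (linGram_posSemidef p).det_le_det (.of_dotProduct_mulVec_nonneg
    ((linGram_isHermitian q).sub (linGram_isHermitian p)) fun x => ?_)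
  rw [Matrix.sub_mulVec, dotProduct_sub, linGram_dotProduct, linGram_dotProduct]
  exact sub_nonneg.2 (h _)

theorem det_linGram_smul (c : ℝ) (p : EuclideanSpace ℝ (Fin n) →L[ℝ] V) :
    (linGram (c • p)).det = (c ^ 2) ^ n * (linGram p).det := by
  have : linGram (c • p) = c ^ 2 • linGram p := by
    ext i j
    simp [linGram, inner_smul_left, inner_smul_right]
    ring
  rw [this, Matrix.det_smul, Fintype.card_fin]

/-- The form of p is dominated by that of √c (q, √h · id), whose Gram matrix is block diagonal up to
the factor c; the determinant is monotone in the quadratic form. -/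
theorem det_linGram_le_prod {k d : ℕ} {p : EuclideanSpace ℝ (Fin (k + d)) →L[ℝ] V}
    {q : EuclideanSpace ℝ (Fin k) →L[ℝ] W} {c h : ℝ} (hc : 0 ≤ c) (hh : 0 ≤ h)
    (hpq : ∀ x, ‖p x‖ ^ 2 ≤ c * (‖q (EuclideanSpace.finAddEquivProd x).1‖ ^ 2 +
      h * ‖(EuclideanSpace.finAddEquivProd x).2‖ ^ 2)) :
    (linGram p).det ≤ c ^ (k + d) * ((linGram q).det * h ^ d) := by
  let T : EuclideanSpace ℝ (Fin (k + d)) →L[ℝ] WithLp 2 (W × EuclideanSpace ℝ (Fin d)) :=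
    (WithLp.prodContinuousLinearEquiv 2 ℝ W (EuclideanSpace ℝ (Fin d))).symm.toContinuousLinearMap.comp
      ((q.prodMap (√h • ContinuousLinearMap.id ℝ (EuclideanSpace ℝ (Fin d)))).comp
        EuclideanSpace.finAddEquivProd.toContinuousLinearMap)
  have hT : ∀ x, T x = WithLp.toLp 2 (q (EuclideanSpace.finAddEquivProd x).1,
      √h • (EuclideanSpace.finAddEquivProd x).2) := fun x => rfl
  have hdet : (linGram T).det = (linGram q).det * h ^ d := by
    have e1 : ∀ i : Fin k, EuclideanSpace.finAddEquivProd (EuclideanSpace.single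
        (finSumFinEquiv (Sum.inl i) : Fin (k + d)) (1 : ℝ)) = (EuclideanSpace.single i 1, 0) := by
      intro i
      ext j <;> simp
    have e2 : ∀ i : Fin d, EuclideanSpace.finAddEquivProd (EuclideanSpace.single
        (finSumFinEquiv (Sum.inr i) : Fin (k + d)) (1 : ℝ)) = (0, EuclideanSpace.single i 1) := by
      intro i
      ext j <;> simp
    have : (linGram T).submatrix finSumFinEquiv finSumFinEquiv =
        Matrix.fromBlocks (linGram q) 0 0 (h • (1 : Matrix (Fin d) (Fin d) ℝ)) := by
      ext i j
      rcases i with i | i <;> rcases j with j | j <;>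
        simp only [linGram, Matrix.submatrix_apply, Matrix.of_apply, hT, e1, e2,
          Matrix.fromBlocks_apply₁₁, Matrix.fromBlocks_apply₁₂, Matrix.fromBlocks_apply₂₁,
          Matrix.fromBlocks_apply₂₂, WithLp.prod_inner_apply]
      · simp
      · simp
      · simp
      · simp [inner_smul_left, inner_smul_right, EuclideanSpace.inner_single_left, Matrix.one_apply]
        split_ifs <;> simp [Real.mul_self_sqrt hh]
    rw [← Matrix.det_submatrix_equiv_self finSumFinEquiv, this, Matrix.det_fromBlocks_zero₂₁,
      Matrix.det_smul]
    simp
  have := det_linGram_le (p := p) (q := √c • T) fun x => by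
    refine (hpq x).trans (le_of_eq ?_)
    rw [_root_.smul_apply, norm_smul, mul_pow, Real.norm_of_nonneg (Real.sqrt_nonneg _), Real.sq_sqrt hc,
      hT, WithLp.prod_norm_sq_eq_of_L2]
    change _ = c * (‖q (EuclideanSpace.finAddEquivProd x).1‖ ^ 2 +
      ‖√h • (EuclideanSpace.finAddEquivProd x).2‖ ^ 2)
    rw [norm_smul, mul_pow, Real.norm_of_nonneg (Real.sqrt_nonneg _), Real.sq_sqrt hh]
  rwa [det_linGram_smul, Real.sq_sqrt hc, hdet] at this

end Gram

/-! ### The volume of a product end -/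

section ProductVolume

variable {k d : ℕ} {U : Type*} [MetricSpace U] [ChartedSpace (EuclideanSpace ℝ (Fin (k + d))) U]
  [RiemannianBundle (fun x : U => TangentSpace (𝓡 (k + d)) x)]
  {M : Type*} [MetricSpace M] [ChartedSpace (EuclideanSpace ℝ (Fin k)) M]
  [RiemannianBundle (fun x : M => TangentSpace (𝓡 k) x)]

/-- The coordinates of the total space given by coordinates of the parallel factor. -/
def endCoord (chart : PartialDiffeomorph ((𝓡 k).prod 𝓘(ℝ, EuclideanSpace ℝ (Fin d)))
      (𝓡 (k + d)) (M × EuclideanSpace ℝ (Fin d)) U ∞)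
    (e : OpenPartialHomeomorph M (EuclideanSpace ℝ (Fin k))) :
    OpenPartialHomeomorph U (EuclideanSpace ℝ (Fin (k + d))) :=
  chart.toOpenPartialHomeomorph.symm.trans ((e.prod (OpenPartialHomeomorph.refl _)).trans
    (EuclideanSpace.finAddEquivProd (𝕜 := ℝ)).symm.toHomeomorph.toOpenPartialHomeomorph)

variable {chart : PartialDiffeomorph ((𝓡 k).prod 𝓘(ℝ, EuclideanSpace ℝ (Fin d)))
    (𝓡 (k + d)) (M × EuclideanSpace ℝ (Fin d)) U ∞}
  {e : OpenPartialHomeomorph M (EuclideanSpace ℝ (Fin k))}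

theorem endCoord_symm_apply (z : EuclideanSpace ℝ (Fin (k + d))) :
    (endCoord chart e).symm z = chart (e.symm (EuclideanSpace.finAddEquivProd z).1,
      (EuclideanSpace.finAddEquivProd z).2) := rfl

theorem mem_endCoord_target {z : EuclideanSpace ℝ (Fin (k + d))} :
    z ∈ (endCoord chart e).target ↔ (EuclideanSpace.finAddEquivProd z).1 ∈ e.target ∧
      (e.symm (EuclideanSpace.finAddEquivProd z).1,
      (EuclideanSpace.finAddEquivProd z).2) ∈ chart.source := by
  simp [endCoord]

theorem mem_endCoord_source {q : M × EuclideanSpace ℝ (Fin d)} (hq : q ∈ chart.source)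
    (he : q.1 ∈ e.source) : chart q ∈ (endCoord chart e).source := by
  have h1 : chart q ∈ chart.target := chart.map_source hq
  have h2 : chart.toOpenPartialHomeomorph.symm (chart q) = q := chart.left_inv hq
  simp only [endCoord, OpenPartialHomeomorph.trans_source, mem_inter_iff, mem_preimage, h2]
  refine ⟨h1, ⟨he, mem_univ _⟩, mem_univ _⟩

variable [IsManifold (𝓡 (k + d)) ∞ U] [IsManifold (𝓡 k) ∞ M]

theorem contMDiffOn_endCoord_symm (he : ContMDiffOn (𝓡 k) (𝓡 k) 1 e.symm e.target) :
    ContMDiffOn (𝓡 (k + d)) (𝓡 (k + d)) 1 (endCoord chart e).symm (endCoord chart e).target := by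
  have hF : ContMDiff (𝓡 (k + d)) 𝓘(ℝ, EuclideanSpace ℝ (Fin k) × EuclideanSpace ℝ (Fin d)) 1
      (EuclideanSpace.finAddEquivProd (𝕜 := ℝ) (n := k) (m := d)) :=
    (EuclideanSpace.finAddEquivProd (𝕜 := ℝ) (n := k) (m := d)).toContinuousLinearMap.contDiff.contMDiff
  have hF1 : ContMDiff (𝓡 (k + d)) (𝓡 k) 1
      fun z => (EuclideanSpace.finAddEquivProd (𝕜 := ℝ) (n := k) (m := d) z).1 :=
    contDiff_fst.contMDiff.comp hF
  have hF2 : ContMDiff (𝓡 (k + d)) 𝓘(ℝ, EuclideanSpace ℝ (Fin d)) 1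
      fun z => (EuclideanSpace.finAddEquivProd (𝕜 := ℝ) (n := k) (m := d) z).2 :=
    contDiff_snd.contMDiff.comp hF
  have h1 : ContMDiffOn (𝓡 (k + d)) (𝓡 k) 1
      (fun z => e.symm (EuclideanSpace.finAddEquivProd (𝕜 := ℝ) (n := k) (m := d) z).1)
      (endCoord chart e).target :=
    he.comp hF1.contMDiffOn fun z hz => (mem_endCoord_target.1 hz).1
  exact (chart.contMDiffOn.of_le (by simp)).comp (h1.prodMk hF2.contMDiffOn)
    fun z hz => (mem_endCoord_target.1 hz).2

theorem pushd_endCoord_symm (he : ContMDiffOn (𝓡 k) (𝓡 k) 1 e.symm e.target)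
    {z : EuclideanSpace ℝ (Fin (k + d))} (hz : z ∈ (endCoord chart e).target)
    (v : EuclideanSpace ℝ (Fin (k + d))) :
    pushd (k + d) (endCoord chart e).symm z v =
      mfderiv ((𝓡 k).prod 𝓘(ℝ, EuclideanSpace ℝ (Fin d))) (𝓡 (k + d)) chart
        (e.symm (EuclideanSpace.finAddEquivProd z).1, (EuclideanSpace.finAddEquivProd z).2)
        (pushd k e.symm (EuclideanSpace.finAddEquivProd z).1 (EuclideanSpace.finAddEquivProd v).1,
          (EuclideanSpace.finAddEquivProd v).2) := by
  obtain ⟨hz1, hz2⟩ := mem_endCoord_target.1 hz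
  have hF : HasMFDerivAt (𝓡 (k + d)) 𝓘(ℝ, EuclideanSpace ℝ (Fin k))
      (fun z => (EuclideanSpace.finAddEquivProd (𝕜 := ℝ) (n := k) (m := d) z).1) z
      ((ContinuousLinearMap.fst ℝ _ _).comp
        (EuclideanSpace.finAddEquivProd (𝕜 := ℝ) (n := k) (m := d)).toContinuousLinearMap) :=
    ((ContinuousLinearMap.fst ℝ _ _).comp
      (EuclideanSpace.finAddEquivProd (𝕜 := ℝ) (n := k) (m := d)).toContinuousLinearMap).hasFDerivAt.hasMFDerivAt
  have hF2 : HasMFDerivAt (𝓡 (k + d)) 𝓘(ℝ, EuclideanSpace ℝ (Fin d))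
      (fun z => (EuclideanSpace.finAddEquivProd (𝕜 := ℝ) (n := k) (m := d) z).2) z
      ((ContinuousLinearMap.snd ℝ _ _).comp
        (EuclideanSpace.finAddEquivProd (𝕜 := ℝ) (n := k) (m := d)).toContinuousLinearMap) :=
    ((ContinuousLinearMap.snd ℝ _ _).comp
      (EuclideanSpace.finAddEquivProd (𝕜 := ℝ) (n := k) (m := d)).toContinuousLinearMap).hasFDerivAt.hasMFDerivAt
  have hes : MDifferentiableAt (𝓡 k) (𝓡 k) e.symm (EuclideanSpace.finAddEquivProd z).1 :=
    (he.contMDiffAt (e.open_target.mem_nhds hz1)).mdifferentiableAt one_ne_zero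
  have hch := (chart.mdifferentiableAt (by simp) hz2).hasMFDerivAt
  have hcomp := hch.comp z ((hes.hasMFDerivAt.comp z hF).prodMk hF2)
  exact DFunLike.congr_fun hcomp.mfderiv v

variable [MeasurableSpace U] [BorelSpace U] [MeasurableSpace M] [BorelSpace M]
  [SecondCountableTopology M]

theorem measurableSet_image_prod {A : Set M} (hA : MeasurableSet A)
    {B : Set (EuclideanSpace ℝ (Fin d))} (hB : MeasurableSet B) (hAB : A ×ˢ B ⊆ chart.source) :
    MeasurableSet (chart '' (A ×ˢ B)) := by
  have : chart '' (A ×ˢ B) = chart.target ∩ chart.symm ⁻¹' (A ×ˢ B) := by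
    ext x
    constructor
    · rintro ⟨q, hq, rfl⟩
      refine ⟨chart.map_source (hAB hq), ?_⟩
      change chart.toPartialEquiv.symm (chart q) ∈ A ×ˢ B
      rwa [chart.left_inv (hAB hq)]
    · rintro ⟨hx, hq⟩
      exact ⟨_, hq, chart.right_inv hx⟩
  rw [this]
  exact chart.contMDiffOn_invFun.continuousOn.measurableSet_inter_preimage
    chart.open_target.measurableSet (hA.prod hB)

/-- An upper bound on the metric bounds the volume element by √(c^(k+d)) times a product of
functions of x and of y, and the integral factors. The other ingredient of C is the ratio κ between
the image of Lebesgue measure under the splitting of ℝ^{k+d} and the product measure; uniqueness of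
Haar measure provides it and its value is irrelevant. C is fixed before the manifolds and the
charts. -/
theorem exists_riemannianVolume_image_prod_le_coordVolume (k d : ℕ) {c : ℝ} (hc : 0 ≤ c) :
    ∃ C : ℝ≥0∞, C ≠ ⊤ ∧
    ∀ {U : Type u} [MetricSpace U] [ChartedSpace (EuclideanSpace ℝ (Fin (k + d))) U]
    [RiemannianBundle (fun x : U => TangentSpace (𝓡 (k + d)) x)]
    {M : Type v} [MetricSpace M] [ChartedSpace (EuclideanSpace ℝ (Fin k)) M]
    [RiemannianBundle (fun x : M => TangentSpace (𝓡 k) x)]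
    [IsManifold (𝓡 (k + d)) ∞ U] [IsManifold (𝓡 k) ∞ M]
    [MeasurableSpace U] [BorelSpace U] [MeasurableSpace M] [BorelSpace M]
    [SecondCountableTopology M]
    (chart : PartialDiffeomorph ((𝓡 k).prod 𝓘(ℝ, EuclideanSpace ℝ (Fin d)))
      (𝓡 (k + d)) (M × EuclideanSpace ℝ (Fin d)) U ∞)
    (B : Set (EuclideanSpace ℝ (Fin d))) (h : EuclideanSpace ℝ (Fin d) → ℝ),
    MeasurableSet B → Measurable h → (∀ y ∈ B, 0 ≤ h y) → univ ×ˢ B ⊆ chart.source →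
    (∀ x : M, ∀ y ∈ B, ∀ (v : TangentSpace (𝓡 k) x) (w : EuclideanSpace ℝ (Fin d)),
      ‖mfderiv ((𝓡 k).prod 𝓘(ℝ, EuclideanSpace ℝ (Fin d))) (𝓡 (k + d)) chart (x, y) (v, w)‖ ^ 2
        ≤ c * (‖v‖ ^ 2 + h y * ‖w‖ ^ 2)) →
    ∀ (e : OpenPartialHomeomorph M (EuclideanSpace ℝ (Fin k))),
    ContMDiffOn (𝓡 k) (𝓡 k) 1 e.symm e.target →
    AEMeasurable (volElement e.symm) (volume.restrict e.target) →
    ∀ A : Set M, MeasurableSet A → A ⊆ e.source →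
    riemannianVolume (k + d) U (chart '' (A ×ˢ B)) ≤
      C * coordVolume e A * ∫⁻ y in B, ENNReal.ofReal (√(h y ^ d)) := by
  let F := EuclideanSpace.finAddEquivProd (𝕜 := ℝ) (n := k) (m := d)
  have hFm : Measure.IsAddHaarMeasure
      ((volume : Measure (EuclideanSpace ℝ (Fin (k + d)))).map F) :=
    F.isAddHaarMeasure_map _
  obtain ⟨κ, hκ⟩ : ∃ κ : ℝ≥0, (volume : Measure (EuclideanSpace ℝ (Fin (k + d)))).map F =
      κ • (volume : Measure (EuclideanSpace ℝ (Fin k))).prod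
        (volume : Measure (EuclideanSpace ℝ (Fin d))) :=
    ⟨_, Measure.isAddLeftInvariant_eq_smul _ _⟩
  refine ⟨ENNReal.ofReal (√(c ^ (k + d))) * κ, by finiteness, ?_⟩
  intro U _ _ _ M _ _ _ _ _ _ _ _ _ _ chart B h hB hh hh0 hBs hbound e he hem A hA hAe
  have hAB : A ×ˢ B ⊆ chart.source := (prod_mono_left (subset_univ _)).trans hBs
  set D := e.target ∩ e.symm ⁻¹' A with hD
  have hDm : MeasurableSet D := 
    e.continuousOn_symm.measurableSet_inter_preimage e.open_target.measurableSet hA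
  refine (riemannianVolume_le_coordVolume (contMDiffOn_endCoord_symm (chart := chart) he)
    (measurableSet_image_prod hA hB hAB) ?_).trans ?_
  · rintro _ ⟨q, hq, rfl⟩
    exact mem_endCoord_source (hAB hq) (hAe hq.1)
  have hset : (endCoord chart e).target ∩ (endCoord chart e).symm ⁻¹' (chart '' (A ×ˢ B)) =
      F ⁻¹' (D ×ˢ B) := by
    ext z
    constructor
    · rintro ⟨hz, q, hq, hqz⟩
      obtain ⟨hz1, hz2⟩ := mem_endCoord_target.1 hz
      rw [endCoord_symm_apply] at hqz
      have := chart.injOn (hAB hq) hz2 hqz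
      rw [this] at hq
      exact ⟨⟨hz1, hq.1⟩, hq.2⟩
    · rintro ⟨⟨hz1, hz2⟩, hz3⟩
      exact ⟨mem_endCoord_target.2 ⟨hz1, hAB ⟨hz2, hz3⟩⟩,
        (e.symm (F z).1, (F z).2), ⟨hz2, hz3⟩, rfl⟩
  rw [coordVolume_apply _ (measurableSet_image_prod hA hB hAB), hset]
  have hle : ∀ z ∈ F ⁻¹' (D ×ˢ B), volElement (endCoord chart e).symm z ≤
      ENNReal.ofReal (√(c ^ (k + d))) * (volElement e.symm (F z).1 *
        ENNReal.ofReal (√(h (F z).2 ^ d))) := by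
    intro z hz
    have hzt : z ∈ (endCoord chart e).target := by
      rw [← hset] at hz
      exact hz.1
    have := det_linGram_le_prod (p := pushd (k + d) (endCoord chart e).symm z)
      (q := pushd k e.symm (F z).1) hc (hh0 _ hz.2) fun v => by
        rw [pushd_endCoord_symm he hzt]
        exact hbound _ _ hz.2 _ _
    rw [volElement, volElement, ← ENNReal.ofReal_mul (Real.sqrt_nonneg _),
      ← ENNReal.ofReal_mul (Real.sqrt_nonneg _), ← Real.sqrt_mul (linGram_posSemidef _).det_nonneg,
      ← Real.sqrt_mul (by positivity)]
    exact ENNReal.ofReal_le_ofReal (Real.sqrt_le_sqrt this)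
  have hFme : MeasurableEmbedding F := F.toHomeomorph.measurableEmbedding
  calc ∫⁻ z in F ⁻¹' (D ×ˢ B), volElement (endCoord chart e).symm z
      ≤ ∫⁻ z in F ⁻¹' (D ×ˢ B), ENNReal.ofReal (√(c ^ (k + d))) * (volElement e.symm (F z).1 *
        ENNReal.ofReal (√(h (F z).2 ^ d))) :=
        setLIntegral_mono' (hFme.measurable (hDm.prod hB)) hle
    _ = ENNReal.ofReal (√(c ^ (k + d))) * ∫⁻ z in F ⁻¹' (D ×ˢ B), volElement e.symm (F z).1 *
        ENNReal.ofReal (√(h (F z).2 ^ d)) := lintegral_const_mul' _ _ ENNReal.ofReal_ne_top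
    _ = ENNReal.ofReal (√(c ^ (k + d))) * (κ * ∫⁻ q in D ×ˢ B, volElement e.symm q.1 *
        ENNReal.ofReal (√(h q.2 ^ d)) ∂(volume.prod volume)) := by
      congr 1
      have := hFme.lintegral_map (μ := volume.restrict (F ⁻¹' (D ×ˢ B)))
        (fun q => volElement e.symm q.1 * ENNReal.ofReal (√(h q.2 ^ d)))
      rw [← this, ← hFme.restrict_map, hκ, Measure.restrict_smul, lintegral_smul_measure]
      rfl
    _ = ENNReal.ofReal (√(c ^ (k + d))) * (κ * ((∫⁻ y in D, volElement e.symm y) *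
        ∫⁻ y in B, ENNReal.ofReal (√(h y ^ d)))) := by
      rw [← Measure.prod_restrict, lintegral_prod_mul (f := volElement e.symm)
        (g := fun y => ENNReal.ofReal (√(h y ^ d))) (hem.mono_set inter_subset_left)
        (by fun_prop : Measurable fun y => ENNReal.ofReal (√(h y ^ d))).aemeasurable]
    _ = _ := by
      rw [coordVolume_apply e hA]
      ring

/-- Because the constant does not depend on the chart, the estimates over a countable atlas of M,
made disjoint, can be summed. -/
theorem exists_riemannianVolume_image_prod_le (k d : ℕ) {c : ℝ} (hc : 0 ≤ c) :
    ∃ C : ℝ≥0∞, C ≠ ⊤ ∧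
    ∀ {U : Type u} [MetricSpace U] [ChartedSpace (EuclideanSpace ℝ (Fin (k + d))) U]
    [RiemannianBundle (fun x : U => TangentSpace (𝓡 (k + d)) x)]
    {M : Type v} [MetricSpace M] [ChartedSpace (EuclideanSpace ℝ (Fin k)) M]
    [RiemannianBundle (fun x : M => TangentSpace (𝓡 k) x)]
    [IsManifold (𝓡 (k + d)) ∞ U] [IsManifold (𝓡 k) ∞ M]
    [IsContMDiffRiemannianBundle (𝓡 k) ∞ (EuclideanSpace ℝ (Fin k))
      (fun x : M => TangentSpace (𝓡 k) x)]
    [MeasurableSpace U] [BorelSpace U] [MeasurableSpace M] [BorelSpace M]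
    [SecondCountableTopology M]
    (chart : PartialDiffeomorph ((𝓡 k).prod 𝓘(ℝ, EuclideanSpace ℝ (Fin d)))
      (𝓡 (k + d)) (M × EuclideanSpace ℝ (Fin d)) U ∞)
    (B : Set (EuclideanSpace ℝ (Fin d))) (h : EuclideanSpace ℝ (Fin d) → ℝ),
    MeasurableSet B → Measurable h → (∀ y ∈ B, 0 ≤ h y) → univ ×ˢ B ⊆ chart.source →
    (∀ x : M, ∀ y ∈ B, ∀ (v : TangentSpace (𝓡 k) x) (w : EuclideanSpace ℝ (Fin d)),
      ‖mfderiv ((𝓡 k).prod 𝓘(ℝ, EuclideanSpace ℝ (Fin d))) (𝓡 (k + d)) chart (x, y) (v, w)‖ ^ 2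
        ≤ c * (‖v‖ ^ 2 + h y * ‖w‖ ^ 2)) →
    riemannianVolume (k + d) U (chart '' (univ ×ˢ B)) ≤
      C * riemannianVolume k M univ * ∫⁻ y in B, ENNReal.ofReal (√(h y ^ d)) := by
  obtain ⟨C, hC, H⟩ := exists_riemannianVolume_image_prod_le_coordVolume.{u, v} k d hc
  refine ⟨C, hC, ?_⟩
  intro U _ _ _ M _ _ _ _ _ _ _ _ _ _ _ chart B h hB hh hh0 hBs hbound
  rcases isEmpty_or_nonempty M with hM | hM
  · rw [univ_eq_empty_iff.2 hM]
    simp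
  obtain ⟨s, hsc, hs⟩ := TopologicalSpace.countable_cover_nhds (fun x : M =>
    (chartAt (EuclideanSpace ℝ (Fin k)) x).open_source.mem_nhds (mem_chart_source _ x))
  have hsne : s.Nonempty := by
    obtain ⟨x⟩ := hM
    have : x ∈ ⋃ x ∈ s, (chartAt (EuclideanSpace ℝ (Fin k)) x).source := hs ▸ mem_univ x
    obtain ⟨y, hy, -⟩ := mem_iUnion₂.1 this
    exact ⟨y, hy⟩
  obtain ⟨x, rfl⟩ := hsc.exists_eq_range hsne
  set A : ℕ → Set M := disjointed fun i => (chartAt (EuclideanSpace ℝ (Fin k)) (x i)).source with hA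
  have hAm : ∀ i, MeasurableSet (A i) := fun i =>
    MeasurableSet.disjointed (fun i => (chartAt _ (x i)).open_source.measurableSet) i
  have hAu : ⋃ i, A i = univ := by
    rw [hA, iUnion_disjointed, ← hs, biUnion_range]
  have hAi : ∀ i, riemannianVolume (k + d) U (chart '' (A i ×ˢ B)) ≤
      C * riemannianVolume k M (A i) * ∫⁻ y in B, ENNReal.ofReal (√(h y ^ d)) := by
    intro i
    have hes : ContMDiffOn (𝓡 k) (𝓡 k) 1 (chartAt (EuclideanSpace ℝ (Fin k)) (x i)).symm
      (chartAt (EuclideanSpace ℝ (Fin k)) (x i)).target := contMDiffOn_chart_symm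
    refine (H chart B h hB hh hh0 hBs hbound (chartAt _ (x i)) hes
      ((continuousOn_volElement (chartAt _ (x i)).open_target hes).aemeasurable
        (chartAt _ (x i)).open_target.measurableSet) (A i) (hAm i)
      (disjointed_subset _ i)).trans ?_
    gcongr
    rw [← chartVolume_eq]
    exact le_iSup (fun x : M => chartVolume (n := k) x) (x i)
  calc riemannianVolume (k + d) U (chart '' (univ ×ˢ B))
      = riemannianVolume (k + d) U (⋃ i, chart '' (A i ×ˢ B)) := by
        rw [← image_iUnion, ← iUnion_prod_const, hAu]
    _ ≤ ∑' i, riemannianVolume (k + d) U (chart '' (A i ×ˢ B)) := measure_iUnion_le _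
    _ ≤ ∑' i, C * riemannianVolume k M (A i) * ∫⁻ y in B, ENNReal.ofReal (√(h y ^ d)) :=
        ENNReal.tsum_le_tsum hAi
    _ = C * riemannianVolume k M univ * ∫⁻ y in B, ENNReal.ofReal (√(h y ^ d)) := by
        rw [ENNReal.tsum_mul_right, ENNReal.tsum_mul_left, ← measure_iUnion (disjoint_disjointed _) hAm,
          hAu]

end ProductVolume

/-! ### The logarithmic profile -/

section Profile

/-- The cutoff profile: `0` for `r ≤ δ²`, `1` for `r ≥ δ`, logarithmic in between. -/
def logProfile (δ r : ℝ) : ℝ := max 0 (min 1 (2 - Real.log r / Real.log δ))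

theorem logProfile_nonneg (δ r : ℝ) : 0 ≤ logProfile δ r := le_max_left _ _

theorem logProfile_le_one (δ r : ℝ) : logProfile δ r ≤ 1 := max_le zero_le_one (min_le_left _ _)

theorem logProfile_eq_one {δ r : ℝ} (hδ : 0 < δ) (hδ1 : δ < 1) (hr : δ ≤ r) : logProfile δ r = 1 := by
  have h1 : Real.log δ < 0 := Real.log_neg hδ hδ1
  have h2 : Real.log r / Real.log δ ≤ 1 := by
    rw [div_le_one_of_neg h1]
    exact Real.log_le_log hδ hr
  rw [logProfile, min_eq_left (by linarith), max_eq_right zero_le_one]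

theorem logProfile_eq_zero {δ r : ℝ} (hδ : 0 < δ) (hδ1 : δ < 1) (hr0 : 0 < r) (hr : r ≤ δ ^ 2) :
    logProfile δ r = 0 := by
  have h1 : Real.log δ < 0 := Real.log_neg hδ hδ1
  have h2 : 2 ≤ Real.log r / Real.log δ := by
    rw [le_div_iff_of_neg h1]
    have := Real.log_le_log hr0 hr
    rwa [Real.log_pow, Nat.cast_ofNat] at this
  rw [logProfile, max_eq_left]
  exact (min_le_right _ _).trans (by linarith)

theorem lipschitzWith_clamp : LipschitzWith 1 fun t : ℝ => max 0 (min 1 t) :=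
  (LipschitzWith.id.const_min 1).const_max 0

theorem exists_lipschitzOnWith_logProfile (δ : ℝ) {r : ℝ} (hr : 0 < r) :
    ∃ K, ∃ t ∈ 𝓝 r, LipschitzOnWith K (logProfile δ) t := by
  have h : ContDiffAt ℝ 1 (fun s => 2 - Real.log s / Real.log δ) r :=
    contDiffAt_const.sub ((Real.contDiffAt_log.2 hr.ne').div_const _)
  obtain ⟨K, t, ht, hK⟩ := h.exists_lipschitzOnWith
  exact ⟨1 * K, t, ht, lipschitzWith_clamp.comp_lipschitzOnWith hK⟩

theorem lipSlope_logProfile_le {δ r : ℝ} (hδ : 0 < δ) (hδ1 : δ < 1) (hr : 0 < r) :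
    lipSlope (logProfile δ) r ≤ 1 / (r * -Real.log δ) := by
  have hL : Real.log δ < 0 := Real.log_neg hδ hδ1
  have h : HasDerivAt (fun s => 2 - Real.log s / Real.log δ) (-(r⁻¹ / Real.log δ)) r :=
    ((Real.hasDerivAt_log hr.ne').div_const _).const_sub 2
  have hp : PtLip (fun s => 2 - Real.log s / Real.log δ) r := by
    obtain ⟨K, t, ht, hK⟩ := (contDiffAt_const.sub
      ((Real.contDiffAt_log.2 hr.ne').div_const (Real.log δ)) :
      ContDiffAt ℝ 1 (fun s => 2 - Real.log s / Real.log δ) r).exists_lipschitzOnWith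
    refine ⟨K, ?_⟩
    filter_upwards [ht] with y hy
    exact hK.dist_le_mul y hy r (mem_of_mem_nhds ht)
  refine (lipSlope_comp_le hp lipschitzWith_clamp).trans (h.hasFDerivAt.lipSlope_le.trans ?_)
  rw [ContinuousLinearMap.norm_toSpanSingleton, norm_neg, norm_div, norm_inv,
    Real.norm_of_nonneg hr.le, Real.norm_of_nonpos hL.le, one_div, mul_inv, div_eq_mul_inv]

end Profile

/-! ### The transverse coordinate of an end and the slope of the cutoff -/

section End

variable {p k : ℕ} {U : Type u} [MetricSpace U]
  [ChartedSpace (EuclideanSpace ℝ (Fin (k + (9 - p)))) U]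
  [RiemannianBundle (fun x : U => TangentSpace (𝓡 (k + (9 - p))) x)] {f : U → ℝ}

namespace DpBraneEnd

/-- The transverse coordinate on an end. -/
def transv (B : DpBraneEnd.{u, v} p k f) (x : U) : Transverse p := (B.chart.symm x).2

variable (B : DpBraneEnd.{u, v} p k f)

theorem mem_source {q : B.M × Transverse p} : q ∈ B.chart.source ↔ 0 < ‖q.2‖ ∧ ‖q.2‖ < B.ε := by
  rw [B.source_eq]
  rfl

theorem transv_chart {q : B.M × Transverse p} (hq : q ∈ B.chart.source) :
    B.transv (B.chart q) = q.2 :=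
  congrArg Prod.snd (B.chart.left_inv hq)

theorem symm_mem_source {x : U} (hx : x ∈ B.chart.target) : B.chart.symm x ∈ B.chart.source :=
  B.chart.map_target hx

theorem chart_symm {x : U} (hx : x ∈ B.chart.target) : B.chart (B.chart.symm x) = x :=
  B.chart.right_inv hx

theorem norm_transv_pos {x : U} (hx : x ∈ B.chart.target) : 0 < ‖B.transv x‖ :=
  (B.mem_source.1 (B.symm_mem_source hx)).1

theorem norm_transv_lt {x : U} (hx : x ∈ B.chart.target) : ‖B.transv x‖ < B.ε :=
  (B.mem_source.1 (B.symm_mem_source hx)).2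

variable [IsManifold (𝓡 (k + (9 - p))) ∞ U]

theorem contMDiffAt_transv {x : U} (hx : x ∈ B.chart.target) :
    ContMDiffAt (𝓡 (k + (9 - p))) 𝓘(ℝ, Transverse p) 1 B.transv x :=
  contMDiffAt_snd.comp x ((B.chart.contMDiffOn_invFun.contMDiffAt
    (B.chart.open_target.mem_nhds hx)).of_le (by simp))

/-- The chain rule for the chart composed with its inverse. The parallel component v may stay
unspecified, since the metric estimate only uses ‖v‖² ≥ 0. -/
theorem exists_mfderiv_chart_eq {q : B.M × Transverse p} (hq : q ∈ B.chart.source)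
    (ξ : TangentSpace (𝓡 (k + (9 - p))) (B.chart q)) :
    ∃ v : TangentSpace (𝓡 k) q.1,
      mfderiv ((𝓡 k).prod 𝓘(ℝ, Transverse p)) (𝓡 (k + (9 - p))) B.chart q
        (v, covd (k + (9 - p)) B.transv (B.chart q) ξ) = ξ := by
  have key : ∀ q' q : B.M × Transverse p, q' = q →
      ∀ w : EuclideanSpace ℝ (Fin k) × Transverse p,
      (show EuclideanSpace ℝ (Fin (k + (9 - p))) from
        mfderiv ((𝓡 k).prod 𝓘(ℝ, Transverse p)) (𝓡 (k + (9 - p))) B.chart q' w) =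
      (show EuclideanSpace ℝ (Fin (k + (9 - p))) from
        mfderiv ((𝓡 k).prod 𝓘(ℝ, Transverse p)) (𝓡 (k + (9 - p))) B.chart q w) := by
    rintro q' _ rfl w
    rfl
  have hx : B.chart q ∈ B.chart.target := B.chart.map_source hq
  have hgx : B.chart.symm (B.chart q) = q := B.chart.left_inv hq
  have hg : HasMFDerivAt (𝓡 (k + (9 - p))) ((𝓡 k).prod 𝓘(ℝ, Transverse p)) B.chart.symm
      (B.chart q) (mfderiv (𝓡 (k + (9 - p))) ((𝓡 k).prod 𝓘(ℝ, Transverse p)) B.chart.symm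
        (B.chart q)) := (B.chart.symm.mdifferentiableAt (by simp) hx).hasMFDerivAt
  have hc := (B.chart.mdifferentiableAt (by simp)
    (show B.chart.symm (B.chart q) ∈ B.chart.source from B.symm_mem_source hx)).hasMFDerivAt
  have hcomp := hc.comp (B.chart q) hg
  have hid : HasMFDerivAt (𝓡 (k + (9 - p))) (𝓡 (k + (9 - p))) (B.chart ∘ B.chart.symm) (B.chart q)
      (ContinuousLinearMap.id ℝ (TangentSpace (𝓡 (k + (9 - p))) (B.chart q))) := by
    refine (hasMFDerivAt_id (I := 𝓡 (k + (9 - p))) (B.chart q)).congr_of_eventuallyEq ?_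
    filter_upwards [B.chart.open_target.mem_nhds hx] with y hy
    exact B.chart.right_inv hy
  have h1 := DFunLike.congr_fun (hasMFDerivAt_unique hcomp hid) ξ
  have hsnd : HasMFDerivAt (𝓡 (k + (9 - p))) 𝓘(ℝ, Transverse p) B.transv (B.chart q)
      ((ContinuousLinearMap.snd ℝ _ _).comp (mfderiv (𝓡 (k + (9 - p)))
        ((𝓡 k).prod 𝓘(ℝ, Transverse p)) B.chart.symm (B.chart q))) :=
    (hasMFDerivAt_snd (B.chart.symm (B.chart q))).comp (B.chart q) hg
  have h2 : covd (k + (9 - p)) B.transv (B.chart q) ξ =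
      (mfderiv (𝓡 (k + (9 - p))) ((𝓡 k).prod 𝓘(ℝ, Transverse p)) B.chart.symm (B.chart q) ξ).2 :=
    DFunLike.congr_fun hsnd.mfderiv ξ
  refine ⟨(mfderiv (𝓡 (k + (9 - p))) ((𝓡 k).prod 𝓘(ℝ, Transverse p)) B.chart.symm
    (B.chart q) ξ).1, ?_⟩
  rw [h2]
  exact (key _ _ hgx _).symm.trans h1

/-- With η = 1/2 the metric is at least half the model metric, so H times the squared transverse
component of ξ is at most 2 ‖ξ‖². -/
theorem covd_transv_le {δ : ℝ}
    (hδ : ∀ (x : B.M) (y : Transverse p), 0 < ‖y‖ → ‖y‖ < δ →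
      ∀ (v : TangentSpace (𝓡 k) x) (w : Transverse p),
        |‖mfderiv ((𝓡 k).prod 𝓘(ℝ, Transverse p)) (𝓡 (k + (9 - p))) B.chart (x, y) (v, w)‖ ^ 2
          - (‖v‖ ^ 2 + braneH p B.gs B.r₀ ‖y‖ * ‖w‖ ^ 2)|
        ≤ 1 / 2 * (‖v‖ ^ 2 + braneH p B.gs B.r₀ ‖y‖ * ‖w‖ ^ 2)) {x : U} (hx : x ∈ B.chart.target)
    (hxδ : ‖B.transv x‖ < δ) (hH : 0 < braneH p B.gs B.r₀ ‖B.transv x‖)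
    (ξ : TangentSpace (𝓡 (k + (9 - p))) x) :
    ‖covd (k + (9 - p)) B.transv x ξ‖ ≤ √(2 / braneH p B.gs B.r₀ ‖B.transv x‖) * ‖ξ‖ := by
  obtain ⟨q, hq, rfl⟩ : ∃ q, q ∈ B.chart.source ∧ B.chart q = x :=
    ⟨_, B.symm_mem_source hx, B.chart_symm hx⟩
  rw [B.transv_chart hq] at hxδ hH ⊢
  obtain ⟨v, hv⟩ := B.exists_mfderiv_chart_eq hq ξ
  have h := hδ q.1 q.2 (B.mem_source.1 hq).1 hxδ v (covd (k + (9 - p)) B.transv (B.chart q) ξ)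
  have e : ‖mfderiv ((𝓡 k).prod 𝓘(ℝ, Transverse p)) (𝓡 (k + (9 - p))) B.chart (q.1, q.2)
      (v, covd (k + (9 - p)) B.transv (B.chart q) ξ)‖ = ‖ξ‖ := congrArg _ hv
  rw [e, abs_le] at h
  have h2 : braneH p B.gs B.r₀ ‖q.2‖ * ‖covd (k + (9 - p)) B.transv (B.chart q) ξ‖ ^ 2 ≤
      2 * ‖ξ‖ ^ 2 := by nlinarith [sq_nonneg ‖v‖]
  refine abs_le_of_sq_le_sq' ?_ (by positivity) |>.2
  rw [mul_pow, Real.sq_sqrt (by positivity), div_mul_eq_mul_div, le_div_iff₀ hH]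
  linarith

variable [IsContMDiffRiemannianBundle (𝓡 (k + (9 - p))) ∞ (EuclideanSpace ℝ (Fin (k + (9 - p))))
    (fun x : U => TangentSpace (𝓡 (k + (9 - p))) x)] [IsRiemannianManifold (𝓡 (k + (9 - p))) U]

theorem exists_lipschitzOnWith_logProfile_transv (δ : ℝ) {x : U} (hx : x ∈ B.chart.target) :
    ∃ K, ∃ t ∈ 𝓝 x, LipschitzOnWith K (fun x => logProfile δ ‖B.transv x‖) t := by
  obtain ⟨C, hC0, s, hs, hC⟩ := exists_nhds_norm_sub_le' (B.contMDiffAt_transv hx)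
  obtain ⟨K, t, ht, hK⟩ := exists_lipschitzOnWith_logProfile δ (B.norm_transv_pos hx)
  have hcont : ContinuousAt (fun x => ‖B.transv x‖) x := (B.contMDiffAt_transv hx).continuousAt.norm
  refine ⟨K * ⟨C, hC0⟩, s ∩ (fun x => ‖B.transv x‖) ⁻¹' t, inter_mem hs (hcont.preimage_mem_nhds ht),
    hK.comp (LipschitzOnWith.of_dist_le_mul fun y hy z hz => ?_) (fun y hy => hy.2)⟩
  have := hC y hy.1 z hz.1
  rw [Real.dist_eq]
  refine (abs_norm_sub_norm_le _ _).trans ?_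
  rw [norm_sub_rev]
  exact this

theorem lipSlope_logProfile_transv_le {δ r : ℝ} (hδ : 0 < δ) (hδ1 : δ < 1)
    (hr : ∀ (x : B.M) (y : Transverse p), 0 < ‖y‖ → ‖y‖ < r →
      ∀ (v : TangentSpace (𝓡 k) x) (w : Transverse p),
        |‖mfderiv ((𝓡 k).prod 𝓘(ℝ, Transverse p)) (𝓡 (k + (9 - p))) B.chart (x, y) (v, w)‖ ^ 2
          - (‖v‖ ^ 2 + braneH p B.gs B.r₀ ‖y‖ * ‖w‖ ^ 2)|
        ≤ 1 / 2 * (‖v‖ ^ 2 + braneH p B.gs B.r₀ ‖y‖ * ‖w‖ ^ 2)) {x : U} (hx : x ∈ B.chart.target)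
    (hxr : ‖B.transv x‖ < r) (hH : 0 < braneH p B.gs B.r₀ ‖B.transv x‖) :
    lipSlope (fun x => logProfile δ ‖B.transv x‖) x ≤
      2 * √(2 / braneH p B.gs B.r₀ ‖B.transv x‖) * (1 / (‖B.transv x‖ * -Real.log δ)) := by
  have hpos : 0 < √(2 / braneH p B.gs B.r₀ ‖B.transv x‖) := Real.sqrt_pos.2 (by positivity)
  -- A Lipschitz bound near x needs a constant strictly above the bound on the differential at x;
  -- this is the only reason for the factor 2.
  obtain ⟨s, hs, h⟩ := exists_nhds_norm_sub_le (B.contMDiffAt_transv hx) hpos.le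
    (B.covd_transv_le hr hx hxr hH)
    (by linarith : _ < 2 * √(2 / braneH p B.gs B.r₀ ‖B.transv x‖))
  obtain ⟨K, t, ht, hK⟩ := exists_lipschitzOnWith_logProfile δ (B.norm_transv_pos hx)
  have hp : PtLip (logProfile δ) ‖B.transv x‖ := by
    refine ⟨K, ?_⟩
    filter_upwards [ht] with y hy
    exact hK.dist_le_mul y hy _ (mem_of_mem_nhds ht)
  refine (lipSlope_comp_le_mul (h := logProfile δ) (ψ := fun x => ‖B.transv x‖)
    (A := 2 * √(2 / braneH p B.gs B.r₀ ‖B.transv x‖)) (by positivity) ?_ hp).trans ?_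
  · filter_upwards [hs] with y hy
    rw [Real.dist_eq, dist_comm]
    exact (abs_norm_sub_norm_le _ _).trans (h x (mem_of_mem_nhds hs) y hy)
  · gcongr
    exact lipSlope_logProfile_le hδ hδ1 (B.norm_transv_pos hx)

end DpBraneEnd

theorem braneH_pos {p : ℕ} {gs r₀ r : ℝ} (hgs : 0 < gs) (hr : 0 < r) (hr₀ : r < r₀) :
    0 < braneH p gs r₀ r := by
  have h0 : 0 < r₀ := hr.trans hr₀
  rw [braneH]
  split_ifs with h
  · have h1 : Real.log (r / r₀) < 0 := Real.log_neg (by positivity) ((div_lt_one h0).2 hr₀)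
    have h2 : 0 < 2 * Real.pi / gs := by positivity
    nlinarith
  · positivity

/-- H r² = r₀² (r₀/r)^{5-p}, and r₀/r ≥ 1. Consequently log r has bounded slope near the tip, which
therefore lies at infinite distance. -/
theorem sq_le_braneH_mul_sq {p : ℕ} (hp : p ≤ 5) {gs r₀ r : ℝ} (hr : 0 < r) (hr₀ : r < r₀) :
    r₀ ^ 2 ≤ braneH p gs r₀ r * r ^ 2 := by
  have h0 : 0 < r₀ := hr.trans hr₀
  have h1 : 1 ≤ r₀ / r := (one_le_div hr).2 hr₀.le
  rw [braneH, if_neg (by omega)]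
  have h2 : (r / r₀) ^ ((p : ℤ) - 7) = (r₀ / r) ^ (7 - p) := by
    rw [← inv_div, inv_zpow', ← zpow_natCast]
    congr 1
    omega
  have h3 : (r₀ / r) ^ 2 ≤ (r₀ / r) ^ (7 - p) := pow_le_pow_right₀ h1 (by omega)
  rw [h2]
  calc r₀ ^ 2 = (r₀ / r) ^ 2 * r ^ 2 := by field_simp
    _ ≤ _ := by gcongr

theorem measurable_braneH (p : ℕ) (gs r₀ : ℝ) : Measurable (braneH p gs r₀) := by
  unfold braneH
  split_ifs
  · exact (Real.measurable_log.comp (measurable_id.div_const _)).const_mul _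
  · exact (measurable_id.div_const _).pow_const _

end End

/-! ### The energy of the logarithmic cutoff -/

/-- In polar coordinates the integrand is r^{d-3}, at most 1/r because d ≥ 2 and r < 1, and the
integral of dr/r from δ² to δ is -log δ. -/
theorem exists_lintegral_annulus_le {d : ℕ} (hd : 2 ≤ d) :
    ∃ K : ℝ≥0∞, K ≠ ⊤ ∧ ∀ δ : ℝ, 0 < δ → δ < 1 →
      ∫⁻ y in {y : EuclideanSpace ℝ (Fin d) | δ ^ 2 ≤ ‖y‖ ∧ ‖y‖ ≤ δ}, ENNReal.ofReal (1 / ‖y‖ ^ 2) ≤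
        K * ENNReal.ofReal (-Real.log δ) := by
  have hfr : Module.finrank ℝ (EuclideanSpace ℝ (Fin d)) = d := by simp
  have : Nontrivial (EuclideanSpace ℝ (Fin d)) :=
    Module.nontrivial_of_finrank_pos (R := ℝ) (by rw [hfr]; omega)
  set κ : ℝ := (volume : Measure (EuclideanSpace ℝ (Fin d))).real (Metric.ball 0 1)
  refine ⟨ENNReal.ofReal (d * κ), ENNReal.ofReal_ne_top, fun δ hδ hδ1 => ?_⟩
  have hδ2 : δ ^ 2 ≤ δ := by nlinarith
  set g : ℝ → ℝ := (Icc (δ ^ 2) δ).indicator fun r => 1 / r ^ 2 with hg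
  have hset : MeasurableSet {y : EuclideanSpace ℝ (Fin d) | δ ^ 2 ≤ ‖y‖ ∧ ‖y‖ ≤ δ} :=
    measurable_norm measurableSet_Icc
  have hgm : Measurable g := (measurable_const.div (measurable_id.pow_const 2)).indicator measurableSet_Icc
  have hg0 : ∀ r, 0 ≤ g r := fun r => indicator_nonneg (fun r _ => by positivity) _
  have hgi : ∀ y : EuclideanSpace ℝ (Fin d), ENNReal.ofReal (g ‖y‖) =
      ({y : EuclideanSpace ℝ (Fin d) | δ ^ 2 ≤ ‖y‖ ∧ ‖y‖ ≤ δ}).indicator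
        (fun y => ENNReal.ofReal (1 / ‖y‖ ^ 2)) y := by
    intro y
    by_cases hy : ‖y‖ ∈ Icc (δ ^ 2) δ
    · rw [hg, indicator_of_mem hy, indicator_of_mem (by exact hy)]
    · rw [hg, indicator_of_notMem hy, indicator_of_notMem (by exact hy), ENNReal.ofReal_zero]
  rw [← lintegral_indicator hset]
  simp only [← hgi]
  have hint : Integrable (fun y : EuclideanSpace ℝ (Fin d) => g ‖y‖) := by
    have hb : Integrable ((Metric.closedBall (0 : EuclideanSpace ℝ (Fin d)) δ).indicator
        fun _ => 1 / (δ ^ 2) ^ 2) :=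
      (integrable_indicator_iff measurableSet_closedBall).2
        (integrableOn_const (measure_closedBall_lt_top.ne))
    refine hb.mono' (hgm.comp measurable_norm).aestronglyMeasurable (Eventually.of_forall fun y => ?_)
    rw [Real.norm_of_nonneg (hg0 _)]
    by_cases hy : ‖y‖ ∈ Icc (δ ^ 2) δ
    · rw [hg, indicator_of_mem hy, indicator_of_mem (by simpa using hy.2)]
      have := hy.1
      gcongr
    · rw [hg, indicator_of_notMem hy]
      exact indicator_nonneg (fun _ _ => by positivity) _
  rw [← ofReal_integral_eq_lintegral_ofReal hint (Eventually.of_forall fun y => hg0 _),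
    integral_fun_norm_addHaar, hfr, ← ENNReal.ofReal_mul (by positivity)]
  refine ENNReal.ofReal_le_ofReal ?_
  rw [nsmul_eq_mul, smul_eq_mul, mul_assoc]
  refine mul_le_mul_of_nonneg_left (mul_le_mul_of_nonneg_left ?_ (by positivity)) (by positivity)
  have hinv : IntegrableOn (fun r : ℝ => r⁻¹) (Icc (δ ^ 2) δ) :=
    (continuousOn_inv₀.mono fun r hr => ne_of_gt ((by positivity : 0 < δ ^ 2).trans_le hr.1)).integrableOn_Icc
  calc ∫ r in Ioi (0 : ℝ), r ^ (d - 1) • g r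
      ≤ ∫ r in Ioi (0 : ℝ), (Icc (δ ^ 2) δ).indicator (fun r => r⁻¹) r := by
        refine integral_mono_of_nonneg ?_ ?_ ?_
        · filter_upwards [ae_restrict_mem measurableSet_Ioi] with r hr
          exact mul_nonneg (pow_nonneg (le_of_lt hr) _) (hg0 r)
        · exact ((integrable_indicator_iff measurableSet_Icc).2 hinv).integrableOn
        · refine Eventually.of_forall fun r => ?_
          by_cases hr : r ∈ Icc (δ ^ 2) δ
          · have hr0 : 0 < r := (by positivity : 0 < δ ^ 2).trans_le hr.1
            have h1 : r ^ (d - 1) ≤ r := by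
              calc r ^ (d - 1) ≤ r ^ 1 :=
                    pow_le_pow_of_le_one hr0.le (hr.2.trans hδ1.le) (by omega)
                _ = r := pow_one r
            simp only [hg, indicator_of_mem hr, smul_eq_mul]
            calc r ^ (d - 1) * (1 / r ^ 2) ≤ r * (1 / r ^ 2) := by gcongr
              _ = r⁻¹ := by field_simp
          · simp only [hg, indicator_of_notMem hr, smul_zero, le_refl]
    _ = ∫ r in Icc (δ ^ 2) δ, r⁻¹ := by
        rw [setIntegral_indicator measurableSet_Icc, inter_eq_right.2]
        exact fun r hr => (by positivity : 0 < δ ^ 2).trans_le hr.1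
    _ = -Real.log δ := by
        rw [integral_Icc_eq_integral_Ioc, ← intervalIntegral.integral_of_le hδ2,
          integral_inv_of_pos (by positivity) hδ, Real.log_div hδ.ne' (by positivity), Real.log_pow]
        push_cast
        ring

/-! ### The weighted integral over the annulus of an end -/

section End

variable {p k : ℕ} {U : Type u} [MetricSpace U]
  [ChartedSpace (EuclideanSpace ℝ (Fin (k + (9 - p)))) U]
  [RiemannianBundle (fun x : U => TangentSpace (𝓡 (k + (9 - p))) x)] {f : U → ℝ}
  [IsManifold (𝓡 (k + (9 - p))) ∞ U] [MeasurableSpace U] [BorelSpace U]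

/-- The exponents balance: the volume element H^{(9-p)/2} times the weight H^{(p-7)/2} is H, which
cancels the 1/H in the squared slope. What remains is the integral of |y|^{-2} over an annulus of
ℝ^{9-p}, of dimension at least 2 since p ≤ 7. -/
theorem DpBraneEnd.exists_lintegral_le (hp : p ≤ 7) (B : DpBraneEnd.{u, v} p k f)
    (hvol : riemannianVolume k B.M univ < ⊤) :
    ∃ δ₀ > 0, ∃ K : ℝ≥0∞, K ≠ ⊤ ∧ ∀ δ : ℝ, 0 < δ → δ < δ₀ →
      ∫⁻ x in {x | x ∈ B.chart.target ∧ δ ^ 2 ≤ ‖B.transv x‖ ∧ ‖B.transv x‖ ≤ δ},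
        ENNReal.ofReal (1 / (braneH p B.gs B.r₀ ‖B.transv x‖ * ‖B.transv x‖ ^ 2)) *
          ENNReal.ofReal (Real.exp (f x)) ∂riemannianVolume (k + (9 - p)) U ≤
        K * ENNReal.ofReal (-Real.log δ) := by
  obtain ⟨δ₁, hδ₁, hδ₁ε, hmet⟩ := B.metric_asymptotic (1 / 2) (by norm_num)
  obtain ⟨δ₂, hδ₂, hδ₂ε, hwt⟩ := B.weight_asymptotic 1 one_pos
  obtain ⟨K, hK, hann⟩ := exists_lintegral_annulus_le (d := 9 - p) (by omega)
  obtain ⟨C, hC, hV⟩ := exists_riemannianVolume_image_prod_le.{u, v} k (9 - p)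
    (by norm_num : (0 : ℝ) ≤ 3 / 2)
  -- Besides the validity of the two asymptotics, δ < r₀ ensures H > 0 on the annulus (the logarithm
  -- for p = 7 changes sign at r₀) and δ < 1 ensures log δ < 0.
  refine ⟨min (min δ₁ δ₂) (min B.r₀ 1), lt_min (lt_min hδ₁ hδ₂) (lt_min B.r₀_pos one_pos),
    C * riemannianVolume k B.M univ * ENNReal.ofReal (B.c + 1) * K, by finiteness, fun δ hδ hδ₀ => ?_⟩
  obtain ⟨⟨hd1, hd2⟩, hd3, hd4⟩ : (δ < δ₁ ∧ δ < δ₂) ∧ δ < B.r₀ ∧ δ < 1 := by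
    simpa [lt_min_iff] using hδ₀
  have hδ2 : 0 < δ ^ 2 := by positivity
  set B₀ : Set (Transverse p) := {y | δ ^ 2 ≤ ‖y‖ ∧ ‖y‖ ≤ δ} with hB₀
  have hB₀m : MeasurableSet B₀ := measurable_norm measurableSet_Icc
  set T : Set U := {x | x ∈ B.chart.target ∧ δ ^ 2 ≤ ‖B.transv x‖ ∧ ‖B.transv x‖ ≤ δ} with hT
  have hcont : ContinuousOn B.transv B.chart.target := fun x hx =>
    (B.contMDiffAt_transv hx).continuousAt.continuousWithinAt
  have hTm : MeasurableSet T :=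
    hcont.measurableSet_inter_preimage B.chart.open_target.measurableSet hB₀m
  set h : Transverse p → ℝ := fun y => braneH p B.gs B.r₀ ‖y‖ with hh
  have hhm : Measurable h := (measurable_braneH p B.gs B.r₀).comp measurable_norm
  have hh0 : ∀ y ∈ B₀, 0 < h y := fun y hy =>
    braneH_pos B.gs_pos (hδ2.trans_le hy.1) (hy.2.trans_lt hd3)
  have htr : AEMeasurable B.transv ((riemannianVolume (k + (9 - p)) U).restrict T) :=
    (hcont.aemeasurable B.chart.open_target.measurableSet).mono_set fun x hx => hx.1
  have hsrc : ∀ q : B.M × Transverse p, q.2 ∈ B₀ → q ∈ B.chart.source := fun q hq =>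
    B.mem_source.2 ⟨hδ2.trans_le hq.1, hq.2.trans_lt (hd1.trans_le hδ₁ε)⟩
  -- Pushed forward to the transverse space, the volume estimate for sets becomes an inequality of
  -- measures and so applies to integrals of functions of y.
  have hν : ((riemannianVolume (k + (9 - p)) U).restrict T).map B.transv ≤
      (C * riemannianVolume k B.M univ) •
        (volume.restrict B₀).withDensity fun y => ENNReal.ofReal (√(h y ^ (9 - p))) := by
    refine Measure.le_iff.2 fun A hA => ?_
    rw [Measure.map_apply_of_aemeasurable htr hA, Measure.restrict_apply' hTm, Measure.smul_apply,
      withDensity_apply _ hA, Measure.restrict_restrict hA, smul_eq_mul]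
    refine le_trans (measure_mono ?_) (hV B.chart (A ∩ B₀) h (hA.inter hB₀m) hhm
      (fun y hy => (hh0 y hy.2).le) (fun q hq => hsrc q hq.2.2) fun x y hy v w => ?_)
    · rintro x ⟨hxA, hx, hxB⟩
      exact ⟨B.chart.symm x, ⟨mem_univ _, hxA, hxB⟩, B.chart_symm hx⟩
    · have := (abs_le.1 (hmet x y (hδ2.trans_le hy.2.1) (hy.2.2.trans_lt hd1) v w)).2
      change _ ≤ 3 / 2 * (‖v‖ ^ 2 + braneH p B.gs B.r₀ ‖y‖ * ‖w‖ ^ 2)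
      linarith
  set g : Transverse p → ℝ≥0∞ := fun y => ENNReal.ofReal (1 / (h y * ‖y‖ ^ 2)) *
    ENNReal.ofReal ((B.c + 1) * h y ^ (((p : ℝ) - 7) / 2)) with hg
  have hgm : Measurable g := by
    refine Measurable.fun_mul ?_ ?_
    · exact (measurable_const.div (hhm.mul (measurable_norm.pow_const 2))).ennreal_ofReal
    · exact ((hhm.pow_const _).const_mul _).ennreal_ofReal
  calc _ ≤ ∫⁻ x in T, g (B.transv x) ∂riemannianVolume (k + (9 - p)) U := by
        refine setLIntegral_mono' hTm fun x hx => ?_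
        refine mul_le_mul_right (ENNReal.ofReal_le_ofReal ?_) _
        have hH := hh0 _ hx.2
        have h1 := hwt (B.chart.symm x).1 (B.chart.symm x).2 (hδ2.trans_le hx.2.1)
          (hx.2.2.trans_lt hd2)
        have h2 : B.chart ((B.chart.symm x).1, (B.chart.symm x).2) = x := B.chart_symm hx.1
        rw [h2] at h1
        have h3 := (abs_le.1 h1).2
        have hpow : 0 < h (B.transv x) ^ (((p : ℝ) - 7) / 2) := Real.rpow_pos_of_pos hH _
        have h4 : Real.exp (f x) / h (B.transv x) ^ (((p : ℝ) - 7) / 2) ≤ B.c + 1 := by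
          have : Real.exp (f x) / h (B.transv x) ^ (((p : ℝ) - 7) / 2) - B.c ≤ 1 := h3
          linarith
        exact (div_le_iff₀ hpow).1 h4
    _ = ∫⁻ y, g y ∂(((riemannianVolume (k + (9 - p)) U).restrict T).map B.transv) :=
        (lintegral_map' hgm.aemeasurable htr).symm
    _ ≤ ∫⁻ y, g y ∂((C * riemannianVolume k B.M univ) •
        (volume.restrict B₀).withDensity fun y => ENNReal.ofReal (√(h y ^ (9 - p)))) :=
        lintegral_mono' hν le_rfl
    _ = C * riemannianVolume k B.M univ * ∫⁻ y in B₀, ENNReal.ofReal (√(h y ^ (9 - p))) * g y := by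
        rw [lintegral_smul_measure, lintegral_withDensity_eq_lintegral_mul _ (by fun_prop) hgm]
        rfl
    _ = C * riemannianVolume k B.M univ *
        ∫⁻ y in B₀, ENNReal.ofReal (B.c + 1) * ENNReal.ofReal (1 / ‖y‖ ^ 2) := by
        congr 1
        refine setLIntegral_congr_fun hB₀m fun y hy => ?_
        have hH := hh0 y hy
        have hc := B.c_pos
        simp only [hg]
        rw [← ENNReal.ofReal_mul (by positivity), ← ENNReal.ofReal_mul (by positivity),
          ← ENNReal.ofReal_mul (by positivity)]
        congr 1
        have e1 : √(h y ^ (9 - p)) = h y ^ ((9 - (p : ℝ)) / 2) := by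
          rw [Real.sqrt_eq_rpow, ← Real.rpow_natCast, ← Real.rpow_mul hH.le]
          congr 1
          rw [Nat.cast_sub (by omega)]
          push_cast
          ring
        have e2 : h y ^ ((9 - (p : ℝ)) / 2) * h y ^ (((p : ℝ) - 7) / 2) = h y := by
          rw [← Real.rpow_add hH]
          conv_rhs => rw [← Real.rpow_one (h y)]
          congr 1
          ring
        rw [e1]
        have hy0 : 0 < ‖y‖ := hδ2.trans_le hy.1
        calc h y ^ ((9 - (p : ℝ)) / 2) * (1 / (h y * ‖y‖ ^ 2) *
              ((B.c + 1) * h y ^ (((p : ℝ) - 7) / 2)))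
            = (h y ^ ((9 - (p : ℝ)) / 2) * h y ^ (((p : ℝ) - 7) / 2)) *
              ((B.c + 1) / (h y * ‖y‖ ^ 2)) := by ring
          _ = _ := by rw [e2]; field_simp
    _ = C * riemannianVolume k B.M univ * (ENNReal.ofReal (B.c + 1) *
        ∫⁻ y in B₀, ENNReal.ofReal (1 / ‖y‖ ^ 2)) := by
        rw [lintegral_const_mul' _ _ ENNReal.ofReal_ne_top]
    _ ≤ C * riemannianVolume k B.M univ * (ENNReal.ofReal (B.c + 1) *
        (K * ENNReal.ofReal (-Real.log δ))) := by
        gcongr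
        exact hann δ hδ hd4
    _ = _ := by ring

end End

/-! ### Cutting off the singular set -/

theorem eLpNorm_two_eq {α : Type*} [MeasurableSpace α] {μ : Measure α} (g : α → ℝ) :
    eLpNorm g 2 μ = (∫⁻ x, ‖g x‖ₑ ^ (2 : ℝ) ∂μ) ^ (1 / 2 : ℝ) := by
  rw [eLpNorm_eq_lintegral_rpow_enorm_toReal (by simp) (by simp)]
  simp

namespace AsymptoticallyDpBrane

variable {p k : ℕ} {X : Type u} [MetricSpace X] {S : Set X}
  [ChartedSpace (EuclideanSpace ℝ (Fin (k + (9 - p)))) ↥Sᶜ]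
  [RiemannianBundle (fun x : ↥Sᶜ => TangentSpace (𝓡 (k + (9 - p))) x)]
  (D : AsymptoticallyDpBrane.{u, v} p k S)

open Classical in
/-- The cutoff function vanishing near the singular set. -/
def cutoff (δ : ℝ) (x : ↥Sᶜ) : ℝ :=
  if h : ∃ a, x ∈ (D.brane a).chart.target then logProfile δ ‖(D.brane h.choose).transv x‖ else 1

variable {D}

theorem cutoff_of_mem {a : Fin D.N} {x : ↥Sᶜ} (hx : x ∈ (D.brane a).chart.target) (δ : ℝ) :
    D.cutoff δ x = logProfile δ ‖(D.brane a).transv x‖ := by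
  have h : ∃ a, x ∈ (D.brane a).chart.target := ⟨a, hx⟩
  have ha : h.choose = a := by
    by_contra hne
    exact Set.disjoint_left.1 (D.disjoint _ _ hne) h.choose_spec hx
  rw [cutoff, dif_pos h, ha]

theorem cutoff_of_notMem {x : ↥Sᶜ} (hx : ∀ a, x ∉ (D.brane a).chart.target) (δ : ℝ) :
    D.cutoff δ x = 1 :=
  dif_neg fun ⟨a, ha⟩ => hx a ha

theorem cutoff_nonneg (δ : ℝ) (x : ↥Sᶜ) : 0 ≤ D.cutoff δ x := by
  rw [cutoff]
  split_ifs
  · exact logProfile_nonneg _ _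
  · exact zero_le_one

theorem cutoff_le_one (δ : ℝ) (x : ↥Sᶜ) : D.cutoff δ x ≤ 1 := by
  rw [cutoff]
  split_ifs
  · exact logProfile_le_one _ _
  · exact le_rfl

variable (D)

/-- The points of the ends at distance at most `δ` from the tip. -/
def tips (δ : ℝ) : Set ↥Sᶜ :=
  {x | ∃ a, x ∈ (D.brane a).chart.target ∧ ‖(D.brane a).transv x‖ ≤ δ}

variable {D}

/-- Off this closed set the cutoff is identically 1; hence its extension by 1 outside the ends is
locally Lipschitz. -/
theorem isClosed_tips {δ : ℝ} (hδ : 0 < δ) (hδε : ∀ a, δ < (D.brane a).ε) : IsClosed (D.tips δ) := by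
  convert! (D.isClosed_nhd δ hδ hδε).preimage continuous_subtype_val using 1
  ext x
  constructor
  · rintro ⟨a, hx, hxδ⟩
    refine Or.inr (mem_iUnion.2 ⟨a, x, ⟨(D.brane a).chart.symm x, ⟨?_, hxδ⟩, ?_⟩, rfl⟩)
    · exact (D.brane a).norm_transv_pos hx
    · exact (D.brane a).chart_symm hx
  · rintro (hx | hx)
    · exact absurd hx x.2
    · obtain ⟨a, _, ⟨q, ⟨hq0, hqδ⟩, rfl⟩, hqx⟩ := mem_iUnion.1 hx
      obtain rfl := Subtype.val_injective hqx
      have hq : q ∈ (D.brane a).chart.source :=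
        (D.brane a).mem_source.2 ⟨hq0, hqδ.trans_lt (hδε a)⟩
      refine ⟨a, (D.brane a).chart.map_source hq, ?_⟩
      rw [(D.brane a).transv_chart hq]
      exact hqδ

/-- Closedness is taken in X and not merely in the regular part: since X is complete, so is this
region, which is what the Hopf–Rinow argument requires. -/
theorem isClosed_compl_tipNhd {δ : ℝ} (hδ : 0 < δ) :
    ∃ C : Set X, IsClosed C ∧ C ⊆ Sᶜ ∧ ∀ x : ↥Sᶜ, (x : X) ∈ C ↔
      ∀ a, x ∈ (D.brane a).chart.target → δ ≤ ‖(D.brane a).transv x‖ := by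
  refine ⟨_, (D.isOpen_nhd δ hδ).isClosed_compl, fun x hx hxS => hx (Or.inl hxS), fun x => ?_⟩
  constructor
  · intro hx a hxa
    by_contra hlt
    refine hx (Or.inr (mem_iUnion.2 ⟨a, x, ⟨(D.brane a).chart.symm x, ⟨?_, not_le.1 hlt, ?_⟩, ?_⟩, rfl⟩))
    · exact (D.brane a).norm_transv_pos hxa
    · exact (D.brane a).norm_transv_lt hxa
    · exact (D.brane a).chart_symm hxa
  · rintro h (hx | hx)
    · exact x.2 hx
    · obtain ⟨a, _, ⟨q, ⟨hq0, hqδ, hqε⟩, rfl⟩, hqx⟩ := mem_iUnion.1 hx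
      obtain rfl := Subtype.val_injective hqx
      have hq : q ∈ (D.brane a).chart.source := (D.brane a).mem_source.2 ⟨hq0, hqε⟩
      have := h a ((D.brane a).chart.map_source hq)
      rw [(D.brane a).transv_chart hq] at this
      exact absurd hqδ this.not_gt

theorem cutoff_eq_one_of_notMem_tips {δ : ℝ} (hδ : 0 < δ) (hδ1 : δ < 1) {x : ↥Sᶜ}
    (hx : x ∉ D.tips δ) : D.cutoff δ x = 1 := by
  by_cases h : ∃ a, x ∈ (D.brane a).chart.target
  · obtain ⟨a, ha⟩ := h
    rw [cutoff_of_mem ha]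
    refine logProfile_eq_one hδ hδ1 (le_of_not_ge fun hle => hx ⟨a, ha, hle⟩)
  · exact cutoff_of_notMem (fun a ha => h ⟨a, ha⟩) δ

theorem cutoff_eq_zero_of_mem_tips {δ : ℝ} (hδ : 0 < δ) (hδ1 : δ < 1) {x : ↥Sᶜ}
    (hx : x ∈ D.tips (δ ^ 2)) : D.cutoff δ x = 0 := by
  obtain ⟨a, ha, h⟩ := hx
  rw [cutoff_of_mem ha]
  exact logProfile_eq_zero hδ hδ1 ((D.brane a).norm_transv_pos ha) h

theorem eventually_cutoff_eq_one (x : ↥Sᶜ) : ∀ᶠ δ in 𝓝[>] (0 : ℝ), D.cutoff δ x = 1 := by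
  by_cases h : ∃ a, x ∈ (D.brane a).chart.target
  · obtain ⟨a, ha⟩ := h
    have h0 := (D.brane a).norm_transv_pos ha
    filter_upwards [Ioo_mem_nhdsGT (lt_min h0 one_pos)] with δ hδ
    rw [cutoff_of_mem ha]
    exact logProfile_eq_one hδ.1 (hδ.2.trans_le (min_le_right _ _)) (hδ.2.le.trans (min_le_left _ _))
  · exact Eventually.of_forall fun δ => cutoff_of_notMem (fun a ha => h ⟨a, ha⟩) δ

theorem eventually_lt_of_pos {g : Fin D.N → ℝ} (hg : ∀ a, 0 < g a) :
    ∀ᶠ δ in 𝓝[>] (0 : ℝ), ∀ a, δ < g a :=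
  eventually_all.2 fun a => Filter.mem_of_superset (Ioo_mem_nhdsGT (hg a)) fun _ h => h.2

theorem locallyLipschitz_cutoff {δ : ℝ} (hδ : 0 < δ) (hδ1 : δ < 1) (hδε : ∀ a, δ < (D.brane a).ε) :
    LocallyLipschitz (D.cutoff δ) := by
  have := D.isManifold
  have := D.smoothMetric
  have := D.isRiemannianManifold
  intro x
  by_cases h : ∃ a, x ∈ (D.brane a).chart.target
  · obtain ⟨a, ha⟩ := h
    obtain ⟨K, t, ht, hK⟩ := (D.brane a).exists_lipschitzOnWith_logProfile_transv δ ha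
    refine ⟨K, t ∩ (D.brane a).chart.target,
      inter_mem ht ((D.brane a).chart.open_target.mem_nhds ha), fun y hy z hz => ?_⟩
    rw [cutoff_of_mem hy.2, cutoff_of_mem hz.2]
    exact hK hy.1 hz.1
  · refine ⟨0, (D.tips δ)ᶜ, (isClosed_tips hδ hδε).isOpen_compl.mem_nhds
      fun ⟨a, ha, _⟩ => h ⟨a, ha⟩, fun y hy z hz => ?_⟩
    rw [cutoff_eq_one_of_notMem_tips hδ hδ1 hy, cutoff_eq_one_of_notMem_tips hδ hδ1 hz]
    simp

/-- The annulus where the cutoff varies. -/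
def annulus (D : AsymptoticallyDpBrane.{u, v} p k S) (δ : ℝ) (a : Fin D.N) : Set ↥Sᶜ :=
  {x | x ∈ (D.brane a).chart.target ∧ δ ^ 2 ≤ ‖(D.brane a).transv x‖ ∧ ‖(D.brane a).transv x‖ ≤ δ}

theorem lipSlope_cutoff_eq_zero {δ : ℝ} (hδ : 0 < δ) (hδ1 : δ < 1) (hδε : ∀ a, δ < (D.brane a).ε)
    {x : ↥Sᶜ} (hx : ∀ a, x ∉ D.annulus δ a) : lipSlope (D.cutoff δ) x = 0 := by
  have := D.isManifold
  by_cases h : x ∈ D.tips δ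
  · obtain ⟨a, ha, hle⟩ := h
    have hlt : ‖(D.brane a).transv x‖ < δ ^ 2 := by
      by_contra hcon
      exact hx a ⟨ha, not_lt.1 hcon, hle⟩
    refine lipSlope_eq_zero (c := 0) ?_
    filter_upwards [(D.brane a).chart.open_target.mem_nhds ha,
      ((D.brane a).contMDiffAt_transv ha).continuousAt.norm.eventually (gt_mem_nhds hlt)] with y hy hy'
    exact cutoff_eq_zero_of_mem_tips hδ hδ1 ⟨a, hy, le_of_lt hy'⟩
  · refine lipSlope_eq_zero (c := 1) ?_
    filter_upwards [(isClosed_tips hδ hδε).isOpen_compl.mem_nhds h] with y hy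
    exact cutoff_eq_one_of_notMem_tips hδ hδ1 hy

theorem eventually_lipSlope_cutoff_le (D : AsymptoticallyDpBrane.{u, v} p k S) :
    ∀ᶠ δ in 𝓝[>] (0 : ℝ), ∀ a, ∀ x ∈ D.annulus δ a,
      0 < braneH p (D.brane a).gs (D.brane a).r₀ ‖(D.brane a).transv x‖ ∧
      ‖(D.brane a).transv x‖ < (D.brane a).r₀ ∧
      lipSlope (D.cutoff δ) x ≤ 2 * √2 * √(1 / (braneH p (D.brane a).gs (D.brane a).r₀
        ‖(D.brane a).transv x‖ * ‖(D.brane a).transv x‖ ^ 2)) * (1 / -Real.log δ) := by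
  have := D.isManifold
  have := D.smoothMetric
  have := D.isRiemannianManifold
  choose r hr hrε hmet using fun a => (D.brane a).metric_asymptotic (1 / 2) (by norm_num)
  filter_upwards [eventually_lt_of_pos hr, eventually_lt_of_pos fun a => (D.brane a).r₀_pos,
    Ioo_mem_nhdsGT (one_pos (α := ℝ))] with δ h1 h2 h3 a x hx
  have h0 := (D.brane a).norm_transv_pos hx.1
  have hr₀ := hx.2.2.trans_lt (h2 a)
  have hH := braneH_pos (p := p) (D.brane a).gs_pos h0 hr₀
  refine ⟨hH, hr₀, ?_⟩
  have hcongr : lipSlope (D.cutoff δ) x = lipSlope (fun x => logProfile δ ‖(D.brane a).transv x‖) x := by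
    refine lipSlope_congr ?_
    filter_upwards [(D.brane a).chart.open_target.mem_nhds hx.1] with y hy
    exact cutoff_of_mem hy δ
  rw [hcongr]
  refine ((D.brane a).lipSlope_logProfile_transv_le h3.1 h3.2 (hmet a) hx.1
    (hx.2.2.trans_lt (h1 a)) hH).trans (le_of_eq ?_)
  set H := braneH p (D.brane a).gs (D.brane a).r₀ ‖(D.brane a).transv x‖
  set s := ‖(D.brane a).transv x‖
  rw [Real.sqrt_div (by norm_num), Real.sqrt_div (by norm_num), Real.sqrt_one,
    Real.sqrt_mul hH.le, Real.sqrt_sq h0.le]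
  have hL : Real.log δ < 0 := Real.log_neg h3.1 h3.2
  have := Real.sqrt_pos.2 hH
  field_simp

variable [MeasurableSpace X] [BorelSpace X]

/-- The measure of the regular part. -/
def regMeasure (D : AsymptoticallyDpBrane.{u, v} p k S) : Measure ↥Sᶜ :=
  (riemannianVolume (k + (9 - p)) ↥Sᶜ).withDensity fun x => ENNReal.ofReal (Real.exp (D.f x))

theorem tendsto_inv_neg_log : Tendsto (fun δ => 1 / -Real.log δ) (𝓝[>] 0) (𝓝 0) := by
  have h : Tendsto (fun δ => -Real.log δ) (𝓝[>] 0) atTop :=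
    tendsto_neg_atBot_atTop.comp Real.tendsto_log_nhdsGT_zero
  simpa [one_div, Function.comp_def] using tendsto_inv_atTop_zero.comp h

/-- For p ≤ 5 the slope of the cutoff is at most C / |log δ| everywhere, so F in L² suffices, with
no bound on F or on volumes. The sum over the ends in C serves as an upper bound for the maximum. -/
theorem tendsto_energy_cutoff_of_le (hp : p ≤ 5) (D : AsymptoticallyDpBrane.{u, v} p k S)
    {F : ↥Sᶜ → ℝ} (hF : MemLp F 2 D.regMeasure) :
    Tendsto (fun δ => eLpNorm (fun x => |F x| * lipSlope (D.cutoff δ) x) 2 D.regMeasure)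
      (𝓝[>] 0) (𝓝 0) := by
  set C : ℝ := ∑ a, 2 * √2 * (1 / (D.brane a).r₀) with hC
  have hC0 : ∀ a, 0 ≤ 2 * √2 * (1 / (D.brane a).r₀) := fun a => by
    have := (D.brane a).r₀_pos
    positivity
  have hbound : ∀ᶠ δ in 𝓝[>] (0 : ℝ), ∀ x, lipSlope (D.cutoff δ) x ≤ C * (1 / -Real.log δ) := by
    filter_upwards [D.eventually_lipSlope_cutoff_le, Ioo_mem_nhdsGT (one_pos (α := ℝ)),
      eventually_lt_of_pos fun a => (D.brane a).ε_pos] with δ h1 h2 h3 x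
    have hL : 0 ≤ 1 / -Real.log δ := by
      have := Real.log_neg h2.1 h2.2
      exact div_nonneg zero_le_one (by linarith)
    by_cases hx : ∃ a, x ∈ D.annulus δ a
    · obtain ⟨a, ha⟩ := hx
      obtain ⟨hH, hr, hs⟩ := h1 a x ha
      refine hs.trans (mul_le_mul_of_nonneg_right ?_ hL)
      refine le_trans ?_ (Finset.single_le_sum (fun a _ => hC0 a) (Finset.mem_univ a))
      refine mul_le_mul_of_nonneg_left ?_ (by positivity)
      have h4 := sq_le_braneH_mul_sq hp (gs := (D.brane a).gs) ((D.brane a).norm_transv_pos ha.1) hr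
      have hr₀ := (D.brane a).r₀_pos
      rw [Real.sqrt_le_left (by positivity), div_pow, one_pow]
      gcongr
    · rw [lipSlope_cutoff_eq_zero h2.1 h2.2 h3 fun a ha => hx ⟨a, ha⟩]
      exact mul_nonneg (Finset.sum_nonneg fun a _ => hC0 a) hL
  have hlim : Tendsto (fun δ => ENNReal.ofReal (C * (1 / -Real.log δ)) * eLpNorm F 2 D.regMeasure)
      (𝓝[>] 0) (𝓝 0) := by
    have h1 : Tendsto (fun δ => ENNReal.ofReal (C * (1 / -Real.log δ))) (𝓝[>] 0) (𝓝 0) := by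
      simpa [Function.comp_def] using
        (ENNReal.continuous_ofReal.tendsto _).comp (tendsto_inv_neg_log.const_mul C)
    simpa using ENNReal.Tendsto.mul_const h1 (Or.inr hF.2.ne)
  refine tendsto_of_tendsto_of_tendsto_of_le_of_le' tendsto_const_nhds hlim
    (Eventually.of_forall fun _ => zero_le) ?_
  filter_upwards [hbound] with δ h
  refine eLpNorm_le_mul_eLpNorm_of_ae_le_mul (Eventually.of_forall fun x => ?_) 2
  rw [norm_mul, Real.norm_of_nonneg (lipSlope_nonneg _ _), Real.norm_eq_abs, abs_abs, mul_comm]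
  exact mul_le_mul_of_nonneg_right (h x) (abs_nonneg _)

/-- The squared slope contributes log^{-2} δ and the weighted integral at most K |log δ|, so the
energy is O(N² / |log δ|). -/
theorem tendsto_energy_cutoff_of_finite (hp : p ≤ 7) (D : AsymptoticallyDpBrane.{u, v} p k S)
    (hvol : D.FiniteVolumeFactors) {F : ↥Sᶜ → ℝ} {N : ℝ} (hFN : ∀ x, |F x| ≤ N) :
    Tendsto (fun δ => eLpNorm (fun x => |F x| * lipSlope (D.cutoff δ) x) 2 D.regMeasure)
      (𝓝[>] 0) (𝓝 0) := by
  have := D.isManifold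
  choose δ₀ hδ₀ K hK hint using fun a =>
    (D.brane a).exists_lintegral_le hp (hvol a)
  have key : ∀ᶠ δ in 𝓝[>] (0 : ℝ),
      ∫⁻ x, ‖|F x| * lipSlope (D.cutoff δ) x‖ₑ ^ (2 : ℝ) ∂D.regMeasure ≤
        ENNReal.ofReal (8 * N ^ 2) * (∑ a, K a) * ENNReal.ofReal (1 / -Real.log δ) := by
    filter_upwards [D.eventually_lipSlope_cutoff_le, Ioo_mem_nhdsGT (one_pos (α := ℝ)),
      eventually_lt_of_pos fun a => (D.brane a).ε_pos, eventually_lt_of_pos hδ₀] with δ h1 h2 h3 h4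
    have hL : 0 < -Real.log δ := by
      have := Real.log_neg h2.1 h2.2
      linarith
    have hm : ∀ a, MeasurableSet (D.annulus δ a) := fun a =>
      ContinuousOn.measurableSet_inter_preimage (fun x hx =>
        ((D.brane a).contMDiffAt_transv hx).continuousAt.continuousWithinAt)
        (D.brane a).chart.open_target.measurableSet (measurable_norm measurableSet_Icc)
    have hind : ∀ x, ‖|F x| * lipSlope (D.cutoff δ) x‖ₑ ^ (2 : ℝ) =
        (⋃ a, D.annulus δ a).indicator (fun x => ‖|F x| * lipSlope (D.cutoff δ) x‖ₑ ^ (2 : ℝ)) x := by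
      intro x
      by_cases hx : x ∈ ⋃ a, D.annulus δ a
      · rw [indicator_of_mem hx]
      · rw [indicator_of_notMem hx, lipSlope_cutoff_eq_zero h2.1 h2.2 h3
          fun a ha => hx (mem_iUnion.2 ⟨a, ha⟩)]
        simp
    have hone : ∀ a, ∫⁻ x in D.annulus δ a, ‖|F x| * lipSlope (D.cutoff δ) x‖ₑ ^ (2 : ℝ) ∂D.regMeasure ≤
        ENNReal.ofReal (8 * N ^ 2) * K a * ENNReal.ofReal (1 / -Real.log δ) := by
      intro a
      set H : ↥Sᶜ → ℝ := fun x => braneH p (D.brane a).gs (D.brane a).r₀ ‖(D.brane a).transv x‖ *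
        ‖(D.brane a).transv x‖ ^ 2 with hHdef
      have hpt : ∀ x ∈ D.annulus δ a, ‖|F x| * lipSlope (D.cutoff δ) x‖ₑ ^ (2 : ℝ) ≤
          ENNReal.ofReal (8 * N ^ 2 * (1 / -Real.log δ) ^ 2) * ENNReal.ofReal (1 / H x) := by
        intro x hx
        obtain ⟨hH, -, hs⟩ := h1 a x hx
        have hH' : 0 < H x := by
          have := (D.brane a).norm_transv_pos hx.1
          positivity
        rw [← ENNReal.ofReal_mul (by positivity), ENNReal.rpow_ofNat, Real.enorm_eq_ofReal
          (mul_nonneg (abs_nonneg _) (lipSlope_nonneg _ _)), ← ENNReal.ofReal_pow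
          (mul_nonneg (abs_nonneg _) (lipSlope_nonneg _ _))]
        refine ENNReal.ofReal_le_ofReal ?_
        calc (|F x| * lipSlope (D.cutoff δ) x) ^ 2
            ≤ (N * (2 * √2 * √(1 / H x) * (1 / -Real.log δ))) ^ 2 := by
              have hN : 0 ≤ N := (abs_nonneg _).trans (hFN x)
              have := lipSlope_nonneg (D.cutoff δ) x
              gcongr
              exact hFN x
          _ = 4 * (√2 ^ 2) * N ^ 2 * (1 / -Real.log δ) ^ 2 * (√(1 / H x)) ^ 2 := by ring
          _ = _ := by
              rw [Real.sq_sqrt (by positivity), Real.sq_sqrt (by positivity)]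
              ring
      calc ∫⁻ x in D.annulus δ a, ‖|F x| * lipSlope (D.cutoff δ) x‖ₑ ^ (2 : ℝ) ∂D.regMeasure
          ≤ ∫⁻ x in D.annulus δ a, ENNReal.ofReal (8 * N ^ 2 * (1 / -Real.log δ) ^ 2) *
            ENNReal.ofReal (1 / H x) ∂D.regMeasure := setLIntegral_mono' (hm a) hpt
        _ = ENNReal.ofReal (8 * N ^ 2 * (1 / -Real.log δ) ^ 2) *
            ∫⁻ x in D.annulus δ a, ENNReal.ofReal (1 / H x) ∂D.regMeasure :=
            lintegral_const_mul' _ _ ENNReal.ofReal_ne_top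
        _ ≤ ENNReal.ofReal (8 * N ^ 2 * (1 / -Real.log δ) ^ 2) *
            (K a * ENNReal.ofReal (-Real.log δ)) := by
            gcongr
            rw [regMeasure, restrict_withDensity (hm a)]
            refine (lintegral_withDensity_le_lintegral_mul _ ?_ _).trans ?_
            · exact (Real.measurable_exp.comp D.smooth_f.continuous.measurable).ennreal_ofReal
            · refine le_trans (le_of_eq ?_) (hint a δ h2.1 (h4 a))
              refine lintegral_congr fun x => ?_
              rw [mul_comm]
              rfl
        _ = ENNReal.ofReal (8 * N ^ 2) * K a * ENNReal.ofReal (1 / -Real.log δ) := by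
            have e : ENNReal.ofReal (8 * N ^ 2 * (1 / -Real.log δ) ^ 2) * ENNReal.ofReal (-Real.log δ) =
                ENNReal.ofReal (8 * N ^ 2) * ENNReal.ofReal (1 / -Real.log δ) := by
              rw [← ENNReal.ofReal_mul (by positivity), ← ENNReal.ofReal_mul (by positivity)]
              congr 1
              field_simp
            calc _ = ENNReal.ofReal (8 * N ^ 2 * (1 / -Real.log δ) ^ 2) *
                  ENNReal.ofReal (-Real.log δ) * K a := by ring
              _ = _ := by rw [e]; ring
    rw [lintegral_congr hind, lintegral_indicator (MeasurableSet.iUnion hm)]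
    refine (lintegral_iUnion_le _ _).trans ?_
    rw [tsum_fintype, Finset.mul_sum, Finset.sum_mul]
    exact Finset.sum_le_sum fun a _ => hone a
  have hlim : Tendsto (fun δ => (ENNReal.ofReal (8 * N ^ 2) * (∑ a, K a) *
      ENNReal.ofReal (1 / -Real.log δ)) ^ (1 / 2 : ℝ)) (𝓝[>] 0) (𝓝 0) := by
    have h1 : Tendsto (fun δ => ENNReal.ofReal (1 / -Real.log δ)) (𝓝[>] 0) (𝓝 0) := by
      simpa [Function.comp_def] using
        (ENNReal.continuous_ofReal.tendsto _).comp tendsto_inv_neg_log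
    have hfin : ENNReal.ofReal (8 * N ^ 2) * (∑ a, K a) ≠ ⊤ :=
      ENNReal.mul_ne_top ENNReal.ofReal_ne_top (ENNReal.sum_ne_top.2 fun a _ => hK a)
    have h2 := ENNReal.Tendsto.const_mul h1 (Or.inr hfin)
    have h3 := ((ENNReal.continuous_rpow_const (y := (1 / 2 : ℝ))).tendsto _).comp h2
    simpa [Function.comp_def] using h3
  refine tendsto_of_tendsto_of_tendsto_of_le_of_le' tendsto_const_nhds hlim
    (Eventually.of_forall fun _ => zero_le) ?_
  filter_upwards [key] with δ h
  rw [eLpNorm_two_eq]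
  exact ENNReal.rpow_le_rpow h (by norm_num)

theorem tendsto_energy_cutoff (hp : p ≤ 7) (D : AsymptoticallyDpBrane.{u, v} p k S)
    (hvol : p = 6 ∨ p = 7 → D.FiniteVolumeFactors) {F : ↥Sᶜ → ℝ} {N : ℝ} (hFN : ∀ x, |F x| ≤ N)
    (hF : MemLp F 2 D.regMeasure) :
    Tendsto (fun δ => eLpNorm (fun x => |F x| * lipSlope (D.cutoff δ) x) 2 D.regMeasure)
      (𝓝[>] 0) (𝓝 0) := by
  rcases le_or_gt p 5 with h | h
  · exact tendsto_energy_cutoff_of_le h D hF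
  · exact tendsto_energy_cutoff_of_finite hp D (hvol (by omega)) hFN

end AsymptoticallyDpBrane

/-! ### Approximation by test functions on the regular part -/

namespace AsymptoticallyDpBrane

variable {p k : ℕ} {X : Type u} [MetricSpace X] {S : Set X}
  [ChartedSpace (EuclideanSpace ℝ (Fin (k + (9 - p)))) ↥Sᶜ]
  [RiemannianBundle (fun x : ↥Sᶜ => TangentSpace (𝓡 (k + (9 - p))) x)]
  (D : AsymptoticallyDpBrane.{u, v} p k S)

/-- ζ j is the product of the logarithmic cutoff with the chain cutoff of radius j + 1 in V j, the
complement of the tips of size e j. The growing radius provides both the slope bound 1/(j+1) and the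
eventual value 1 at every point. -/
theorem exists_compactly_supported_cutoff [CompleteSpace X] (x₀ : ↥Sᶜ) :
    ∃ (δ : ℕ → ℝ) (ζ : ℕ → ↥Sᶜ → ℝ), Tendsto δ atTop (𝓝[>] 0) ∧
      (∀ j, LocallyLipschitz (D.cutoff (δ j))) ∧ (∀ j x, 0 ≤ ζ j x ∧ ζ j x ≤ 1) ∧ (∀ j, LocallyLipschitz (ζ j)) ∧
      (∀ j, HasCompactSupport (ζ j)) ∧ (∀ x, ∀ᶠ j in atTop, ζ j x = 1) ∧
      ∀ j x, lipSlope (ζ j) x ≤ lipSlope (D.cutoff (δ j)) x + 1 / ((j : ℝ) + 1) := by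
  have := D.isManifold
  have := D.smoothMetric
  have := D.isRiemannianManifold
  have : LocallyCompactSpace ↥Sᶜ := Manifold.locallyCompact_of_finiteDimensional (𝓡 (k + (9 - p)))
  have : PreconnectedSpace ↥Sᶜ := preconnectedSpace_of_riemannian D.isRiemannianManifold
  obtain ⟨η, hη0, hη⟩ : ∃ η > 0, ∀ δ : ℝ, 0 < δ → δ < η → δ < 1 ∧ ∀ a, δ < (D.brane a).ε := by
    have h : ∀ᶠ δ in 𝓝[>] (0 : ℝ), δ < 1 ∧ ∀ a, δ < (D.brane a).ε := by
      filter_upwards [Ioo_mem_nhdsGT (one_pos (α := ℝ)),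
        eventually_lt_of_pos fun a => (D.brane a).ε_pos] with δ h1 h2 using ⟨h1.2, h2⟩
    obtain ⟨η, hη, h⟩ := mem_nhdsGT_iff_exists_Ioo_subset.1 h
    exact ⟨η, hη, fun δ h1 h2 => h ⟨h1, h2⟩⟩
  set δ : ℕ → ℝ := fun j => η / 2 * (1 / ((j : ℝ) + 1)) with hδdef
  have hδ0 : ∀ j, 0 < δ j := fun j => by positivity
  have hδη : ∀ j, δ j < η := fun j => by
    have : 1 / ((j : ℝ) + 1) ≤ 1 := by
      rw [div_le_one (by positivity)]
      linarith [(Nat.cast_nonneg j : (0 : ℝ) ≤ j)]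
    calc δ j ≤ η / 2 * 1 := by simp only [hδdef]; gcongr
      _ < η := by linarith
  have hδ1 : ∀ j, δ j < 1 := fun j => (hη _ (hδ0 j) (hδη j)).1
  have hδε : ∀ j a, δ j < (D.brane a).ε := fun j => (hη _ (hδ0 j) (hδη j)).2
  have hδlim : Tendsto δ atTop (𝓝 0) := by
    have h := (tendsto_one_div_add_atTop_nhds_zero_nat (𝕜 := ℝ)).const_mul (η / 2)
    rwa [mul_zero] at h
  have hδlim' : Tendsto δ atTop (𝓝[>] 0) :=
    tendsto_nhdsWithin_iff.2 ⟨hδlim, Eventually.of_forall hδ0⟩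
  have hδanti : Antitone δ := fun i j hij => by
    simp only [hδdef]
    gcongr
  -- With e j strictly below δ j ², the logarithmic cutoff vanishes on a neighbourhood of every
  -- point outside V j. This is essential because the chain cutoff is known to be locally Lipschitz
  -- only on V j.
  set e : ℕ → ℝ := fun j => δ j ^ 2 / 2 with hedef
  have he0 : ∀ j, 0 < e j := fun j => by have := hδ0 j; positivity
  have heδ : ∀ j, e j < δ j ^ 2 := fun j => by
    have := he0 j
    simp only [hedef] at this ⊢
    linarith
  have heδ' : ∀ j, e j < δ j := fun j => (heδ j).trans_le (by nlinarith [hδ0 j, hδ1 j])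
  set V : ℕ → Set ↥Sᶜ := fun j => (D.tips (e j))ᶜ with hV
  have hVo : ∀ j, IsOpen (V j) := fun j =>
    (isClosed_tips (he0 j) fun a => (heδ' j).trans (hδε j a)).isOpen_compl
  have hVm : Monotone V := by
    intro i j hij
    refine compl_subset_compl.2 ?_
    rintro x ⟨a, ha, hx⟩
    refine ⟨a, ha, hx.trans ?_⟩
    have := hδanti hij
    have := hδ0 j
    simp only [hedef]
    gcongr
  have hVc : ∀ x, ∃ j, x ∈ V j := by
    intro x
    by_cases h : ∃ a, x ∈ (D.brane a).chart.target
    · obtain ⟨a, ha⟩ := h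
      obtain ⟨j, hj⟩ := (hδlim.eventually (gt_mem_nhds ((D.brane a).norm_transv_pos ha))).exists
      refine ⟨j, fun ⟨b, hb, hle⟩ => ?_⟩
      have hab : b = a := by
        by_contra hne
        exact Set.disjoint_left.1 (D.disjoint _ _ hne) hb ha
      subst hab
      exact absurd (hle.trans (heδ' j).le) hj.not_ge
    · exact ⟨0, fun ⟨a, ha, _⟩ => h ⟨a, ha⟩⟩
  have hC : ∀ j, ∃ C : Set ↥Sᶜ, IsComplete C ∧ V j ⊆ C := by
    intro j
    obtain ⟨C, hC, hCS, hmem⟩ := isClosed_compl_tipNhd (D := D) (he0 j)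
    refine ⟨Subtype.val ⁻¹' C, ?_, fun x hx => (hmem x).2 fun a ha => ?_⟩
    · rw [← isUniformEmbedding_subtype_val.isUniformInducing.isComplete_iff,
        image_preimage_eq_inter_range, Subtype.range_coe, inter_eq_left.2 hCS]
      exact hC.isComplete
    · by_contra hcon
      exact hx ⟨a, ha, (not_le.1 hcon).le⟩
  choose C hCc hVC using hC
  choose κ hκ01 hκc hκl hκ1 using fun j : ℕ => exists_cutoff (x₀ := x₀)
    (fun x y a b ha hb h => exists_dist_lt_dist_lt D.isRiemannianManifold ha hb h)
    (hVo j) (hCc j) (hVC j) (by positivity : (0 : ℝ) < (j : ℝ) + 1)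
  have hzero : ∀ j x, x ∉ V j → (fun x => D.cutoff (δ j) x * κ j x) =ᶠ[𝓝 x] fun _ => 0 := by
    intro j x hx
    obtain ⟨a, ha, hle⟩ := not_not.1 hx
    filter_upwards [(D.brane a).chart.open_target.mem_nhds ha,
      ((D.brane a).contMDiffAt_transv ha).continuousAt.norm.eventually
        (gt_mem_nhds (hle.trans_lt (heδ j)))] with y hy hy'
    rw [cutoff_eq_zero_of_mem_tips (hδ0 j) (hδ1 j) ⟨a, hy, le_of_lt hy'⟩, zero_mul]
  have hχ : ∀ j, LocallyLipschitz (D.cutoff (δ j)) := fun j =>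
    locallyLipschitz_cutoff (hδ0 j) (hδ1 j) (hδε j)
  have hκL : ∀ j, ∀ x ∈ V j, ∃ K, ∃ t ∈ 𝓝 x, LipschitzOnWith K (κ j) t := by
    intro j x hx
    obtain ⟨s, hs, h⟩ := hκl j x hx
    exact ⟨⟨1 / ((j : ℝ) + 1), by positivity⟩, s, hs, LipschitzOnWith.of_dist_le_mul h⟩
  refine ⟨δ, fun j x => D.cutoff (δ j) x * κ j x, hδlim', hχ, fun j x => ?_, fun j x => ?_,
    fun j => (hκc j).mul_left, fun x => ?_, fun j x => ?_⟩
  · exact ⟨mul_nonneg (cutoff_nonneg _ _) (hκ01 j x).1,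
      mul_le_one₀ (cutoff_le_one _ _) (hκ01 j x).1 (hκ01 j x).2⟩
  · by_cases hx : x ∈ V j
    · exact exists_lipschitzOnWith_mul (hχ j x) (hκL j x hx)
    · refine ⟨0, _, hzero j x hx, fun y hy z hz => ?_⟩
      have hy' : D.cutoff (δ j) y * κ j y = 0 := hy
      have hz' : D.cutoff (δ j) z * κ j z = 0 := hz
      change edist (D.cutoff (δ j) y * κ j y) (D.cutoff (δ j) z * κ j z) ≤ _
      rw [hy', hz']
      simp
  · obtain ⟨c, k₀, hc⟩ := exists_reach hVo hVm hVc x₀ x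
    obtain ⟨m, hm⟩ := exists_nat_ge c
    filter_upwards [hδlim'.eventually (D.eventually_cutoff_eq_one x), eventually_ge_atTop k₀,
      eventually_ge_atTop m] with j h1 h2 h3
    rw [h1, hκ1 j x c ?_ (hc j h2), one_mul]
    have : (m : ℝ) ≤ j := Nat.cast_le.2 h3
    linarith
  · by_cases hx : x ∈ V j
    · obtain ⟨K, t, ht, hK⟩ := hκL j x hx
      have hp : PtLip (κ j) x := by
        refine ⟨K, ?_⟩
        filter_upwards [ht] with y hy
        exact hK.dist_le_mul y hy x (mem_of_mem_nhds ht)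
      have hs : lipSlope (κ j) x ≤ 1 / ((j : ℝ) + 1) := by
        obtain ⟨s, hs, h⟩ := hκl j x hx
        refine lipSlope_le (by positivity) ?_
        filter_upwards [hs] with y hy
        exact h y hy x (mem_of_mem_nhds hs)
      refine (lipSlope_mul_le ((hχ j).ptLip x) hp).trans ?_
      have h1 : |D.cutoff (δ j) x| ≤ 1 := by
        rw [abs_of_nonneg (cutoff_nonneg _ _)]
        exact cutoff_le_one _ _
      have h2 : |κ j x| ≤ 1 := by
        rw [abs_of_nonneg (hκ01 j x).1]
        exact (hκ01 j x).2
      have h3 := lipSlope_nonneg (κ j) x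
      have h4 := lipSlope_nonneg (D.cutoff (δ j)) x
      nlinarith
    · rw [lipSlope_eq_zero (hzero j x hx)]
      have h4 := lipSlope_nonneg (D.cutoff (δ j)) x
      positivity

variable [MeasurableSpace X] [BorelSpace X]

theorem isLocallyFiniteMeasure_regMeasure : IsLocallyFiniteMeasure D.regMeasure := by
  have := D.isManifold
  have := D.smoothMetric
  exact isLocallyFiniteMeasure_withDensity_riemannianVolume
    (Real.continuous_exp.comp D.smooth_f.continuous)

variable [CompleteSpace X] [SecondCountableTopology X]

/-- By the Leibniz rule the slope of F ζ j is at most |F| times the slope of the logarithmic cutoff,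
plus |F| / (j+1), plus the slope of F; the first two terms tend to 0 in L². The slope of φ is only
bounded in norm by that of F, with no convergence claimed, and relaxation needs no more. -/
theorem exists_smooth_approx_of_bounded (hp : p ≤ 7) (hvol : p = 6 ∨ p = 7 → D.FiniteVolumeFactors)
    {F : ↥Sᶜ → ℝ} (hFl : LocallyLipschitz F) {N : ℝ} (hFN : ∀ x, |F x| ≤ N)
    (hF : MemLp F 2 D.regMeasure) {ε : ℝ≥0∞} (hε : 0 < ε) :
    ∃ φ : ↥Sᶜ → ℝ, ContMDiff (𝓡 (k + (9 - p))) 𝓘(ℝ, ℝ) ∞ φ ∧ HasCompactSupport φ ∧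
      eLpNorm (fun x => φ x - F x) 2 D.regMeasure ≤ ε ∧
      eLpNorm (lipSlope φ) 2 D.regMeasure ≤ eLpNorm (lipSlope F) 2 D.regMeasure + ε := by
  have := D.isManifold
  have := D.smoothMetric
  have := D.isRiemannianManifold
  have := D.isLocallyFiniteMeasure_regMeasure
  rcases isEmpty_or_nonempty ↥Sᶜ with hE | ⟨⟨x₀⟩⟩
  · refine ⟨fun _ => 0, contMDiff_const, HasCompactSupport.zero, ?_, ?_⟩ <;>
      simp [Measure.eq_zero_of_isEmpty]
  obtain ⟨δ, ζ, hδ, hχ, hζ01, hζl, hζc, hζ1, hζs⟩ := D.exists_compactly_supported_cutoff x₀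
  have hGl : ∀ j, LocallyLipschitz fun x => F x * ζ j x := fun j => hFl.real_mul (hζl j)
  have t1 : Tendsto (fun j => eLpNorm (fun x => F x * ζ j x - F x) 2 D.regMeasure) atTop (𝓝 0) := by
    refine tendsto_eLpNorm_two_zero (b := fun x => |F x|)
      (fun j => ((hGl j).continuous.sub hFl.continuous).aestronglyMeasurable) hF.abs
      (fun j => Eventually.of_forall fun x => ?_) (Eventually.of_forall fun x => ?_)
    · have e : F x * ζ j x - F x = F x * (ζ j x - 1) := by ring
      rw [e, abs_mul]
      refine mul_le_of_le_one_right (abs_nonneg _) (abs_le.2 ⟨?_, ?_⟩) <;>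
        linarith [(hζ01 j x).1, (hζ01 j x).2]
    · refine tendsto_const_nhds.congr' ?_
      filter_upwards [hζ1 x] with j hj
      rw [hj]
      ring
  have t2 := (D.tendsto_energy_cutoff hp hvol hFN hF).comp hδ
  have t3 : Tendsto (fun j : ℕ => ENNReal.ofReal (1 / ((j : ℝ) + 1)) * eLpNorm F 2 D.regMeasure)
      atTop (𝓝 0) := by
    have h1 : Tendsto (fun j : ℕ => ENNReal.ofReal (1 / ((j : ℝ) + 1))) atTop (𝓝 0) := by
      simpa [Function.comp_def] using (ENNReal.continuous_ofReal.tendsto _).comp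
        (tendsto_one_div_add_atTop_nhds_zero_nat (𝕜 := ℝ))
    simpa using ENNReal.Tendsto.mul_const h1 (Or.inr hF.2.ne)
  have hε3 : 0 < ε / 3 := ENNReal.div_pos hε.ne' (by norm_num)
  obtain ⟨j, h1, h2, h3⟩ := ((t1.eventually (gt_mem_nhds hε3)).and
    ((t2.eventually (gt_mem_nhds hε3)).and (t3.eventually (gt_mem_nhds hε3)))).exists
  obtain ⟨φ, hφ, hφc, h4, h5⟩ := exists_smooth_approx (μ := D.regMeasure)
    (withDensity_absolutelyContinuous _ _) (hGl j) (hζc j).mul_left hε3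
  have h333 : ε / 3 + ε / 3 + ε / 3 = ε := ENNReal.add_thirds ε
  have hsub : LocallyLipschitz fun x => φ x - F x * ζ j x := by
    simpa only [sub_eq_add_neg] using hφ.locallyLipschitz.real_add (hGl j).real_neg
  have hm : ∀ {f : ↥Sᶜ → ℝ}, LocallyLipschitz f → AEStronglyMeasurable f D.regMeasure :=
    fun h => h.continuous.aestronglyMeasurable
  have hms : ∀ {f : ↥Sᶜ → ℝ}, LocallyLipschitz f → AEStronglyMeasurable (lipSlope f) D.regMeasure :=
    fun h => (measurable_lipSlope h.continuous).aestronglyMeasurable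
  refine ⟨φ, hφ, hφc, ?_, ?_⟩
  · have e : (fun x => φ x - F x) = fun x => (φ x - F x * ζ j x) + (F x * ζ j x - F x) := by
      funext x
      ring
    rw [e]
    refine (eLpNorm_add_le (hm hsub) ((hm (hGl j)).sub (hm hFl)) (by norm_num)).trans ?_
    calc _ ≤ ε / 3 + ε / 3 := add_le_add h4 h1.le
      _ ≤ ε / 3 + ε / 3 + ε / 3 := le_self_add
      _ = ε := h333
  · have hχm : AEStronglyMeasurable (fun x => |F x| * lipSlope (D.cutoff (δ j)) x) D.regMeasure :=
      (hFl.continuous.abs.measurable.mul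
        (measurable_lipSlope (hχ j).continuous)).aestronglyMeasurable
    have hb : ∀ x, ‖lipSlope φ x‖ ≤ lipSlope (fun x => φ x - F x * ζ j x) x +
        (|F x| * lipSlope (D.cutoff (δ j)) x + (1 / ((j : ℝ) + 1) * |F x| + lipSlope F x)) := by
      intro x
      rw [Real.norm_of_nonneg (lipSlope_nonneg _ _)]
      have e : φ = fun x => (φ x - F x * ζ j x) + F x * ζ j x := by
        funext x
        ring
      have h6 : lipSlope φ x ≤ lipSlope (fun x => φ x - F x * ζ j x) x +
          lipSlope (fun x => F x * ζ j x) x := by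
        conv_lhs => rw [e]
        exact lipSlope_add_le (hsub.ptLip x) ((hGl j).ptLip x)
      have h7 : lipSlope (fun x => F x * ζ j x) x ≤ |F x| * lipSlope (ζ j) x +
          |ζ j x| * lipSlope F x := lipSlope_mul_le (hFl.ptLip x) ((hζl j).ptLip x)
      have h8 : |ζ j x| * lipSlope F x ≤ lipSlope F x := by
        rw [abs_of_nonneg (hζ01 j x).1]
        exact mul_le_of_le_one_left (lipSlope_nonneg _ _) (hζ01 j x).2
      have h9 := mul_le_mul_of_nonneg_left (hζs j x) (abs_nonneg (F x))
      linarith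
    have hFa : AEStronglyMeasurable (fun x => 1 / ((j : ℝ) + 1) * |F x|) D.regMeasure :=
      (continuous_const.mul hFl.continuous.abs).aestronglyMeasurable
    refine (eLpNorm_mono_real hb).trans ?_
    refine (eLpNorm_add_le (hms hsub) (hχm.add (hFa.add (hms hFl))) (by norm_num)).trans ?_
    refine (add_le_add_right (eLpNorm_add_le hχm (hFa.add (hms hFl)) (by norm_num)) _).trans ?_
    refine (add_le_add_right (add_le_add_right (eLpNorm_add_le hFa (hms hFl) (by norm_num)) _) _).trans ?_
    have h10 : eLpNorm (fun x => 1 / ((j : ℝ) + 1) * |F x|) 2 D.regMeasure ≤ ε / 3 := by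
      refine (eLpNorm_le_mul_eLpNorm_of_ae_le_mul (g := F) (c := 1 / ((j : ℝ) + 1))
        (Eventually.of_forall fun x => ?_) 2).trans h3.le
      rw [norm_mul, Real.norm_of_nonneg (by positivity), Real.norm_eq_abs, abs_abs, Real.norm_eq_abs]
    calc _ ≤ ε / 3 + (ε / 3 + (ε / 3 + eLpNorm (lipSlope F) 2 D.regMeasure)) := by
          gcongr
          exact h2.le
      _ = eLpNorm (lipSlope F) 2 D.regMeasure + (ε / 3 + ε / 3 + ε / 3) := by ring
      _ = _ := by rw [h333]

/-- Truncation at ±N is 1-Lipschitz and fixes 0, so it does not increase slopes, and it converges in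
L² as N → ∞. -/
theorem exists_smooth_approx (hp : p ≤ 7) (hvol : p = 6 ∨ p = 7 → D.FiniteVolumeFactors)
    {F : ↥Sᶜ → ℝ} (hFl : LocallyLipschitz F)
    (hF : MemLp F 2 D.regMeasure) {ε : ℝ≥0∞} (hε : 0 < ε) :
    ∃ φ : ↥Sᶜ → ℝ, ContMDiff (𝓡 (k + (9 - p))) 𝓘(ℝ, ℝ) ∞ φ ∧ HasCompactSupport φ ∧
      eLpNorm (fun x => φ x - F x) 2 D.regMeasure ≤ ε ∧
      eLpNorm (lipSlope φ) 2 D.regMeasure ≤ eLpNorm (lipSlope F) 2 D.regMeasure + ε := by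
  set θ : ℕ → ℝ → ℝ := fun N t => max (-(N : ℝ)) (min N t) with hθ
  have hθL : ∀ N, LipschitzWith 1 (θ N) := fun N => (LipschitzWith.id.const_min _).const_max _
  have hθN : ∀ N t, |θ N t| ≤ N := fun N t => by
    have hN : (0 : ℝ) ≤ N := Nat.cast_nonneg N
    exact abs_le.2 ⟨le_max_left _ _, max_le (by linarith) (min_le_left _ _)⟩
  have hθ0 : ∀ N, θ N 0 = 0 := fun N => by
    have hN : (0 : ℝ) ≤ N := Nat.cast_nonneg N
    simp only [hθ]
    rw [min_eq_right hN, max_eq_right (by linarith)]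
  have hθle : ∀ N t, |θ N t| ≤ |t| := fun N t => by
    have := (hθL N).dist_le_mul t 0
    rw [hθ0] at this
    simpa using this
  have hθsub : ∀ N t, |θ N t - t| ≤ |t| := fun N t => by
    have hN : (0 : ℝ) ≤ N := Nat.cast_nonneg N
    simp only [hθ]
    rcases le_total t N with h | h
    · rw [min_eq_right h]
      rcases le_total (-(N : ℝ)) t with h' | h'
      · rw [max_eq_right h', sub_self, abs_zero]
        exact abs_nonneg _
      · rw [max_eq_left h', abs_of_nonneg (by linarith), abs_of_nonpos (by linarith)]
        linarith
    · rw [min_eq_left h, max_eq_right (by linarith), abs_of_nonpos (by linarith),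
        abs_of_nonneg (by linarith)]
      linarith
  have hFθl : ∀ N, LocallyLipschitz (θ N ∘ F) := fun N => (hθL N).locallyLipschitz.comp hFl
  have hθm : ∀ N, MemLp (θ N ∘ F) 2 D.regMeasure := fun N =>
    hF.mono (hFθl N).continuous.aestronglyMeasurable (Eventually.of_forall fun x => hθle N (F x))
  have t1 : Tendsto (fun N => eLpNorm (fun x => θ N (F x) - F x) 2 D.regMeasure) atTop (𝓝 0) := by
    refine tendsto_eLpNorm_two_zero (b := fun x => |F x|)
      (fun N => ((hFθl N).continuous.sub hFl.continuous).aestronglyMeasurable) hF.abs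
      (fun N => Eventually.of_forall fun x => hθsub N (F x)) (Eventually.of_forall fun x => ?_)
    obtain ⟨m, hm⟩ := exists_nat_ge |F x|
    refine tendsto_const_nhds.congr' ?_
    filter_upwards [eventually_ge_atTop m] with N hN
    have h1 : |F x| ≤ N := hm.trans (Nat.cast_le.2 hN)
    simp only [hθ]
    rw [min_eq_right (abs_le.1 h1).2, max_eq_right (abs_le.1 h1).1, sub_self]
  have hε2 : 0 < ε / 2 := ENNReal.half_pos hε.ne'
  obtain ⟨N, hN⟩ := (t1.eventually (gt_mem_nhds hε2)).exists
  obtain ⟨φ, hφ, hφc, h1, h2⟩ := D.exists_smooth_approx_of_bounded hp hvol (hFθl N)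
    (fun x => hθN N (F x)) (hθm N) hε2
  refine ⟨φ, hφ, hφc, ?_, h2.trans (add_le_add ?_ ENNReal.half_le_self)⟩
  · have e : (fun x => φ x - F x) = fun x => (φ x - (θ N ∘ F) x) + (θ N (F x) - F x) := by
      funext x
      simp
    rw [e]
    refine (eLpNorm_add_le (hφ.continuous.sub (hFθl N).continuous).aestronglyMeasurable
      ((hFθl N).continuous.sub hFl.continuous).aestronglyMeasurable (by norm_num)).trans ?_
    exact (add_le_add h1 hN.le).trans (ENNReal.add_halves ε).le
  · refine eLpNorm_mono fun x => ?_
    rw [Real.norm_of_nonneg (lipSlope_nonneg _ _), Real.norm_of_nonneg (lipSlope_nonneg _ _)]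
    exact lipSlope_comp_le (hFl.ptLip x) (hθL N)

end AsymptoticallyDpBrane

/-! ### The Sobolev space -/

section Memberships

variable {U : Type*} [MetricSpace U]

theorem lipSlope_eq_zero_of_notMem_tsupport {φ : U → ℝ} {x : U} (hx : x ∉ tsupport φ) :
    lipSlope φ x = 0 :=
  lipSlope_eq_zero (notMem_tsupport_iff_eventuallyEq.1 hx)

theorem LocallyLipschitz.memLp_lipSlope [MeasurableSpace U] [BorelSpace U] {μ : Measure U}
    [IsLocallyFiniteMeasure μ] {φ : U → ℝ} (h : LocallyLipschitz φ) (hc : HasCompactSupport φ) :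
    MemLp (lipSlope φ) 2 μ := by
  obtain ⟨K, hK⟩ := h.exists_lipschitzWith hc
  refine (memLp_indicator_const 2 (isClosed_tsupport φ).measurableSet (K : ℝ)
    (Or.inr (hc.isCompact.measure_lt_top (μ := μ)).ne)).mono
    (measurable_lipSlope h.continuous).aestronglyMeasurable (Eventually.of_forall fun x => ?_)
  by_cases hx : x ∈ tsupport φ
  · rw [indicator_of_mem hx, Real.norm_of_nonneg (lipSlope_nonneg _ _),
      Real.norm_of_nonneg K.coe_nonneg]
    exact hK.lipSlope_le x
  · rw [lipSlope_eq_zero_of_notMem_tsupport hx, norm_zero]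
    exact norm_nonneg _

theorem eLpNorm_lipSlope_parallelogram {n : ℕ} [ChartedSpace (EuclideanSpace ℝ (Fin n)) U]
    [RiemannianBundle (fun x : U => TangentSpace (𝓡 n) x)] [IsManifold (𝓡 n) ∞ U]
    [IsContMDiffRiemannianBundle (𝓡 n) ∞ (EuclideanSpace ℝ (Fin n))
      (fun x : U => TangentSpace (𝓡 n) x)] [IsRiemannianManifold (𝓡 n) U]
    [MeasurableSpace U] [BorelSpace U] {μ : Measure U} {φ ψ : U → ℝ}
    (hφ : ContMDiff (𝓡 n) 𝓘(ℝ, ℝ) ∞ φ) (hψ : ContMDiff (𝓡 n) 𝓘(ℝ, ℝ) ∞ ψ) :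
    eLpNorm (lipSlope (φ + ψ)) 2 μ ^ 2 + eLpNorm (lipSlope (φ - ψ)) 2 μ ^ 2 =
      2 * (eLpNorm (lipSlope φ) 2 μ ^ 2 + eLpNorm (lipSlope ψ) 2 μ ^ 2) := by
  have key : ∀ χ : U → ℝ, eLpNorm (lipSlope χ) 2 μ ^ 2 = ∫⁻ x, ENNReal.ofReal (lipSlope χ x ^ 2) ∂μ := by
    intro χ
    rw [eLpNorm_two_eq, ← ENNReal.rpow_natCast, ← ENNReal.rpow_mul]
    norm_num
    refine lintegral_congr fun x => ?_
    rw [Real.enorm_of_nonneg (lipSlope_nonneg _ _), ENNReal.ofReal_pow (lipSlope_nonneg _ _)]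
  have hm : ∀ {χ : U → ℝ}, Continuous χ → Measurable fun x => ENNReal.ofReal (lipSlope χ x ^ 2) :=
    fun h => ((measurable_lipSlope h).pow_const 2).ennreal_ofReal
  rw [key, key, key, key, ← lintegral_add_left (hm (hφ.continuous.add hψ.continuous)),
    ← lintegral_add_left (hm hφ.continuous), ← lintegral_const_mul' _ _ (by norm_num)]
  refine lintegral_congr fun x => ?_
  have h1 : (1 : WithTop ℕ∞) ≤ (∞ : WithTop ℕ∞) := by simp
  rw [← ENNReal.ofReal_add (sq_nonneg _) (sq_nonneg _),
    ← ENNReal.ofReal_add (sq_nonneg _) (sq_nonneg _),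
    lipSlope_parallelogram ((hφ.of_le h1) x) ((hψ.of_le h1) x), ENNReal.ofReal_mul zero_le_two]
  norm_num

end Memberships

/-! ### Extension by zero across the singular set -/

section Extension

variable {X : Type*} [MetricSpace X] {S : Set X}

theorem extend_val_comp (φ : ↥Sᶜ → ℝ) (x : ↥Sᶜ) :
    Function.extend Subtype.val φ 0 (x : X) = φ x := Subtype.val_injective.extend_apply _ _ _

theorem lipSlope_extend_val (hS : IsClosed S) (φ : ↥Sᶜ → ℝ) (x : ↥Sᶜ) :
    lipSlope (Function.extend Subtype.val φ 0) (x : X) = lipSlope φ x := by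
  rw [← lipSlope_comp_val hS.isOpen_compl]
  simp only [extend_val_comp]

/-- The support is compact in X and disjoint from S, so the extension vanishes near S; it is locally
Lipschitz with compact support in X, hence Lipschitz. -/
theorem LocallyLipschitz.exists_lipschitzWith_extend (hS : IsClosed S) {φ : ↥Sᶜ → ℝ}
    (h : LocallyLipschitz φ) (hc : HasCompactSupport φ) :
    ∃ K, LipschitzWith K (Function.extend Subtype.val φ (0 : X → ℝ)) := by
  have hT : IsCompact (Subtype.val '' tsupport φ) := hc.isCompact.image continuous_subtype_val
  have h0 : ∀ x ∉ Subtype.val '' tsupport φ, Function.extend Subtype.val φ (0 : X → ℝ) x = 0 := by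
    intro x hx
    by_cases hxS : x ∈ Sᶜ
    · rw [extend_val_comp φ ⟨x, hxS⟩]
      exact image_eq_zero_of_notMem_tsupport fun h => hx ⟨_, h, rfl⟩
    · exact Function.extend_apply' _ _ _ fun ⟨y, hy⟩ => hxS (hy ▸ y.2)
  refine LocallyLipschitz.exists_lipschitzWith (fun x => ?_) (HasCompactSupport.intro hT h0)
  by_cases hxS : x ∈ Sᶜ
  · obtain ⟨K, t, ht, hK⟩ := h ⟨x, hxS⟩
    refine ⟨K, Subtype.val '' t, ?_, ?_⟩
    · rw [← hS.isOpen_compl.isOpenEmbedding_subtypeVal.map_nhds_eq ⟨x, hxS⟩]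
      exact image_mem_map ht
    · rintro _ ⟨y, hy, rfl⟩ _ ⟨z, hz, rfl⟩
      rw [extend_val_comp, extend_val_comp]
      exact hK hy hz
  · refine ⟨0, _, hT.isClosed.isOpen_compl.mem_nhds fun ⟨y, _, hy⟩ => hxS (hy ▸ y.2),
      fun y hy z hz => ?_⟩
    rw [h0 y hy, h0 z hz]
    simp

end Extension

/-! ### The quadratic relation of test functions and its relaxation -/

namespace AsymptoticallyDpBrane

variable {p k : ℕ} {X : Type u} [MetricSpace X] {S : Set X}
  [ChartedSpace (EuclideanSpace ℝ (Fin (k + (9 - p)))) ↥Sᶜ]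
  [RiemannianBundle (fun x : ↥Sᶜ => TangentSpace (𝓡 (k + (9 - p))) x)]
  [MeasurableSpace X] [BorelSpace X]
  (D : AsymptoticallyDpBrane.{u, v} p k S)

theorem measurableEmbedding_val (D : AsymptoticallyDpBrane.{u, v} p k S) :
    MeasurableEmbedding (Subtype.val : ↥Sᶜ → X) :=
  MeasurableEmbedding.subtype_coe D.isClosed.measurableSet.compl

theorem memLp_measure_iff {F : X → ℝ} :
    MemLp F 2 D.measure ↔ MemLp (fun x : ↥Sᶜ => F x) 2 D.regMeasure :=
  D.measurableEmbedding_val.memLp_map_measure_iff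

theorem eLpNorm_measure (F : X → ℝ) :
    eLpNorm F 2 D.measure = eLpNorm (fun x : ↥Sᶜ => F x) 2 D.regMeasure :=
  D.measurableEmbedding_val.eLpNorm_map_measure

theorem ae_measure_iff {P : X → Prop} :
    (∀ᵐ x ∂D.measure, P x) ↔ ∀ᵐ x : ↥Sᶜ ∂D.regMeasure, P x :=
  D.measurableEmbedding_val.ae_map_iff

theorem ae_regMeasure_eq {D : AsymptoticallyDpBrane.{u, v} p k S} {F G : X → ℝ}
    (h : F =ᵐ[D.measure] G) : ∀ᵐ x : ↥Sᶜ ∂D.regMeasure, F x = G x :=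
  D.ae_measure_iff.1 h

theorem ae_eq_extend_iff {g : X → ℝ} {φ : ↥Sᶜ → ℝ} :
    g =ᵐ[D.measure] Function.extend Subtype.val φ 0 ↔ ∀ᵐ x : ↥Sᶜ ∂D.regMeasure, g x = φ x := by
  rw [EventuallyEq, D.ae_measure_iff]
  simp only [extend_val_comp]

/-- `g` is the class of a test function whose gradient has `L²` norm at most `c`. -/
def TestRel (g : Lp ℝ 2 D.measure) (c : ℝ) : Prop :=
  0 ≤ c ∧ ∃ φ : ↥Sᶜ → ℝ, ContMDiff (𝓡 (k + (9 - p))) 𝓘(ℝ, ℝ) ∞ φ ∧ HasCompactSupport φ ∧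
    g =ᵐ[D.measure] Function.extend Subtype.val φ 0 ∧
    eLpNorm (lipSlope φ) 2 D.regMeasure ≤ ENNReal.ofReal c

theorem locallyLipschitz_of_contMDiff (D : AsymptoticallyDpBrane.{u, v} p k S) {φ : ↥Sᶜ → ℝ}
    (hφ : ContMDiff (𝓡 (k + (9 - p))) 𝓘(ℝ, ℝ) ∞ φ) : LocallyLipschitz φ := by
  have := D.isManifold
  have := D.smoothMetric
  have := D.isRiemannianManifold
  exact hφ.locallyLipschitz

theorem memLp_lipSlope_test {φ : ↥Sᶜ → ℝ}
    (hφ : ContMDiff (𝓡 (k + (9 - p))) 𝓘(ℝ, ℝ) ∞ φ) (hc : HasCompactSupport φ) :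
    MemLp (lipSlope φ) 2 D.regMeasure := by
  have := D.isLocallyFiniteMeasure_regMeasure
  exact (D.locallyLipschitz_of_contMDiff hφ).memLp_lipSlope hc

theorem memLp_extend_test {φ : ↥Sᶜ → ℝ}
    (hφ : ContMDiff (𝓡 (k + (9 - p))) 𝓘(ℝ, ℝ) ∞ φ) (hc : HasCompactSupport φ) :
    MemLp (Function.extend Subtype.val φ 0) 2 D.measure := by
  have := D.isLocallyFiniteMeasure_regMeasure
  rw [D.memLp_measure_iff]
  simp only [extend_val_comp]
  exact hφ.continuous.memLp_of_hasCompactSupport hc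

theorem testRel_of_ae_eq {g : Lp ℝ 2 D.measure} {φ : ↥Sᶜ → ℝ}
    (hφ : ContMDiff (𝓡 (k + (9 - p))) 𝓘(ℝ, ℝ) ∞ φ) (hc : HasCompactSupport φ)
    (hg : g =ᵐ[D.measure] Function.extend Subtype.val φ 0) :
    D.TestRel g (eLpNorm (lipSlope φ) 2 D.regMeasure).toReal :=
  ⟨ENNReal.toReal_nonneg, φ, hφ, hc, hg,
    (ENNReal.ofReal_toReal (D.memLp_lipSlope_test hφ hc).2.ne).ge⟩

theorem testRel_zero : D.TestRel 0 0 := by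
  refine ⟨le_rfl, fun _ => 0, contMDiff_const, HasCompactSupport.zero, ?_, ?_⟩
  · rw [D.ae_eq_extend_iff]
    exact ae_regMeasure_eq (Lp.coeFn_zero ℝ 2 D.measure)
  · have h : lipSlope (fun _ : ↥Sᶜ => (0 : ℝ)) = 0 := funext fun x => lipSlope_eq_zero (c := 0) .rfl
    rw [h]
    simp

variable {D}

theorem TestRel.smul (a : ℝ) {g : Lp ℝ 2 D.measure} {c : ℝ} (h : D.TestRel g c) :
    D.TestRel (a • g) (|a| * c) := by
  obtain ⟨hc, φ, hφ, hφc, hg, hs⟩ := h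
  have hac : HasCompactSupport (a • φ) := hφc.mono fun x hx h => hx (by
    rw [Pi.smul_apply, h, smul_zero])
  have ha' : ContMDiff (𝓡 (k + (9 - p))) 𝓘(ℝ, ℝ) ∞ fun _ : ↥Sᶜ => a := contMDiff_const
  have ha : ContMDiff (𝓡 (k + (9 - p))) 𝓘(ℝ, ℝ) ∞ (a • φ) := ha'.smul hφ
  refine ⟨mul_nonneg (abs_nonneg a) hc, a • φ, ha, hac, ?_, ?_⟩
  · rw [D.ae_eq_extend_iff] at hg ⊢
    filter_upwards [hg, ae_regMeasure_eq (Lp.coeFn_smul a g)] with x h1 h2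
    rw [h2, Pi.smul_apply, Pi.smul_apply, h1]
  · rw [ENNReal.ofReal_mul (abs_nonneg a)]
    refine (eLpNorm_le_mul_eLpNorm_of_ae_le_mul (g := lipSlope φ) (c := |a|)
      (Eventually.of_forall fun x => ?_) 2).trans (by gcongr)
    rw [Real.norm_of_nonneg (lipSlope_nonneg _ _), Real.norm_of_nonneg (lipSlope_nonneg _ _)]
    exact lipSlope_smul_le a ((D.locallyLipschitz_of_contMDiff hφ).ptLip x)

theorem ae_eq_extend_add {f g : Lp ℝ 2 D.measure} {φ ψ : ↥Sᶜ → ℝ}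
    (hf : f =ᵐ[D.measure] Function.extend Subtype.val φ 0)
    (hg : g =ᵐ[D.measure] Function.extend Subtype.val ψ 0) :
    ↑(f + g) =ᵐ[D.measure] Function.extend Subtype.val (φ + ψ) 0 := by
  rw [D.ae_eq_extend_iff] at hf hg ⊢
  filter_upwards [hf, hg, ae_regMeasure_eq (Lp.coeFn_add f g)] with x h1 h2 h3
  rw [h3, Pi.add_apply, Pi.add_apply, h1, h2]

theorem ae_eq_extend_sub {f g : Lp ℝ 2 D.measure} {φ ψ : ↥Sᶜ → ℝ}
    (hf : f =ᵐ[D.measure] Function.extend Subtype.val φ 0)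
    (hg : g =ᵐ[D.measure] Function.extend Subtype.val ψ 0) :
    ↑(f - g) =ᵐ[D.measure] Function.extend Subtype.val (φ - ψ) 0 := by
  rw [D.ae_eq_extend_iff] at hf hg ⊢
  filter_upwards [hf, hg, ae_regMeasure_eq (Lp.coeFn_sub f g)] with x h1 h2 h3
  rw [h3, Pi.sub_apply, Pi.sub_apply, h1, h2]

theorem TestRel.add {f g : Lp ℝ 2 D.measure} {c d : ℝ} (hf : D.TestRel f c) (hg : D.TestRel g d) :
    D.TestRel (f + g) (c + d) := by
  obtain ⟨hc, φ, hφ, hφc, hf, hs⟩ := hf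
  obtain ⟨hd, ψ, hψ, hψc, hg, ht⟩ := hg
  refine ⟨add_nonneg hc hd, φ + ψ, hφ.add hψ, hφc.add hψc, ae_eq_extend_add hf hg, ?_⟩
  rw [ENNReal.ofReal_add hc hd]
  refine (eLpNorm_mono_real (g := lipSlope φ + lipSlope ψ) fun x => ?_).trans
    ((eLpNorm_add_le (D.memLp_lipSlope_test hφ hφc).1 (D.memLp_lipSlope_test hψ hψc).1
      (by norm_num)).trans (add_le_add hs ht))
  rw [Real.norm_of_nonneg (lipSlope_nonneg _ _)]
  exact lipSlope_add_le ((D.locallyLipschitz_of_contMDiff hφ).ptLip x)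
    ((D.locallyLipschitz_of_contMDiff hψ).ptLip x)

theorem TestRel.parallelogram {f g : Lp ℝ 2 D.measure} {c d : ℝ} (hf : D.TestRel f c)
    (hg : D.TestRel g d) : ∃ s t, D.TestRel (f + g) s ∧ D.TestRel (f - g) t ∧
      s ^ 2 + t ^ 2 ≤ 2 * (c ^ 2 + d ^ 2) := by
  obtain ⟨hc, φ, hφ, hφc, hf, hs⟩ := hf
  obtain ⟨hd, ψ, hψ, hψc, hg, ht⟩ := hg
  have := D.isManifold
  have := D.smoothMetric
  have := D.isRiemannianManifold
  have hadd : ContMDiff (𝓡 (k + (9 - p))) 𝓘(ℝ, ℝ) ∞ (φ + ψ) := hφ.add hψ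
  have hsub : ContMDiff (𝓡 (k + (9 - p))) 𝓘(ℝ, ℝ) ∞ (φ - ψ) := hφ.sub hψ
  have haddc : HasCompactSupport (φ + ψ) := hφc.add hψc
  have hsubc : HasCompactSupport (φ - ψ) := by
    rw [sub_eq_add_neg]
    exact hφc.add hψc.neg
  refine ⟨_, _, D.testRel_of_ae_eq hadd haddc (ae_eq_extend_add hf hg),
    D.testRel_of_ae_eq hsub hsubc (ae_eq_extend_sub hf hg), ?_⟩
  rw [← ENNReal.toReal_pow, ← ENNReal.toReal_pow,
    ← ENNReal.toReal_add (ENNReal.pow_ne_top (D.memLp_lipSlope_test hadd haddc).2.ne)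
      (ENNReal.pow_ne_top (D.memLp_lipSlope_test hsub hsubc).2.ne),
    eLpNorm_lipSlope_parallelogram hφ hψ]
  refine ENNReal.toReal_le_of_le_ofReal (by positivity) ?_
  rw [ENNReal.ofReal_mul zero_le_two, ENNReal.ofReal_add (sq_nonneg c) (sq_nonneg d),
    ENNReal.ofReal_pow hc, ENNReal.ofReal_pow hd, ENNReal.ofReal_ofNat]
  gcongr

variable (D)

theorem quadraticRelation_testRel : QuadraticRelation D.TestRel where
  nonneg := fun h => h.1
  zero := D.testRel_zero
  smul := fun a _ _ h => h.smul a
  add := TestRel.add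
  parallelogram := TestRel.parallelogram

theorem TestRel.lipRel {D : AsymptoticallyDpBrane.{u, v} p k S} {g : Lp ℝ 2 D.measure} {c : ℝ}
    (h : D.TestRel g c) : LipRel D.measure g c := by
  obtain ⟨hc, φ, hφ, hφc, hg, hs⟩ := h
  have hD : MemLp (lipSlope (Function.extend Subtype.val φ 0)) 2 D.measure := by
    rw [D.memLp_measure_iff]
    simp only [lipSlope_extend_val D.isClosed]
    exact D.memLp_lipSlope_test hφ hφc
  refine ⟨hD.toLp _, ⟨_, D.memLp_extend_test hφ hφc, hD, ?_, ?_, rfl⟩, ?_⟩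
  · exact (D.locallyLipschitz_of_contMDiff hφ).exists_lipschitzWith_extend D.isClosed hφc
  · exact Lp.ext (hg.trans (MemLp.coeFn_toLp _).symm)
  · rw [Lp.norm_toLp, D.eLpNorm_measure]
    simp only [lipSlope_extend_val D.isClosed]
    exact ENNReal.toReal_le_of_le_ofReal hc hs

variable [CompleteSpace X] [SecondCountableTopology X]

/-- The approximation theorem in the form used by relaxation: close in L², with arbitrarily small
increase of the norm of the slope. -/
theorem relax_testRel_of_lipRel (hp : p ≤ 7) (hvol : p = 6 ∨ p = 7 → D.FiniteVolumeFactors)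
    {g : Lp ℝ 2 D.measure} {c : ℝ} (h : LipRel D.measure g c) : Relax D.TestRel g c := by
  intro ε hε
  obtain ⟨_, ⟨F, hF, hD, ⟨K, hK⟩, rfl, rfl⟩, hc⟩ := h
  have hc0 : 0 ≤ c := (norm_nonneg _).trans hc
  have hFl : LocallyLipschitz fun x : ↥Sᶜ => F x :=
    hK.locallyLipschitz.comp (LipschitzWith.subtype_val Sᶜ).locallyLipschitz
  obtain ⟨φ, hφ, hφc, h1, h2⟩ := D.exists_smooth_approx hp hvol hFl (D.memLp_measure_iff.1 hF)
    (ENNReal.ofReal_pos.2 (half_pos hε))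
  refine ⟨(D.memLp_extend_test hφ hφc).toLp _, c + ε / 2,
    ⟨by positivity, φ, hφ, hφc, MemLp.coeFn_toLp _, ?_⟩, ?_, by linarith⟩
  · rw [ENNReal.ofReal_add hc0 (half_pos hε).le]
    refine h2.trans (add_le_add_left ?_ _)
    have h3 : (fun x : ↥Sᶜ => lipSlope F x) = lipSlope fun x : ↥Sᶜ => F x :=
      funext fun x => (lipSlope_comp_val D.isClosed.isOpen_compl F x).symm
    rw [Lp.norm_toLp, D.eLpNorm_measure, h3] at hc
    rw [D.memLp_measure_iff, h3] at hD
    exact (ENNReal.le_ofReal_iff_toReal_le hD.2.ne hc0).2 hc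
  · rw [← MemLp.toLp_sub, Lp.norm_toLp, D.eLpNorm_measure]
    simp only [Pi.sub_apply, extend_val_comp]
    exact (ENNReal.toReal_le_of_le_ofReal (half_pos hε).le h1).trans_lt (half_lt_self hε)

/-- Test functions extend to Lipschitz functions with the same slope norm, which gives one
direction. The converse combines the approximation theorem with the closedness of the relaxation. -/
theorem relax_testRel_iff (hp : p ≤ 7) (hvol : p = 6 ∨ p = 7 → D.FiniteVolumeFactors)
    (f : Lp ℝ 2 D.measure) (c : ℝ) : Relax D.TestRel f c ↔ Relax (LipRel D.measure) f c := by
  refine ⟨fun h ε hε => ?_, fun h => Relax.closed fun ε hε => ?_⟩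
  · obtain ⟨g, c', hA, h1, h2⟩ := h ε hε
    exact ⟨g, c', hA.lipRel, h1, h2⟩
  · obtain ⟨g, c', hA, h1, h2⟩ := h ε hε
    exact ⟨g, h1, (D.relax_testRel_of_lipRel hp hvol hA).mono h2.le⟩

end AsymptoticallyDpBrane

theorem proposition3p11 (p k : ℕ) (hp : p ≤ 7) {X : Type u} [MetricSpace X]
    [CompleteSpace X] [SecondCountableTopology X] [MeasurableSpace X] [BorelSpace X] (S : Set X)
    [ChartedSpace (EuclideanSpace ℝ (Fin (k + (9 - p)))) ↥Sᶜ]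
    [RiemannianBundle (fun x : ↥Sᶜ => TangentSpace (𝓡 (k + (9 - p))) x)]
    (D : AsymptoticallyDpBrane.{u, v} p k S)
    (hvol : p = 6 ∨ p = 7 → D.FiniteVolumeFactors) :
    ∃ (W : Type u) (_ : NormedAddCommGroup W) (_ : InnerProductSpace ℝ W)
      (j : W →ₗ[ℝ] Lp ℝ 2 D.measure),
      IsSobolevHilbertSpace D.measure W j ∧
      (∀ φ : ↥Sᶜ → ℝ, ContMDiff (𝓡 (k + (9 - p))) 𝓘(ℝ, ℝ) ∞ φ → HasCompactSupport φ →
        ∃ u : W, j u =ᵐ[D.measure] Function.extend Subtype.val φ 0) ∧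
      ∃ W₀ : Submodule ℝ W,
        (W₀ : Set W) = closure (j ⁻¹' D.testFunctions) ∧
        W₀ = ⊤ ∧
        ∃ e : W₀ ≃ₗᵢ[ℝ] W, ∀ u : W₀, e u = (u : W) := by
  have hA := D.quadraticRelation_testRel
  refine ⟨hA.Space, inferInstance, inferInstance, hA.incl,
    hA.isSobolevHilbertSpace (D.relax_testRel_iff hp hvol), fun φ hφ hφc => ?_,
    ⊤, ?_, rfl, LinearIsometryEquiv.ofTop _ ⊤ rfl, fun u => rfl⟩
  · have h := D.testRel_of_ae_eq hφ hφc (MemLp.coeFn_toLp (D.memLp_extend_test hφ hφc))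
    exact ⟨⟨_, _, Relax.of_rel h⟩, MemLp.coeFn_toLp (D.memLp_extend_test hφ hφc)⟩
  -- Density: the relaxation starts from test functions, so each element of its domain is a limit of
  -- test functions in the graph norm.
  · refine (Set.eq_univ_of_forall fun u => Metric.mem_closure_iff.2 fun ε hε => ?_).symm
    obtain ⟨w, ⟨c, -, φ, hφ, hφc, hw, -⟩, h⟩ := hA.exists_rel_norm_sub_lt u hε
    exact ⟨w, ⟨φ, hφ, hφc, hw⟩, by rwa [dist_comm, dist_eq_norm]⟩

end
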